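/- **Setting.** Fix an integer $k\ge 1$ and a real $r>0$. Let $W^k_r$ be the set of all 1-periodic, $k$ times continuously differentiable functions $f:\mathbb R\to\mathbb R$ with $\sum_{j=0}^k\|f^{(j)}\|^2\le r$, where $\|f\|^2=\int_0^1 f^2(t)\,dt$; its elements are also regarded as elements of $C[0,1]$. Let $g:[0,1]\times C[0,1]\to[0,\infty)$ be such that $g(\cdot,S)$ is square integrable on $[0,1]$ for every $S$, and $g(x,S)>0$ for all $x\in[0,1]$ and $S\in W^k_r$. For each $n$ one observes $$y_j=S(x_j)+g(x_j,S)\,\xi_j,\qquad x_j=j/n,\quad 1\le j\le n,$$ where the distribution $p$ of $(\xi_1,\dots,\xi_n)$ is unknown and belongs to the family $\mathcal P_n$ of distributions on $\mathbb R^n$ with independent, centered components of unit variance such that $\max_{1\le j\le n}\mathbf E\,\xi_j^4\le l^*_n$. Here $l^*_n\ge 3$ is a given sequence with $l^*_n\to\infty$ and $l^*_n/n^{\nu}\to0$ for every $\nu>0$. An estimator $\widehat S_n$ is a function $(y,x)\mapsto\widehat S_n(y)(x)$ on $\mathbb R^n\times[0,1]$ that is jointly measurable. With $\|u\|_n^2=\frac1n\sum_{j=1}^n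 u(x_j)^2$ and $\mathbf E_{S,p}$ the expectation over the observations, put $$\mathcal R_n(\widehat S_n,S)=\sup_{p\in\mathcal P_n}\mathbf E_{S,p}\|\widehat S_n-S\|_n^2,\qquad \mathcal T_n(\widehat S_n,S)=\sup_{p\in\mathcal P_n}\mathbf E_{S,p}\|\widehat S_n-S\|^2$$ (values in $[0,\infty]$), and $$\gamma_k(S)=\Gamma^*_k\,r^{\frac1{2k+1}}\,\varsigma(S)^{\frac{2k}{2k+1}},\quad \varsigma(S)=\int_0^1 g^2(x,S)\,dx,\quad \Gamma_k^*=(2k+1)^{\frac1{2k+1}}\Bigl(\frac{k}{\pi(k+1)}\Bigr)^{\frac{2k}{2k+1}}.$$ **Theorem 4.3.** Assume moreover: * (H2) for every $x\in[0,1]$ the functional $g^2(x,\cdot):C[0,1]\to\mathbb R$ is Fréchet differentiable (for the supremum norm $\|\cdot\|_\infty$) at every $S\in C[0,1]$, with derivative $\mathbf L_{x,S}$; * (H3) there is a constant $C^*>0$ such that for all $x\in[0,1]$ and $S,f\in C[0,1]$, $$|\mathbf L_{x,S}(f)|\le C^*\Bigl(|S(x)f(x)|+\int_0^1|f(t)|\,dt+\|S\|\,\|f\|\Bigr);$$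 * (H4) $g(\cdot,0)$ is continuous on $[0,1]$ and $\displaystyle\lim_{\delta\to0}\ \sup_{0\le x\le1}\ \sup_{\|S\|_\infty\le\delta}|g(x,S)-g(x,0)|=0$. Then $$\liminf_{n\to\infty}\,n^{\frac{2k}{2k+1}}\,\inf_{\widehat S_n}\,\sup_{S\in W^k_r}\frac{\mathcal R_n(\widehat S_n,S)}{\gamma_k(S)}\ \ge\ 1 \qquad\text{and}\qquad \liminf_{n\to\infty}\,n^{\frac{2k}{2k+1}}\,\inf_{\widehat S_n}\,\sup_{S\in W^k_r}\frac{\mathcal T_n(\widehat S_n,S)}{\gamma_k(S)}\ \ge\ 1,$$ where the infima are over all estimators based on $n$ observations. -/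

import Mathlib

open MeasureTheory ProbabilityTheory Filter Topology unitInterval
open scoped ENNReal

noncomputable section

namespace Pinsker

/-! ### The Sobolev class -/

/-- The class `W^k_r`: the 1-periodic functions `f : ℝ → ℝ` of class `C^k` such that
`∑_{j=0}^k ‖f^{(j)}‖² ≤ r`, where `‖·‖` is the norm of `L²[0,1]`. -/
def sobolevClass (k : ℕ) (r : ℝ) : Set (ℝ → ℝ) :=
  {f | ContDiff ℝ k f ∧ Function.Periodic f 1 ∧
    (∑ j ∈ Finset.range (k + 1), ∫ t in (0 : ℝ)..1, (iteratedDeriv j f t) ^ 2) ≤ r}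

/-- The restriction to `[0,1]` of a function of the class `W^k_r`. -/
def restrict {k : ℕ} {r : ℝ} (S : sobolevClass k r) : C(I, ℝ) where
  toFun x := S.1 x
  continuous_toFun := S.2.1.continuous.comp continuous_subtype_val

/-! ### The scale functional -/

/-- The norm of `L²[0,1]`. -/
def l2norm (f : C(I, ℝ)) : ℝ := Real.sqrt (∫ x, (f x) ^ 2)

/-- The norm of `L¹[0,1]`. -/
def l1norm (f : C(I, ℝ)) : ℝ := ∫ x, |f x|

/-- `g` takes nonnegative values and is square integrable with respect to its first argument. -/
def IsScale (g : I → C(I, ℝ) → ℝ) : Prop :=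
  (∀ x S, 0 ≤ g x S) ∧ ∀ S, MemLp (fun x => g x S) 2

/-- For every `x`, the functional `g²(x, ·)` is Fréchet differentiable on `C[0,1]`
(with the supremum norm). -/
def CondH2 (g : I → C(I, ℝ) → ℝ) : Prop :=
  ∀ x, Differentiable ℝ (fun S : C(I, ℝ) => (g x S) ^ 2)

/-- The Fréchet derivative `L_{x,S}` of `g²(x, ·)` at `S` satisfies, with one constant `C > 0`,
`|L_{x,S}(f)| ≤ C (|S(x) f(x)| + |f|₁ + ‖S‖ ‖f‖)`. -/
def CondH3 (g : I → C(I, ℝ) → ℝ) : Prop :=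
  ∃ C : ℝ, 0 < C ∧ ∀ (x : I) (S f : C(I, ℝ)),
    |fderiv ℝ (fun u : C(I, ℝ) => (g x u) ^ 2) S f| ≤
      C * (|S x * f x| + l1norm f + l2norm S * l2norm f)

/-- `g(·, 0)` is continuous on `[0,1]`, and `g(x, S) → g(x, 0)` as `‖S‖_∞ → 0`,
uniformly in `x`. -/
def CondH4 (g : I → C(I, ℝ) → ℝ) : Prop :=
  Continuous (fun x => g x 0) ∧
    ∀ ε : ℝ, 0 < ε → ∃ δ : ℝ, 0 < δ ∧ ∀ S : C(I, ℝ), ‖S‖ ≤ δ → ∀ x, |g x S - g x 0| ≤ ε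

/-! ### The regression model -/

/-- The design points `x_j = j/n`, `1 ≤ j ≤ n`; the index `j : Fin n` stands for `j + 1`. -/
def design (n : ℕ) (j : Fin n) : I :=
  ⟨((j : ℝ) + 1) / n, by positivity, by
    have h : ((j : ℕ) : ℝ) + 1 ≤ n := by exact_mod_cast j.2
    exact div_le_one_of_le₀ h (Nat.cast_nonneg n)⟩

/-- The family of the distributions on `ℝⁿ` of random vectors with independent centered
components of unit variance whose fourth moments are at most `l`. -/
def noiseFamily (n : ℕ) (l : ℝ) : Set (Measure (Fin n → ℝ)) :=
  {p | IsProbabilityMeasure p ∧ iIndepFun (fun (j : Fin n) (ξ : Fin n → ℝ) => ξ j) p ∧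
    ∀ j : Fin n, MemLp (fun ξ : Fin n → ℝ => ξ j) 4 p ∧
      ∫ ξ, ξ j ∂p = 0 ∧ ∫ ξ, (ξ j) ^ 2 ∂p = 1 ∧ ∫ ξ, (ξ j) ^ 4 ∂p ≤ l}

/-- The distribution of the observations `y_j = S(x_j) + g(x_j, S) ξ_j`, where `ξ` has
distribution `p`. -/
def obsLaw (g : I → C(I, ℝ) → ℝ) {n : ℕ} (S : C(I, ℝ)) (p : Measure (Fin n → ℝ)) :
    Measure (Fin n → ℝ) :=
  p.map fun ξ j => S (design n j) + g (design n j) S * ξ j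

/-- An estimator of the regression function: a map sending the observations `y ∈ ℝⁿ` to a function
on `[0,1]`, jointly measurable in `y` and the argument of the function. -/
def Estimator (n : ℕ) : Type :=
  {T : (Fin n → ℝ) → I → ℝ // Measurable (Function.uncurry T)}

/-- The risk with respect to the empirical norm `‖u‖_n² = n⁻¹ ∑ u(x_j)²`. -/
def riskEmp (g : I → C(I, ℝ) → ℝ) (l : ℝ) {n : ℕ} (T : Estimator n) (S : C(I, ℝ)) : ℝ≥0∞ :=
  ⨆ p ∈ noiseFamily n l,
    ∫⁻ y, ENNReal.ofReal ((1 / (n : ℝ)) * ∑ j, (T.1 y (design n j) - S (design n j)) ^ 2) ∂(obsLaw g S p)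

/-- The risk with respect to the norm of `L²[0,1]`; the loss is `∞` if the estimate is not square
integrable. -/
def riskL2 (g : I → C(I, ℝ) → ℝ) (l : ℝ) {n : ℕ} (T : Estimator n) (S : C(I, ℝ)) : ℝ≥0∞ :=
  ⨆ p ∈ noiseFamily n l,
    ∫⁻ y, (∫⁻ x, ENNReal.ofReal ((T.1 y x - S x) ^ 2)) ∂(obsLaw g S p)

/-! ### The Pinsker constant -/

/-- `ς(S) = ∫₀¹ g²(x, S) dx`. -/
def varsigma (g : I → C(I, ℝ) → ℝ) (S : C(I, ℝ)) : ℝ := ∫ x, (g x S) ^ 2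

/-- `Γ*_k = (2k+1)^{1/(2k+1)} (k / (π (k+1)))^{2k/(2k+1)}`. -/
def gammaStar (k : ℕ) : ℝ :=
  (2 * k + 1 : ℝ) ^ (1 / (2 * k + 1) : ℝ) *
    (k / (Real.pi * (k + 1)) : ℝ) ^ (2 * k / (2 * k + 1) : ℝ)

/-- `γ_k(S) = Γ*_k r^{1/(2k+1)} ς(S)^{2k/(2k+1)}`. -/
def pinsker (g : I → C(I, ℝ) → ℝ) (k : ℕ) (r : ℝ) (S : C(I, ℝ)) : ℝ :=
  gammaStar k * r ^ (1 / (2 * k + 1) : ℝ) * varsigma g S ^ (2 * k / (2 * k + 1) : ℝ)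

end Pinsker

end

noncomputable section

namespace Pinsker

/-! ### Moments of the standard normal distribution -/

/-! The bound is of Pinsker type, with a least favourable prior concentrated near `S = 0`. Standard
normal noise belongs to the noise family because its fourth moment is 3, so it suffices to bound the
risk in a normal model with means `S (x_j)` and variances `g² (x_j, S)`. The supremum over the class
is then bounded below by an average over a prior carried by a finite-dimensional subfamily.

Cut `[0,1]` into a fixed number `M` of windows of length `h = q/n`, where `q` is the integer part of
`n/M`. In each window place rescaled sines of frequencies `i₀ ≤ i < N`, with `N ≈ b h n^{1/(2k+1)}`,
multiplied by a smooth cutoff. The frequencies start at a large constant `i₀` for two reasons. A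
fixed cutoff then changes the Sobolev norm only by a factor close to 1 (`exists_cutoff_sobolev`,
`exists_mem_sobolevClass`). Moreover the functions of the ellipsoid `∑ a_α θ_α² < R`, `a = (π i /
h)^{2k}`, are uniformly small (`norm_synth_sq_le`). On so small a ball `g²` is close to `g² (·, 0)`,
hence nearly a constant `σ_m` in window `m`. The derivative bound on `g²` makes the information
carried by the variances a small fraction of `n`, so one coefficient has information at most about
`n / σ_m` (`info_bound`).

The prior is a product of centred normal laws with variances `w = (σ_m / n) ((N/i)^k - 1)`,
multiplied by a smooth cutoff supported inside the ellipsoid. No coordinate carries a noticeable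
part of the energy `∑ a w`, so Chebyshev's inequality shows that the truncation loses almost no mass
(`prior_mass_ge`) and it adds almost nothing to the information of the prior. The van Trees
inequality, that is, integration by parts and Cauchy–Schwarz, bounds each coordinate risk below by
nearly `1 / (n/σ_m + 1/w) = (σ_m / n) (1 - (i/N)^k)` (`bayes_coordinate`). Bessel's inequality for
the sines without cutoff, which are orthonormal both for Lebesgue measure and for the design
measure, bounds the loss below by the sum of the coordinate losses (`bayes_family`). One argument
therefore serves both risks.

Power sums finish the computation. The energy is about `ς(0) π^{2k} b^{2k+1} k/((k+1)(2k+1))`, which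
fixes `b` by the budget `r`. The total risk is about `n^{-2k/(2k+1)} ς(0) b k/(k+1)`, which for this
`b` is `n^{-2k/(2k+1)} γ_k(0)` (`pinsker_eq`). Near zero `γ_k(S) ≤ (1+ε) γ_k(0)`. All losses are
collected in `efficiency ε`, which tends to 1 as `ε → 0`. -/

lemma integrable_pow_std (p : ℕ) : Integrable (fun x : ℝ => x ^ p) (gaussianReal 0 1) := by
  rcases Nat.eq_zero_or_pos p with rfl | hp
  · simp
  · have h := (memLp_id_gaussianReal (μ := 0) (v := 1) (p : NNReal)).integrable_norm_pow
      (by exact_mod_cast hp.ne')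
    refine (integrable_norm_iff (by fun_prop)).1 ?_
    simpa using h

lemma gaussianPDFReal_std (x : ℝ) :
    gaussianPDFReal 0 1 x = (Real.sqrt (2 * Real.pi))⁻¹ * Real.exp (-x ^ 2 / 2) := by
  simp [gaussianPDFReal]

lemma hasDerivAt_gaussianPDFReal_std (x : ℝ) :
    HasDerivAt (gaussianPDFReal 0 1) (-x * gaussianPDFReal 0 1 x) x := by
  have h : HasDerivAt (fun x : ℝ => (Real.sqrt (2 * Real.pi))⁻¹ * Real.exp (-x ^ 2 / 2))
      ((Real.sqrt (2 * Real.pi))⁻¹ * (Real.exp (-x ^ 2 / 2) * (-(2 * x) / 2))) x := by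
    have := (((hasDerivAt_pow 2 x).neg.div_const 2).exp).const_mul (Real.sqrt (2 * Real.pi))⁻¹
    simpa using this
  have he : gaussianPDFReal 0 1 =
      fun x : ℝ => (Real.sqrt (2 * Real.pi))⁻¹ * Real.exp (-x ^ 2 / 2) :=
    funext gaussianPDFReal_std
  rw [he]
  convert h using 1
  ring

lemma integrable_pow_mul_pdf (p : ℕ) :
    Integrable (fun x : ℝ => x ^ p * gaussianPDFReal 0 1 x) := by
  have h := integrable_pow_std p
  rw [gaussianReal_of_var_ne_zero _ one_ne_zero,
    integrable_withDensity_iff_integrable_smul₀' (by fun_prop)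
      (ae_of_all _ fun _ => gaussianPDF_lt_top)] at h
  simpa [toReal_gaussianPDF, mul_comm] using h

lemma integral_std (f : ℝ → ℝ) :
    ∫ x, f x ∂(gaussianReal 0 1) = ∫ x, f x * gaussianPDFReal 0 1 x := by
  rw [integral_gaussianReal_eq_integral_smul one_ne_zero]
  simp [mul_comm]

/-- Stein's recursion for the moments of the standard normal distribution. -/
lemma integral_pow_std_succ (p : ℕ) :
    ∫ x, x ^ (p + 2) ∂(gaussianReal 0 1) = (p + 1) * ∫ x, x ^ p ∂(gaussianReal 0 1) := by
  rw [integral_std, integral_std]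
  have h : ∫ x : ℝ, ((p + 1) * (x ^ p * gaussianPDFReal 0 1 x)
      - x ^ (p + 2) * gaussianPDFReal 0 1 x) = 0 := by
    refine integral_eq_zero_of_hasDerivAt_of_integrable
      (f := fun x => x ^ (p + 1) * gaussianPDFReal 0 1 x) (fun x => ?_)
      (((integrable_pow_mul_pdf p).const_mul _).sub (integrable_pow_mul_pdf (p + 2)))
      (integrable_pow_mul_pdf (p + 1))
    refine ((hasDerivAt_pow (p + 1) x).mul (hasDerivAt_gaussianPDFReal_std x)).congr_deriv ?_
    push_cast
    ring
  rw [integral_sub ((integrable_pow_mul_pdf p).const_mul _) (integrable_pow_mul_pdf (p + 2)),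
    integral_const_mul] at h
  linarith

lemma integral_std_one : ∫ x, x ∂(gaussianReal 0 1) = 0 := by simp

lemma integral_std_two : ∫ x, x ^ 2 ∂(gaussianReal 0 1) = 1 := by
  have := integral_pow_std_succ 0
  simpa using this

lemma integral_std_three : ∫ x, x ^ 3 ∂(gaussianReal 0 1) = 0 := by
  have := integral_pow_std_succ 1
  simpa using this

lemma integral_std_four : ∫ x, x ^ 4 ∂(gaussianReal 0 1) = 3 := by
  have := integral_pow_std_succ 2
  rw [integral_std_two] at this
  norm_num at this
  exact this

/-- The first two moments of a quadratic polynomial without constant term after centring. -/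
lemma integral_quadratic_std (α β : ℝ) :
    ∫ x, (α * x + β * (x ^ 2 - 1)) ∂(gaussianReal 0 1) = 0 := by
  have i1 : Integrable (fun x : ℝ => x) (gaussianReal 0 1) := by
    simpa using integrable_pow_std 1
  have i2 : Integrable (fun x : ℝ => β * (x ^ 2 - 1)) (gaussianReal 0 1) :=
    ((integrable_pow_std 2).sub (integrable_const 1)).const_mul _
  rw [integral_add (i1.const_mul _) i2, integral_const_mul, integral_const_mul, integral_sub
      (integrable_pow_std 2)
      (integrable_const 1), integral_std_one, integral_std_two]
  simp

/-- The Hermite polynomials `x` and `x² - 1` are orthogonal with squared norms 1 and 2. This is why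
mean and variance contribute separately to the Fisher information. -/
lemma integral_quadratic_sq_std (α β : ℝ) :
    ∫ x, (α * x + β * (x ^ 2 - 1)) ^ 2 ∂(gaussianReal 0 1) = α ^ 2 + 2 * β ^ 2 := by
  have i1 : Integrable (fun x : ℝ => x) (gaussianReal 0 1) := by
    simpa using integrable_pow_std 1
  have h : ∀ x : ℝ, (α * x + β * (x ^ 2 - 1)) ^ 2 =
      (β ^ 2 * x ^ 4 + 2 * α * β * x ^ 3) +
          (((α ^ 2 - 2 * β ^ 2) * x ^ 2 - 2 * α * β * x) + β ^ 2) := by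
    intro x; ring
  simp_rw [h]
  rw [integral_add, integral_add, integral_add, integral_sub, integral_const_mul,
    integral_const_mul, integral_const_mul, integral_const_mul, integral_std_four,
    integral_std_three, integral_std_two, integral_std_one]
  · simp; ring
  all_goals first
    | exact (integrable_pow_std _).const_mul _
    | exact i1.const_mul _
    | exact integrable_const _
    | exact ((integrable_pow_std _).const_mul _).sub (i1.const_mul _)
    | exact ((integrable_pow_std _).const_mul _).add ((integrable_pow_std _).const_mul _)
    | exact (((integrable_pow_std _).const_mul _).sub (i1.const_mul _)).add (integrable_const _)

/-! ### The normal density as a function of its parameters -/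

/-- The logarithmic derivative of the normal density with mean `m` and variance `v`, when the mean
has derivative `a` and the variance has derivative `b`. -/
def score (a b m v y : ℝ) : ℝ := a * (y - m) / v + b * ((y - m) ^ 2 - v) / (2 * v ^ 2)

lemma gaussianReal_eq_map (m : ℝ) {v : ℝ} (hv : 0 ≤ v) :
    gaussianReal m v.toNNReal = (gaussianReal 0 1).map (fun x => m + Real.sqrt v * x) := by
  have h1 : (fun x => m + Real.sqrt v * x) = (fun x => m + x) ∘ (fun x => Real.sqrt v * x) := rfl
  rw [h1, ← Measure.map_map (by fun_prop) (by fun_prop), gaussianReal_map_const_mul,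
    gaussianReal_map_const_add]
  congr 1
  · simp
  · ext; simp [Real.sq_sqrt hv, hv]

/-- In the standardized variable the score is a combination of the first two Hermite polynomials, so
its moments reduce to those of the standard normal law. -/
lemma score_affine (a b m : ℝ) {v : ℝ} (hv : 0 < v) (x : ℝ) :
    score a b m v (m + Real.sqrt v * x) = a / Real.sqrt v * x + b / (2 * v) * (x ^ 2 - 1) := by
  have h : Real.sqrt v ≠ 0 := (Real.sqrt_pos.2 hv).ne'
  have h2 : Real.sqrt v ^ 2 = v := Real.sq_sqrt hv.le
  unfold score
  rw [add_sub_cancel_left, mul_pow, h2]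
  have h3 : a * (Real.sqrt v * x) / v = a / Real.sqrt v * x := by
    rw [div_mul_eq_mul_div, div_eq_div_iff hv.ne' h]
    linear_combination -(a * x) * (-h2)
  rw [h3]
  field_simp

@[fun_prop]
lemma continuous_score (a b m v : ℝ) : Continuous (score a b m v) := by
  unfold score; fun_prop

lemma integral_score (a b m : ℝ) {v : ℝ} (hv : 0 < v) :
    ∫ y, score a b m v y ∂(gaussianReal m v.toNNReal) = 0 := by
  rw [gaussianReal_eq_map m hv.le, integral_map (by fun_prop) (by fun_prop)]
  simp_rw [score_affine a b m hv]
  exact integral_quadratic_std _ _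

lemma integral_score_sq (a b m : ℝ) {v : ℝ} (hv : 0 < v) :
    ∫ y, score a b m v y ^ 2 ∂(gaussianReal m v.toNNReal) = a ^ 2 / v + b ^ 2 / (2 * v ^ 2) := by
  rw [gaussianReal_eq_map m hv.le, integral_map (by fun_prop)
    (by exact ((continuous_score _ _ _ _).pow 2).aestronglyMeasurable)]
  simp_rw [score_affine a b m hv]
  rw [integral_quadratic_sq_std, div_pow, Real.sq_sqrt hv.le]
  field_simp

lemma memLp_score (a b m : ℝ) {v : ℝ} (hv : 0 < v) :
    MemLp (score a b m v) 2 (gaussianReal m v.toNNReal) := by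
  rw [gaussianReal_eq_map m hv.le, memLp_map_measure_iff (by fun_prop) (by fun_prop)]
  have : score a b m v ∘ (fun x => m + Real.sqrt v * x) =
      fun x => a / Real.sqrt v * x + b / (2 * v) * (x ^ 2 - 1) :=
    funext (score_affine a b m hv)
  rw [this]
  have h1 : MemLp (fun x : ℝ => x) 2 (gaussianReal 0 1) :=
    memLp_id_gaussianReal' 2 (by simp)
  have h2 : MemLp (fun x : ℝ => x ^ 2) 2 (gaussianReal 0 1) := by
    rw [memLp_two_iff_integrable_sq (by fun_prop)]
    simpa [← pow_mul] using integrable_pow_std 4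
  exact (h1.const_mul _).add ((h2.sub (memLp_const 1)).const_mul _)

lemma hasDerivAt_gaussianPDFReal {m v : ℝ → ℝ} {m' v' t : ℝ} (y : ℝ) (hm : HasDerivAt m m' t)
    (hv : HasDerivAt v v' t) (hpos : 0 < v t) :
    HasDerivAt (fun s => gaussianPDFReal (m s) (v s).toNNReal y)
      (gaussianPDFReal (m t) (v t).toNNReal y * score m' v' (m t) (v t) y) t := by
  -- `toNNReal` is the identity only on nonnegative variances; continuity of `v` at `t` provides a
  -- neighbourhood where it can be dropped.
  have he : (fun s => gaussianPDFReal (m s) (v s).toNNReal y) =ᶠ[𝓝 t]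
      fun s => (Real.sqrt (2 * Real.pi * v s))⁻¹ * Real.exp (-(y - m s) ^ 2 / (2 * v s)) := by
    filter_upwards [hv.continuousAt.eventually (lt_mem_nhds hpos)] with s hs
    simp [gaussianPDFReal, Real.coe_toNNReal _ (le_of_lt hs)]
  refine HasDerivAt.congr_of_eventuallyEq ?_ he
  have hc : 0 < 2 * Real.pi * v t := by positivity
  have hsq : Real.sqrt (2 * Real.pi * v t) ≠ 0 := (Real.sqrt_pos.2 hc).ne'
  have h1 := ((hv.const_mul (2 * Real.pi)).sqrt hc.ne').fun_inv hsq
  have h2 := ((((hm.const_sub y).pow 2).neg).div (hv.const_mul 2) (by positivity)).exp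
  refine (h1.mul h2).congr_deriv ?_
  simp only [gaussianPDFReal, Real.coe_toNNReal _ hpos.le, score, Pi.pow_apply, Pi.neg_apply,
    Pi.div_apply]
  generalize Real.exp (-(y - m t) ^ 2 / (2 * v t)) = E
  rw [Real.sq_sqrt hc.le]
  field_simp
  ring

/-! ### Products of normal distributions -/

variable {ι : Type*} [Fintype ι]

/-- The density of a product of normal distributions. -/
def prodPDF (m v : ι → ℝ) (y : ι → ℝ) : ℝ := ∏ i, gaussianPDFReal (m i) (v i).toNNReal (y i)

lemma prodPDF_nonneg (m v y : ι → ℝ) : 0 ≤ prodPDF m v y :=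
  Finset.prod_nonneg fun _ _ => gaussianPDFReal_nonneg _ _ _

/-- A product of normal distributions. -/
def prodGaussian (m v : ι → ℝ) : Measure (ι → ℝ) :=
  Measure.pi fun i => gaussianReal (m i) (v i).toNNReal

instance (m v : ι → ℝ) : IsProbabilityMeasure (prodGaussian m v) := by
  unfold prodGaussian; infer_instance

lemma measurable_prodPDF_uncurry {α : Type*} [MeasurableSpace α] {m v y : α → ι → ℝ}
    (hm : Measurable m) (hv : Measurable v) (hy : Measurable y) :
    Measurable fun x => prodPDF (m x) (v x) (y x) := by
  unfold prodPDF
  refine Finset.measurable_prod _ fun i _ => ?_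
  exact measurable_uncurry_gaussianPDFReal.comp
    (((measurable_pi_iff.1 hm i)).prodMk ((measurable_pi_iff.1 hv i).real_toNNReal.prodMk
      (measurable_pi_iff.1 hy i)))

/-- A product measure is determined by its values on boxes, and there the restricted density is a
product of functions of one variable. -/
lemma prodGaussian_eq_withDensity (m v : ι → ℝ) (hv : ∀ i, 0 < v i) :
    prodGaussian m v = volume.withDensity fun y => ENNReal.ofReal (prodPDF m v y) := by
  refine Measure.pi_eq fun s hs => ?_
  have hv' : ∀ i, (v i).toNNReal ≠ 0 := fun i => by simpa using hv i
  rw [withDensity_apply _ (MeasurableSet.univ_pi hs), ← lintegral_indicator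
      (MeasurableSet.univ_pi hs)]
  have h1 : ∀ y : ι → ℝ, (Set.univ.pi s).indicator (fun y => ENNReal.ofReal (prodPDF m v y)) y
      = ENNReal.ofReal (∏ i, (s i).indicator (gaussianPDFReal (m i) (v i).toNNReal) (y i)) := by
    intro y
    by_cases hy : y ∈ Set.univ.pi s
    · rw [Set.indicator_of_mem hy, prodPDF]
      congr 1
      exact Finset.prod_congr rfl fun i _ => by
        rw [Set.indicator_of_mem (hy i (Set.mem_univ i))]
    · rw [Set.indicator_of_notMem hy]
      simp only [Set.mem_pi, Set.mem_univ, true_imp_iff, not_forall] at hy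
      obtain ⟨i, hi⟩ := hy
      rw [Finset.prod_eq_zero (Finset.mem_univ i) (Set.indicator_of_notMem hi _)]
      simp
  simp_rw [h1]
  have hint : ∀ i, Integrable ((s i).indicator (gaussianPDFReal (m i) (v i).toNNReal)) :=
    fun i => (integrable_gaussianPDFReal _ _).indicator (hs i)
  rw [← ofReal_integral_eq_lintegral_ofReal]
  · rw [integral_fintype_prod_volume_eq_prod, ENNReal.ofReal_prod_of_nonneg]
    · refine Finset.prod_congr rfl fun i _ => ?_
      rw [integral_indicator (hs i), gaussianReal_apply_eq_integral _ (hv' i)]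
    · intro i _
      exact integral_nonneg fun y => Set.indicator_nonneg
          (fun _ _ => gaussianPDFReal_nonneg _ _ _) y
  · exact Integrable.fintype_prod hint
  · exact ae_of_all _ fun y => Finset.prod_nonneg fun i _ =>
      Set.indicator_nonneg (fun _ _ => gaussianPDFReal_nonneg _ _ _) _

lemma lintegral_prodGaussian (m v : ι → ℝ) (hv : ∀ i, 0 < v i) (F : (ι → ℝ) → ℝ≥0∞) :
    ∫⁻ y, F y ∂(prodGaussian m v) = ∫⁻ y, ENNReal.ofReal (prodPDF m v y) * F y := by
  rw [prodGaussian_eq_withDensity m v hv, lintegral_withDensity_eq_lintegral_mul_non_measurable]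
  · rfl
  · exact (measurable_prodPDF_uncurry measurable_const measurable_const
      measurable_id).ennreal_ofReal
  · exact ae_of_all _ fun _ => ENNReal.ofReal_lt_top

lemma integral_sq_gaussianReal {w : ℝ} (hw : 0 ≤ w) :
    ∫ x, x ^ 2 ∂(gaussianReal 0 w.toNNReal) = w := by
  rw [gaussianReal_eq_map 0 hw, integral_map (by fun_prop) (by fun_prop)]
  simp_rw [zero_add, mul_pow, Real.sq_sqrt hw]
  rw [integral_const_mul, integral_std_two, mul_one]

lemma integral_four_gaussianReal {w : ℝ} (hw : 0 ≤ w) :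
    ∫ x, x ^ 4 ∂(gaussianReal 0 w.toNNReal) = 3 * w ^ 2 := by
  rw [gaussianReal_eq_map 0 hw, integral_map (by fun_prop) (by fun_prop)]
  have h : √w ^ 4 = w ^ 2 := by rw [show 4 = 2 * 2 from rfl, pow_mul, Real.sq_sqrt hw]
  simp_rw [zero_add, mul_pow, h]
  rw [integral_const_mul, integral_std_four, mul_comm]

lemma memLp_sq_gaussianReal (m : ℝ) (w : NNReal) :
    MemLp (fun x : ℝ => x ^ 2) 2 (gaussianReal m w) := by
  rw [memLp_two_iff_integrable_sq (by fun_prop)]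
  have h := (memLp_id_gaussianReal (μ := m) (v := w) (4 : NNReal)).integrable_norm_pow
    (p := 4) (by norm_num)
  refine h.congr (ae_of_all _ fun x => ?_)
  simp only [id, Real.norm_eq_abs, ← pow_mul]
  exact (Even.pow_abs (by decide) x)

lemma lintegral_coord_sq {w : ι → ℝ} (hw : ∀ i, 0 ≤ w i) (i : ι) :
    ∫⁻ θ, ENNReal.ofReal (θ i ^ 2) ∂(prodGaussian 0 w) = ENNReal.ofReal (w i) := by
  have h := (measurePreserving_eval (fun i => gaussianReal ((0 : ι → ℝ) i) (w i).toNNReal)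
    i).lintegral_comp (f := fun x => ENNReal.ofReal (x ^ 2)) (by fun_prop)
  have h' : ∫⁻ θ, ENNReal.ofReal (θ i ^ 2) ∂(prodGaussian 0 w) =
    ∫⁻ x, ENNReal.ofReal (x ^ 2) ∂(gaussianReal 0 (w i).toNNReal) := h
  rw [h', ← ofReal_integral_eq_lintegral_ofReal _ (ae_of_all _ fun _ => sq_nonneg _),
    integral_sq_gaussianReal (hw i)]
  exact (memLp_id_gaussianReal' 2 (by simp)).integrable_sq

/-- The second moment of an affine function of the total score of independent observations. -/
lemma lintegral_score_sum_sq (a b m v : ι → ℝ) (hv : ∀ i, 0 < v i) (c d : ℝ) :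
    ∫⁻ y, ENNReal.ofReal ((c * ∑ i, score (a i) (b i) (m i) (v i) (y i) + d) ^ 2)
      ∂(prodGaussian m v) =
      ENNReal.ofReal (c ^ 2 * ∑ i, (a i ^ 2 / v i + b i ^ 2 / (2 * v i ^ 2)) + d ^ 2) := by
  have hL : ∀ i, MemLp (score (a i) (b i) (m i) (v i)) 2 (gaussianReal (m i) (v i).toNNReal) :=
    fun i => memLp_score _ _ _ (hv i)
  have hL' : ∀ i, MemLp (fun y : ι → ℝ => score (a i) (b i) (m i) (v i) (y i)) 2
      (prodGaussian m v) := fun i =>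
    (hL i).comp_measurePreserving (measurePreserving_eval _ i)
  have hS : MemLp (fun y : ι → ℝ => ∑ i, score (a i) (b i) (m i) (v i) (y i)) 2
      (prodGaussian m v) := memLp_finsetSum _ fun i _ => hL' i
  have hmean1 : ∀ i, ∫ y, score (a i) (b i) (m i) (v i) (y i) ∂(prodGaussian m v) = 0 := by
    intro i
    have := integral_comp_eval (μ := fun i => gaussianReal (m i) (v i).toNNReal) (i := i)
      (f := score (a i) (b i) (m i) (v i)) (by fun_prop)
    unfold prodGaussian
    rw [this, integral_score _ _ _ (hv i)]
  have hmean : ∫ y, ∑ i, score (a i) (b i) (m i) (v i) (y i) ∂(prodGaussian m v) = 0 := by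
    rw [integral_finsetSum _ fun i _ => (hL' i).integrable (by norm_num)]
    exact Finset.sum_eq_zero fun i _ => hmean1 i
  have hsq : ∫ y, (∑ i, score (a i) (b i) (m i) (v i) (y i)) ^ 2 ∂(prodGaussian m v) =
      ∑ i, (a i ^ 2 / v i + b i ^ 2 / (2 * v i ^ 2)) := by
    rw [← variance_of_integral_eq_zero hS.aemeasurable hmean]
    have h := variance_sum_pi (μ := fun i => gaussianReal (m i) (v i).toNNReal) hL
    have he : (∑ i, fun y : ι → ℝ => score (a i) (b i) (m i) (v i) (y i)) =
        fun y : ι → ℝ => ∑ i, score (a i) (b i) (m i) (v i) (y i) := by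
      ext y; simp
    rw [he] at h
    unfold prodGaussian
    rw [h]
    refine Finset.sum_congr rfl fun i _ => ?_
    rw [variance_of_integral_eq_zero (hL i).aemeasurable (integral_score _ _ _ (hv i)),
      integral_score_sq _ _ _ (hv i)]
  have i1 := hS.integrable_sq
  have i2 := hS.integrable (by norm_num : (1 : ℝ≥0∞) ≤ 2)
  -- The total score is centred, so only the two squares survive integration, and the square of the
  -- score is its variance, which is additive over the coordinates.
  have hexp : ∀ y : ι → ℝ, (c * ∑ i, score (a i) (b i) (m i) (v i) (y i) + d) ^ 2 =
      c ^ 2 * (∑ i, score (a i) (b i) (m i) (v i) (y i)) ^ 2 +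
      (2 * c * d * (∑ i, score (a i) (b i) (m i) (v i) (y i)) + d ^ 2) := fun y => by ring
  rw [← ofReal_integral_eq_lintegral_ofReal]
  · congr 1
    simp_rw [hexp]
    have i3 : Integrable (fun y : ι → ℝ => 2 * c * d *
        (∑ i, score (a i) (b i) (m i) (v i) (y i)) + d ^ 2) (prodGaussian m v) :=
      (i2.const_mul _).add (integrable_const _)
    rw [integral_add (i1.const_mul _) i3, integral_add (i2.const_mul _) (integrable_const _),
        integral_const_mul, integral_const_mul,
      hsq, hmean]
    simp
  · simp_rw [hexp]
    exact (i1.const_mul _).add ((i2.const_mul _).add (integrable_const _))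
  · exact ae_of_all _ fun y => sq_nonneg _

/-! ### The van Trees inequality -/

/-- A zero of a nonnegative function is a minimum. In the van Trees inequality this makes the
convention `p' ^ 2 / 0 = 0` harmless: where the density vanishes, so does its derivative. -/
lemma hasLineDerivAt_eq_zero_of_nonneg {E : Type*} [NormedAddCommGroup E] [NormedSpace ℝ E]
    {f : E → ℝ} {f' : ℝ} {x e : E} (hf : ∀ x, 0 ≤ f x) (hx : f x = 0)
    (h : HasLineDerivAt ℝ f f' x e) : f' = 0 := by
  refine IsLocalMin.hasDerivAt_eq_zero (f := fun t : ℝ => f (x + t • e)) (a := 0) ?_ h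
  exact Filter.Eventually.of_forall fun t => by simpa [hx] using hf _

/-- The van Trees inequality for a nonnegative joint density `p` of a parameter `θ` and an
observation `y`; `p'` is the derivative of `p` in the direction `e` of the parameter space. -/
theorem van_trees {E Y : Type*} [NormedAddCommGroup E] [NormedSpace ℝ E] [FiniteDimensional ℝ E]
    [MeasurableSpace E] [BorelSpace E] {μ : Measure E} [μ.IsAddHaarMeasure]
    [MeasurableSpace Y] {ν : Measure Y} [SFinite ν]
    {p p' : E × Y → ℝ} (hp : Measurable p) (hp' : Measurable p') (hp0 : ∀ z, 0 ≤ p z) {e : E}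
    (hder : ∀ θ y, HasLineDerivAt ℝ (fun θ => p (θ, y)) (p' (θ, y)) θ e)
    (ψ : E →L[ℝ] ℝ) {T : Y → ℝ} (hT : Measurable T) {m A B : ℝ} (hm0 : 0 ≤ m) (hA0 : 0 ≤ A)
    (hB0 : 0 ≤ B)
    (hm : ∫⁻ z, ENNReal.ofReal (p z) ∂(μ.prod ν) = ENNReal.ofReal m)
    (hA : ∫⁻ z, ENNReal.ofReal ((T z.2 - ψ z.1) ^ 2 * p z) ∂(μ.prod ν) ≤ ENNReal.ofReal A)
    (hB : ∫⁻ z, ENNReal.ofReal (p' z ^ 2 / p z) ∂(μ.prod ν) ≤ ENNReal.ofReal B) :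
    (ψ e * m) ^ 2 ≤ A * B := by
  have hz : ∀ z, p z = 0 → p' z = 0 := fun z h =>
    hasLineDerivAt_eq_zero_of_nonneg (fun θ => hp0 (θ, z.2)) h (hder z.1 z.2)
  have hu : Measurable fun z : E × Y => T z.2 - ψ z.1 := by fun_prop
  have key : ∀ {f : E × Y → ℝ} {a : ℝ}, Measurable f → (∀ z, 0 ≤ f z) →
      ∫⁻ z, ENNReal.ofReal (f z) ∂(μ.prod ν) ≤ ENNReal.ofReal a → Integrable f (μ.prod ν) := by
    intro f a hf h0 h
    refine ⟨hf.aestronglyMeasurable, ?_⟩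
    rw [hasFiniteIntegral_iff_ofReal (ae_of_all _ h0)]
    exact h.trans_lt ENNReal.ofReal_lt_top
  have hA1 : ∀ z : E × Y, 0 ≤ (T z.2 - ψ z.1) ^ 2 * p z := fun z => mul_nonneg (sq_nonneg _) (hp0 z)
  have hB1 : ∀ z : E × Y, 0 ≤ p' z ^ 2 / p z := fun z => div_nonneg (sq_nonneg _) (hp0 z)
  have ip : Integrable p (μ.prod ν) := key hp hp0 hm.le
  have iA : Integrable (fun z : E × Y => (T z.2 - ψ z.1) ^ 2 * p z) (μ.prod ν) :=
    key ((hu.pow_const 2).mul hp) hA1 hA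
  have iB : Integrable (fun z : E × Y => p' z ^ 2 / p z) (μ.prod ν) :=
    key ((hp'.pow_const 2).div hp) hB1 hB
  have hint : ∀ {f : E × Y → ℝ} {a : ℝ}, Measurable f → 0 ≤ a → (∀ z, 0 ≤ f z) →
      ∫⁻ z, ENNReal.ofReal (f z) ∂(μ.prod ν) ≤ ENNReal.ofReal a → ∫ z, f z ∂(μ.prod ν) ≤ a := by
    intro f a hf ha h0 h
    rw [integral_eq_lintegral_of_nonneg_ae (ae_of_all _ h0) hf.aestronglyMeasurable]
    exact ENNReal.toReal_le_of_le_ofReal ha h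
  have hAle := hint ((hu.pow_const 2).mul hp) hA0 hA1 hA
  have hBle := hint ((hp'.pow_const 2).div hp) hB0 hB1 hB
  have hmeq : ∫ z, p z ∂(μ.prod ν) = m := by
    rw [integral_eq_lintegral_of_nonneg_ae (ae_of_all _ hp0) hp.aestronglyMeasurable, hm,
      ENNReal.toReal_ofReal hm0]
  -- This is the square `((T - ψ) p + t p')² / p`. Integrated, it is a nonnegative quadratic
  -- polynomial in `t`, whose discriminant yields Cauchy–Schwarz; the values `t = ±1` also give the
  -- integrability of the cross term.
  have quad : ∀ (t : ℝ) (z : E × Y), 0 ≤ (T z.2 - ψ z.1) ^ 2 * p z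
      + 2 * t * ((T z.2 - ψ z.1) * p' z) + t ^ 2 * (p' z ^ 2 / p z) := by
    intro t z
    rcases (hp0 z).eq_or_lt with h | h
    · simp [hz z h.symm, ← h]
    · have : (T z.2 - ψ z.1) ^ 2 * p z + 2 * t * ((T z.2 - ψ z.1) * p' z) + t ^ 2 * (p' z ^ 2 / p z)
          = ((T z.2 - ψ z.1) * p z + t * p' z) ^ 2 / p z := by
        field_simp
        ring
      rw [this]
      positivity
  have iC : Integrable (fun z : E × Y => (T z.2 - ψ z.1) * p' z) (μ.prod ν) := by
    refine (iA.add iB).mono' (hu.mul hp').aestronglyMeasurable (ae_of_all _ fun z => ?_)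
    rw [Real.norm_eq_abs, abs_le]
    have h1 := quad 1 z
    have h2 := quad (-1) z
    have h3 := hA1 z
    have h4 := hB1 z
    simp only [Pi.add_apply]
    constructor <;> nlinarith
  -- Needed to integrate by parts without boundary terms; it follows from `|u| ≤ u² + 1` and the
  -- finite mass.
  have iD : Integrable (fun z : E × Y => (T z.2 - ψ z.1) * p z) (μ.prod ν) := by
    refine (iA.add ip).mono' (hu.mul hp).aestronglyMeasurable (ae_of_all _ fun z => ?_)
    rw [Real.norm_eq_abs, abs_mul, abs_of_nonneg (hp0 z)]
    simp only [Pi.add_apply]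
    have h1 : |T z.2 - ψ z.1| ≤ (T z.2 - ψ z.1) ^ 2 + 1 := by
      rw [← sq_abs]; nlinarith [sq_nonneg (|T z.2 - ψ z.1| - 1 / 2)]
    nlinarith [hp0 z]
  -- Integration by parts in `θ` for almost every fixed `y`: the estimator does not depend on `θ`,
  -- so only the derivative `-(ψ e)` of `-ψ` remains.
  have hparts : ∫ z, (T z.2 - ψ z.1) * p' z ∂(μ.prod ν) = ψ e * m := by
    rw [integral_prod_symm _ iC, ← hmeq, integral_prod_symm _ ip, ← integral_const_mul]
    refine integral_congr_ae ?_
    filter_upwards [iC.prod_left_ae, iD.prod_left_ae, ip.prod_left_ae] with y h1 h2 h3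
    have hl : ∀ θ, HasLineDerivAt ℝ (fun θ => T y - ψ θ) (-(ψ e)) θ e := fun θ =>
      (ψ.hasFDerivAt.const_sub (T y)).hasLineDerivAt e
    have := integral_bilinear_hasLineDerivAt_right_eq_neg_left_of_integrable
      (B := ContinuousLinearMap.mul ℝ ℝ) (μ := μ) (f := fun θ => T y - ψ θ)
      (f' := fun _ => -(ψ e)) (g := fun θ => p (θ, y)) (g' := fun θ => p' (θ, y)) (v := e)
      (h3.const_mul _) h1 h2 (fun θ _ => hl θ) (fun θ _ => hder θ y)
    simp only [ContinuousLinearMap.mul_apply'] at this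
    rw [this, integral_const_mul]
    ring
  have hdisc : ∀ t : ℝ, 0 ≤ (∫ z, p' z ^ 2 / p z ∂(μ.prod ν)) * (t * t)
      + 2 * (ψ e * m) * t + ∫ z, (T z.2 - ψ z.1) ^ 2 * p z ∂(μ.prod ν) := by
    intro t
    have h : 0 ≤ ∫ z : E × Y, ((T z.2 - ψ z.1) ^ 2 * p z + 2 * t * ((T z.2 - ψ z.1) * p' z)
        + t ^ 2 * (p' z ^ 2 / p z)) ∂(μ.prod ν) := integral_nonneg fun z => quad t z
    have iE : Integrable (fun z : E × Y => (T z.2 - ψ z.1) ^ 2 * p z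
      + 2 * t * ((T z.2 - ψ z.1) * p' z)) (μ.prod ν) := iA.add (iC.const_mul _)
    rw [integral_add iE (iB.const_mul _), integral_add iA (iC.const_mul _), integral_const_mul,
      integral_const_mul, hparts] at h
    linarith
  have h := discrim_le_zero hdisc
  unfold discrim at h
  have hB2 : 0 ≤ ∫ z, p' z ^ 2 / p z ∂(μ.prod ν) := integral_nonneg hB1
  calc (ψ e * m) ^ 2 ≤ (∫ z, (T z.2 - ψ z.1) ^ 2 * p z ∂(μ.prod ν)) *
        ∫ z, p' z ^ 2 / p z ∂(μ.prod ν) := by linarith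
    _ ≤ A * B := mul_le_mul hAle hBle hB2 hA0

/-! ### Bayes risk in a normal regression model with a truncated normal prior -/

/-- Derivatives are written as value times logarithmic derivative, so that logarithmic derivatives
add up without any division by the factors. -/
lemma hasDerivAt_prod_of_logDeriv {κ : Type*} [Fintype κ] {f : κ → ℝ → ℝ} {c : κ → ℝ} {t : ℝ}
    (h : ∀ j, HasDerivAt (f j) (f j t * c j) t) :
    HasDerivAt (fun s => ∏ j, f j s) ((∏ j, f j t) * ∑ j, c j) t := by
  classical
  refine (HasDerivAt.fun_finsetProd (u := Finset.univ) fun j _ => h j).congr_deriv ?_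
  rw [Finset.mul_sum]
  refine Finset.sum_congr rfl fun j hj => ?_
  rw [smul_eq_mul, ← mul_assoc, Finset.prod_erase_mul _ _ hj]

lemma hasDerivAt_gaussianPDFReal_arg {x : ℝ → ℝ} {x' t : ℝ} {w : ℝ} (hw : 0 < w)
    (hx : HasDerivAt x x' t) :
    HasDerivAt (fun s => gaussianPDFReal 0 w.toNNReal (x s))
      (gaussianPDFReal 0 w.toNNReal (x t) * (-(x t * x') / w)) t := by
  have h := ((((hx.fun_pow 2).fun_neg).div_const (2 * w)).exp).const_mul
    (Real.sqrt (2 * Real.pi * w))⁻¹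
  have he : (fun s => gaussianPDFReal 0 w.toNNReal (x s)) = fun s =>
      (Real.sqrt (2 * Real.pi * w))⁻¹ * Real.exp (-(x s) ^ 2 / (2 * w)) := by
    ext s
    simp [gaussianPDFReal, Real.coe_toNNReal _ hw.le]
  rw [he]
  refine h.congr_deriv ?_
  simp only [gaussianPDFReal, Real.coe_toNNReal _ hw.le, sub_zero]
  push_cast
  field_simp

section Bayes

variable {ι κ : Type*} [Fintype ι] [Fintype κ]

/-- The total score in the direction `e`. -/
def totalScore (M : κ → (ι → ℝ) →L[ℝ] ℝ) (v : κ → (ι → ℝ) → ℝ) (e θ : ι → ℝ) (y : κ → ℝ) : ℝ :=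
  ∑ j, score (M j e) (fderiv ℝ (v j) θ e) (M j θ) (v j θ) (y j)

/-- The weighted sum of squares `∑ a_i θ_i²`. -/
def wsq (a θ : ι → ℝ) : ℝ := ∑ i, a i * θ i ^ 2

lemma continuous_wsq (a : ι → ℝ) : Continuous (wsq a) := by
  unfold wsq; fun_prop

lemma measurable_totalScore (M : κ → (ι → ℝ) →L[ℝ] ℝ) {v : κ → (ι → ℝ) → ℝ}
    (hv : ∀ j, Differentiable ℝ (v j)) (e : ι → ℝ) :
    Measurable fun z : (ι → ℝ) × (κ → ℝ) => totalScore M v e z.1 z.2 := by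
  unfold totalScore score
  have h1 : ∀ j, Measurable fun z : (ι → ℝ) × (κ → ℝ) => fderiv ℝ (v j) z.1 e := fun j =>
    (measurable_fderiv_apply_const ℝ (v j) e).comp measurable_fst
  have h2 : ∀ j, Measurable fun z : (ι → ℝ) × (κ → ℝ) => v j z.1 := fun j =>
    (hv j).continuous.measurable.comp measurable_fst
  have h3 : ∀ j, Measurable fun z : (ι → ℝ) × (κ → ℝ) => M j z.1 := fun j =>
    (M j).continuous.measurable.comp measurable_fst
  have h4 : ∀ j, Measurable fun z : (ι → ℝ) × (κ → ℝ) => z.2 j := fun j => by fun_prop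
  refine Finset.measurable_sum _ fun j _ => ?_
  exact ((measurable_const.mul ((h4 j).sub (h3 j))).div (h2 j)).add
    (((h1 j).mul ((((h4 j).sub (h3 j)).pow_const 2).sub (h2 j))).div
      (measurable_const.mul ((h2 j).pow_const 2)))

lemma hasLineDerivAt_prodPDF (M : κ → (ι → ℝ) →L[ℝ] ℝ) {v : κ → (ι → ℝ) → ℝ}
    (hv : ∀ j, Differentiable ℝ (v j)) (e θ : ι → ℝ) (hpos : ∀ j, 0 < v j θ) (y : κ → ℝ) :
    HasLineDerivAt ℝ (fun θ => prodPDF (fun j => M j θ) (fun j => v j θ) y)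
      (prodPDF (fun j => M j θ) (fun j => v j θ) y * totalScore M v e θ y) θ e := by
  have h := hasDerivAt_prod_of_logDeriv (κ := κ) (t := 0)
    (f := fun j t => gaussianPDFReal (M j (θ + t • e)) (v j (θ + t • e)).toNNReal (y j))
    (c := fun j => score (M j e) (fderiv ℝ (v j) θ e) (M j θ) (v j θ) (y j)) (fun j => by
      have h1 : HasDerivAt (fun t : ℝ => M j (θ + t • e)) (M j e) 0 :=
        (M j).hasFDerivAt.hasLineDerivAt e
      have h2 : HasDerivAt (fun t : ℝ => v j (θ + t • e)) (fderiv ℝ (v j) θ e) 0 :=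
        (hv j θ).hasFDerivAt.hasLineDerivAt e
      have := hasDerivAt_gaussianPDFReal (y j) h1 h2 (by simpa using hpos j)
      simpa using this)
  simpa [HasLineDerivAt, prodPDF, totalScore] using h

lemma hasLineDerivAt_prior [DecidableEq ι] {w : ι → ℝ} (hw : ∀ i, 0 < w i) (i : ι) (θ : ι → ℝ) :
    HasLineDerivAt ℝ (fun θ => prodPDF 0 w θ) (prodPDF 0 w θ * (-(θ i) / w i)) θ
      (Pi.single i 1) := by
  have h := hasDerivAt_prod_of_logDeriv (κ := ι) (t := 0)
    (f := fun j t => gaussianPDFReal 0 (w j).toNNReal ((θ + t • (Pi.single i 1 : ι → ℝ)) j))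
    (c := fun j => -(θ j * (Pi.single i (1 : ℝ) : ι → ℝ) j) / w j) (fun j => by
      have h1 : HasDerivAt (fun t : ℝ => (θ + t • (Pi.single i 1 : ι → ℝ)) j)
          ((Pi.single i (1 : ℝ) : ι → ℝ) j) 0 := by
        simpa using ((hasDerivAt_id (0 : ℝ)).mul_const ((Pi.single i (1 : ℝ) : ι → ℝ) j)).const_add
          (θ j)
      have := hasDerivAt_gaussianPDFReal_arg (hw j) h1
      simpa using this)
  have hs : ∑ j, -(θ j * (Pi.single i (1 : ℝ) : ι → ℝ) j) / w j = -(θ i) / w i := by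
    rw [Finset.sum_eq_single i]
    · simp
    · intro j _ hj; simp [hj]
    · simp
  rw [hs] at h
  simpa [HasLineDerivAt, prodPDF] using h

lemma hasLineDerivAt_wsq [DecidableEq ι] (a : ι → ℝ) (i : ι) (θ : ι → ℝ) :
    HasLineDerivAt ℝ (wsq a) (2 * a i * θ i) θ (Pi.single i 1) := by
  have h : HasDerivAt (fun t : ℝ => ∑ j, a j * (θ j + t * (Pi.single i (1 : ℝ) : ι → ℝ) j) ^ 2)
      (∑ j, a j * (2 * θ j * (Pi.single i (1 : ℝ) : ι → ℝ) j)) 0 := by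
    refine HasDerivAt.fun_sum fun j _ => ?_
    have := ((((hasDerivAt_id (0 : ℝ)).mul_const ((Pi.single i (1 : ℝ) : ι → ℝ) j)).const_add
          (θ j)).fun_pow 2).const_mul (a j)
    simpa using this
  have hs : ∑ j, a j * (2 * θ j * (Pi.single i (1 : ℝ) : ι → ℝ) j) = 2 * a i * θ i := by
    rw [Finset.sum_eq_single i]
    · simp; ring
    · intro j _ hj; simp [hj]
    · simp
  rw [hs] at h
  simpa [HasLineDerivAt, wsq] using h

/-- The van Trees bound for one coordinate: the observations are independent normal with means
`M j θ` and variances `v j θ`, the prior is normal with variances `w` and truncated to the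
ellipsoid `∑ a_i θ_i² < R` by the cutoff `ρ`. -/
theorem bayes_coordinate [DecidableEq ι] (M : κ → (ι → ℝ) →L[ℝ] ℝ) {v : κ → (ι → ℝ) → ℝ}
    (hv : ∀ j, Differentiable ℝ (v j)) {a w : ι → ℝ} (ha : ∀ i, 0 ≤ a i) (hw : ∀ i, 0 < w i)
    {ρ ρ' : ℝ → ℝ} (hρ : ∀ t, HasDerivAt ρ (ρ' t) t) {L R₀ R : ℝ} (hR : R₀ < R)
    (hρ0 : ∀ t, R₀ ≤ t → ρ t = 0) (hρ1 : ∀ t, |ρ t| ≤ 1) (hρ' : ∀ t, |ρ' t| ≤ L)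
    (hρm : Measurable ρ')
    (hpos : ∀ θ, wsq a θ < R → ∀ j, 0 < v j θ) (i : ι) {J : ℝ} (hJ0 : 0 ≤ J)
    (hJ : ∀ θ, wsq a θ < R → ∑ j, ((M j (Pi.single i 1)) ^ 2 / v j θ +
      (fderiv ℝ (v j) θ (Pi.single i 1)) ^ 2 / (2 * v j θ ^ 2)) ≤ J)
    (ψ : (ι → ℝ) →L[ℝ] ℝ) {T : (κ → ℝ) → ℝ} (hT : Measurable T) {Z : ℝ} (hZ0 : 0 ≤ Z)
    (hZ : ∫⁻ θ, ENNReal.ofReal (ρ (wsq a θ) ^ 2) ∂(prodGaussian 0 w) = ENNReal.ofReal Z) :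
    ENNReal.ofReal ((ψ (Pi.single i 1) * Z) ^ 2 / (J * Z + w i * (4 * L * a i + 1 / w i) ^ 2)) ≤
      ∫⁻ θ, ENNReal.ofReal (ρ (wsq a θ) ^ 2) * ∫⁻ y, ENNReal.ofReal ((T y - ψ θ) ^ 2)
        ∂(prodGaussian (fun j => M j θ) (fun j => v j θ)) ∂(prodGaussian 0 w) := by
  set e : ι → ℝ := Pi.single i 1 with he
  -- The derivative of `ρ² G` along the coordinate is `ρ G η`. Truncating by the square of `ρ` keeps
  -- a factor `ρ` in this derivative, so `p' ^ 2 / p` has no singularity at the edge of the support.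
  set η : (ι → ℝ) → ℝ := fun θ => (4 * ρ' (wsq a θ) * a i - ρ (wsq a θ) / w i) * θ i with hη
  set G : (ι → ℝ) → ℝ := prodPDF 0 w with hG
  set f : (ι → ℝ) × (κ → ℝ) → ℝ := fun z =>
    prodPDF (fun j => M j z.1) (fun j => v j z.1) z.2 with hf
  have hcw := continuous_wsq a
  have mρ : Measurable ρ := (continuous_iff_continuousAt.2 fun t => (hρ t).continuousAt).measurable
  have mρw : Measurable fun θ => ρ (wsq a θ) := mρ.comp hcw.measurable
  have mη : Measurable η := by
    have := hρm.comp hcw.measurable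
    exact ((((measurable_const.mul this).mul_const _).sub (mρw.div_const _)).mul
      (measurable_pi_apply i))
  have mG : Measurable G :=
    measurable_prodPDF_uncurry measurable_const measurable_const measurable_id
  have mf : Measurable f := by
    refine measurable_prodPDF_uncurry ?_ ?_ measurable_snd
    · exact measurable_pi_lambda _ fun j => (M j).continuous.measurable.comp measurable_fst
    · exact measurable_pi_lambda _ fun j => (hv j).continuous.measurable.comp measurable_fst
  have hG0 : ∀ θ, 0 ≤ G θ := fun θ => prodPDF_nonneg _ _ _
  have hf0 : ∀ z, 0 ≤ f z := fun z => prodPDF_nonneg _ _ _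
  have ms := measurable_totalScore M hv e
  set p : (ι → ℝ) × (κ → ℝ) → ℝ := fun z => ρ (wsq a z.1) ^ 2 * (G z.1 * f z) with hp
  set p' : (ι → ℝ) × (κ → ℝ) → ℝ := fun z => ρ (wsq a z.1) * (G z.1 * f z) *
    (ρ (wsq a z.1) * totalScore M v e z.1 z.2 + η z.1) with hp'
  have mρ1 : Measurable fun z : (ι → ℝ) × (κ → ℝ) => ρ (wsq a z.1) := mρw.comp measurable_fst
  have mG1 : Measurable fun z : (ι → ℝ) × (κ → ℝ) => G z.1 := mG.comp measurable_fst
  have mη1 : Measurable fun z : (ι → ℝ) × (κ → ℝ) => η z.1 := mη.comp measurable_fst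
  have mp : Measurable p := (mρ1.pow_const 2).mul (mG1.mul mf)
  have mp' : Measurable p' := (mρ1.mul (mG1.mul mf)).mul ((mρ1.mul ms).add mη1)
  have hp0 : ∀ z, 0 ≤ p z := fun z => mul_nonneg (sq_nonneg _) (mul_nonneg (hG0 _) (hf0 _))
  have hder : ∀ θ y, HasLineDerivAt ℝ (fun θ => p (θ, y)) (p' (θ, y)) θ e := by
    intro θ y
    rcases lt_or_ge (wsq a θ) R with h | h
    · have h1 : HasDerivAt (fun t : ℝ => ρ (wsq a (θ + t • e)))
          (ρ' (wsq a θ) * (2 * a i * θ i)) 0 := by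
        have h2 : HasDerivAt (fun t : ℝ => wsq a (θ + t • e)) (2 * a i * θ i) 0 :=
          hasLineDerivAt_wsq a i θ
        have h3 := HasDerivAt.comp (0 : ℝ) (hρ (wsq a (θ + (0 : ℝ) • e))) h2
        simpa [Function.comp_def] using h3
      have h2 : HasDerivAt (fun t : ℝ => G (θ + t • e)) (G θ * (-(θ i) / w i)) 0 :=
        hasLineDerivAt_prior hw i θ
      have h3 : HasDerivAt (fun t : ℝ => f (θ + t • e, y))
          (f (θ, y) * totalScore M v e θ y) 0 :=
        hasLineDerivAt_prodPDF M hv e θ (hpos θ h) y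
      have h4 := (h1.fun_pow 2).mul (h2.mul h3)
      refine h4.congr_deriv ?_
      simp only [hp', hη, Pi.mul_apply, zero_smul, add_zero]
      push_cast
      ring
    -- Beyond `R` the functions `v j` need not be positive, but since `R₀ < R` the density vanishes
    -- in a whole neighbourhood of such a point.
    · have h0 : p' (θ, y) = 0 := by simp [hp', hρ0 _ (hR.le.trans h)]
      rw [h0]
      have h1 : (fun θ => p (θ, y)) =ᶠ[𝓝 θ] fun _ => 0 := by
        filter_upwards [hcw.continuousAt.eventually (lt_mem_nhds (hR.trans_le h))] with θ' hθ'
        simp [hp, hρ0 _ hθ'.le]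
      have h2 : HasLineDerivAt ℝ (fun _ : ι → ℝ => (0 : ℝ)) 0 θ e :=
        hasDerivAt_const (0 : ℝ) (0 : ℝ)
      exact h2.congr_of_eventuallyEq h1
  -- Integrals against the joint density become iterated normal expectations. The weight `c` must
  -- vanish outside the ellipsoid, where `prodPDF` may fail to be the density of `prodGaussian`.
  have fub : ∀ (c : (ι → ℝ) → ℝ≥0∞) (H : (ι → ℝ) × (κ → ℝ) → ℝ≥0∞), Measurable c → Measurable H →
      (∀ θ, R ≤ wsq a θ → c θ = 0) →
      ∫⁻ z, c z.1 * (ENNReal.ofReal (G z.1 * f z) * H z) ∂(volume.prod volume) =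
        ∫⁻ θ, c θ * ∫⁻ y, H (θ, y) ∂(prodGaussian (fun j => M j θ) (fun j => v j θ))
          ∂(prodGaussian 0 w) := by
    intro c H mc mH hc
    rw [lintegral_prodGaussian 0 w hw, lintegral_prod _ (by fun_prop)]
    refine lintegral_congr fun θ => ?_
    rcases lt_or_ge (wsq a θ) R with h | h
    · rw [lintegral_prodGaussian _ _ (hpos θ h)]
      have mfy : Measurable fun y => f (θ, y) := mf.comp measurable_prodMk_left
      have mHy : Measurable fun y => H (θ, y) := mH.comp measurable_prodMk_left
      have mfy' : Measurable fun y => ENNReal.ofReal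
        (prodPDF (fun j => M j θ) (fun j => v j θ) y) * H (θ, y) := mfy.ennreal_ofReal.mul mHy
      rw [← lintegral_const_mul _ mfy', ← lintegral_const_mul _ (mfy'.const_mul _)]
      refine lintegral_congr fun y => ?_
      rw [ENNReal.ofReal_mul (hG0 _)]
      simp only [hf, hG]
      ring
    · simp [hc θ h]
  have hm : ∫⁻ z, ENNReal.ofReal (p z) ∂(volume.prod volume) = ENNReal.ofReal Z := by
    have h := fub (fun θ => ENNReal.ofReal (ρ (wsq a θ) ^ 2)) (fun _ => 1) (by fun_prop)
      measurable_const (fun θ h => by simp [hρ0 _ (hR.le.trans h)])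
    simp only [mul_one, lintegral_const, measure_univ] at h
    rw [hZ] at h
    rw [← h]
    refine lintegral_congr fun z => ?_
    rw [← ENNReal.ofReal_mul (sq_nonneg _)]
  have hAeq := fub (fun θ => ENNReal.ofReal (ρ (wsq a θ) ^ 2))
      (fun z => ENNReal.ofReal ((T z.2 - ψ z.1) ^ 2)) (by fun_prop)
      (by fun_prop) (fun θ h => by simp [hρ0 _ (hR.le.trans h)])
  have hAeq' : ∫⁻ z, ENNReal.ofReal ((T z.2 - ψ z.1) ^ 2 * p z) ∂(volume.prod volume) =
      ∫⁻ θ, ENNReal.ofReal (ρ (wsq a θ) ^ 2) * ∫⁻ y, ENNReal.ofReal ((T y - ψ θ) ^ 2)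
        ∂(prodGaussian (fun j => M j θ) (fun j => v j θ)) ∂(prodGaussian 0 w) := by
    rw [← hAeq]
    refine lintegral_congr fun z => ?_
    rw [ENNReal.ofReal_mul (sq_nonneg _), ENNReal.ofReal_mul (sq_nonneg _)]
    ring
  have hL0 : 0 ≤ L := (abs_nonneg _).trans (hρ' 0)
  have hηle : ∀ θ, η θ ^ 2 ≤ (4 * L * a i + 1 / w i) ^ 2 * θ i ^ 2 := by
    intro θ
    simp only [hη, mul_pow]
    refine mul_le_mul_of_nonneg_right ?_ (sq_nonneg _)
    refine sq_le_sq' ?_ ?_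
    · have h1 := (abs_le.1 (hρ' (wsq a θ))).1
      have h2 := (abs_le.1 (hρ1 (wsq a θ))).2
      have h3 : ρ (wsq a θ) / w i ≤ 1 / w i := div_le_div_of_nonneg_right h2 (hw i).le
      nlinarith [ha i, mul_le_mul_of_nonneg_right h1 (ha i)]
    · have h1 := (abs_le.1 (hρ' (wsq a θ))).2
      have h2 := (abs_le.1 (hρ1 (wsq a θ))).1
      have h3 : -1 / w i ≤ ρ (wsq a θ) / w i := div_le_div_of_nonneg_right h2 (hw i).le
      have h4 : -1 / w i = -(1 / w i) := by ring
      nlinarith [ha i, mul_le_mul_of_nonneg_right h1 (ha i)]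
  set B : ℝ := J * Z + w i * (4 * L * a i + 1 / w i) ^ 2 with hBdef
  have hBpos : 0 < B := by
    have h1 : 0 < 1 / w i := one_div_pos.2 (hw i)
    have h2 := ha i
    have h3 := hw i
    positivity
  have hB : ∫⁻ z, ENNReal.ofReal (p' z ^ 2 / p z) ∂(volume.prod volume) ≤ ENNReal.ofReal B := by
    classical
    have ms2 : Measurable ({θ : ι → ℝ | wsq a θ < R}.indicator (fun _ => (1 : ℝ≥0∞))) :=
      measurable_const.indicator (measurableSet_lt hcw.measurable measurable_const)
    have h := fub ({θ : ι → ℝ | wsq a θ < R}.indicator (fun _ => (1 : ℝ≥0∞)))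
      (fun z => ENNReal.ofReal ((ρ (wsq a z.1) * totalScore M v e z.1 z.2 + η z.1) ^ 2)) ms2
      (by fun_prop) (fun θ h => Set.indicator_of_notMem (by simpa using h) _)
    -- Where `ρ` is nonzero, `p' ^ 2 / p` equals `G f (ρ · score + η)²` if `G f ≠ 0`, and both sides
    -- vanish otherwise. The factor `ρ` has cancelled, so the indicator of the ellipsoid takes over
    -- as the weight.
    refine le_trans (b := ∫⁻ z : (ι → ℝ) × (κ → ℝ),
      {θ : ι → ℝ | wsq a θ < R}.indicator (fun _ => (1 : ℝ≥0∞)) z.1 * (ENNReal.ofReal (G z.1 * f z)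
      * ENNReal.ofReal ((ρ (wsq a z.1) * totalScore M v e z.1 z.2 + η z.1) ^ 2))
        ∂(volume.prod volume)) ?_ ?_
    · refine lintegral_mono fun z => ?_
      by_cases h0 : ρ (wsq a z.1) = 0
      · simp [hp', h0]
      · have h1 : wsq a z.1 < R := by
          by_contra h2
          exact h0 (hρ0 _ (hR.le.trans (not_lt.1 h2)))
        have hmem : z.1 ∈ {θ : ι → ℝ | wsq a θ < R} := h1
        rw [Set.indicator_of_mem hmem, one_mul,
          ← ENNReal.ofReal_mul (mul_nonneg (hG0 _) (hf0 _))]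
        refine ENNReal.ofReal_le_ofReal (le_of_eq ?_)
        simp only [hp, hp']
        by_cases h3 : G z.1 * f z = 0
        · simp [h3]
        · field_simp
    · rw [h]
      have hle : ∀ θ, {θ : ι → ℝ | wsq a θ < R}.indicator (fun _ => (1 : ℝ≥0∞)) θ *
          ∫⁻ y, ENNReal.ofReal ((ρ (wsq a θ) * totalScore M v e θ y + η θ) ^ 2)
            ∂(prodGaussian (fun j => M j θ) (fun j => v j θ)) ≤
          ENNReal.ofReal J * ENNReal.ofReal (ρ (wsq a θ) ^ 2) +
            ENNReal.ofReal ((4 * L * a i + 1 / w i) ^ 2) * ENNReal.ofReal (θ i ^ 2) := by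
        intro θ
        by_cases hθ : θ ∈ {θ : ι → ℝ | wsq a θ < R}
        · rw [Set.indicator_of_mem hθ, one_mul]
          unfold totalScore
          -- Conditionally on `θ` the score is centred and `η` is constant, so what remains is `ρ²`
          -- times the Fisher information plus `η²`.
          rw [lintegral_score_sum_sq _ _ _ _ (hpos θ hθ), ← ENNReal.ofReal_mul hJ0,
            ← ENNReal.ofReal_mul (sq_nonneg _),
            ← ENNReal.ofReal_add (mul_nonneg hJ0 (sq_nonneg _))
              (mul_nonneg (sq_nonneg _) (sq_nonneg _))]
          refine ENNReal.ofReal_le_ofReal (add_le_add ?_ (hηle θ))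
          rw [mul_comm]
          exact mul_le_mul_of_nonneg_right (hJ θ hθ) (sq_nonneg _)
        · rw [Set.indicator_of_notMem hθ, zero_mul]
          exact zero_le
      refine (lintegral_mono hle).trans (le_of_eq ?_)
      rw [lintegral_add_left (by fun_prop), lintegral_const_mul _ (by fun_prop),
        lintegral_const_mul _ (by fun_prop), hZ, lintegral_coord_sq (fun i => (hw i).le),
        ← ENNReal.ofReal_mul hJ0, ← ENNReal.ofReal_mul (sq_nonneg _),
        ← ENNReal.ofReal_add (mul_nonneg hJ0 hZ0) (mul_nonneg (sq_nonneg _) (hw i).le), hBdef]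
      congr 1
      ring
  rw [← hAeq']
  -- If the Bayes risk is infinite there is nothing to prove; otherwise its real value serves as `A`
  -- in the van Trees inequality.
  by_cases htop : ∫⁻ z, ENNReal.ofReal ((T z.2 - ψ z.1) ^ 2 * p z) ∂(volume.prod volume) = ⊤
  · rw [htop]; exact le_top
  · have hvt := van_trees (μ := (volume : Measure (ι → ℝ))) (ν := (volume : Measure (κ → ℝ)))
      mp mp' hp0 hder ψ hT hZ0 ENNReal.toReal_nonneg hBpos.le hm
      (ENNReal.ofReal_toReal htop).ge hB
    rw [← ENNReal.ofReal_toReal htop]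
    refine ENNReal.ofReal_le_ofReal ?_
    rwa [div_le_iff₀ hBpos]

end Bayes

/-! ### The mass of the truncated prior -/

lemma memLp_coord_sq {ι : Type*} [Fintype ι] (a w : ι → ℝ) (i : ι) :
    MemLp (fun x : ℝ => a i * x ^ 2) 2 (gaussianReal 0 (w i).toNNReal) :=
  (memLp_sq_gaussianReal _ _).const_mul _

lemma variance_coord_sq (c : ℝ) {w : ℝ} (hw : 0 ≤ w) :
    Var[fun x : ℝ => c * x ^ 2; gaussianReal 0 w.toNNReal] = 2 * c ^ 2 * w ^ 2 := by
  rw [variance_const_mul, variance_eq_sub (memLp_sq_gaussianReal _ _), integral_sq_gaussianReal hw]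
  have h : (gaussianReal 0 w.toNNReal)[(fun x : ℝ => x ^ 2) ^ 2] = 3 * w ^ 2 := by
    rw [← integral_four_gaussianReal hw]
    refine integral_congr_ae (ae_of_all _ fun x => ?_)
    simp only [Pi.pow_apply]; ring
  rw [h]; ring

/-- Chebyshev's inequality: the variance of `∑ a_i θ_i²` is `2 ∑ (a_i w_i)² ≤ 2 b ∑ a_i w_i`. When
no coordinate carries much energy, the energy concentrates at its mean, which lies at distance `c`
below the region where `ρ` may drop from 1. -/
lemma prior_mass_ge {ι : Type*} [Fintype ι] {a w : ι → ℝ} (ha : ∀ i, 0 ≤ a i) (hw : ∀ i, 0 ≤ w i)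
    {ρ : ℝ → ℝ} {R₁ b c : ℝ} (hρ : ∀ t, 0 ≤ t → t ≤ R₁ → ρ t = 1) (hc : 0 < c)
    (hE : ∑ i, a i * w i + c ≤ R₁) (hb : ∀ i, a i * w i ≤ b) :
    ENNReal.ofReal (1 - 2 * b * (∑ i, a i * w i) / c ^ 2) ≤
      ∫⁻ θ, ENNReal.ofReal (ρ (wsq a θ) ^ 2) ∂(prodGaussian 0 w) := by
  have hL : ∀ i, MemLp (fun x : ℝ => a i * x ^ 2) 2
      (gaussianReal ((0 : ι → ℝ) i) (w i).toNNReal) := fun i => memLp_coord_sq a w i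
  have hL' : ∀ i, MemLp (fun θ : ι → ℝ => a i * θ i ^ 2) 2 (prodGaussian 0 w) := fun i =>
    (hL i).comp_measurePreserving (measurePreserving_eval _ i)
  have hW : MemLp (wsq a) 2 (prodGaussian 0 w) := by
    unfold wsq; exact memLp_finsetSum _ fun i _ => hL' i
  have hmean : ∫ θ, wsq a θ ∂(prodGaussian 0 w) = ∑ i, a i * w i := by
    unfold wsq
    rw [integral_finsetSum _ fun i _ => (hL' i).integrable (by norm_num)]
    refine Finset.sum_congr rfl fun i _ => ?_
    have := integral_comp_eval (μ := fun i => gaussianReal ((0 : ι → ℝ) i) (w i).toNNReal) (i := i)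
      (f := fun x => a i * x ^ 2) (by fun_prop)
    unfold prodGaussian
    rw [this, integral_const_mul]
    congr 1
    exact integral_sq_gaussianReal (hw i)
  have hvar : Var[wsq a; prodGaussian 0 w] ≤ 2 * b * ∑ i, a i * w i := by
    have h := variance_sum_pi (μ := fun i => gaussianReal ((0 : ι → ℝ) i) (w i).toNNReal) hL
    have he : (∑ i, fun y : ι → ℝ => a i * y i ^ 2) = wsq a := by
      ext y; simp [wsq]
    rw [he] at h
    unfold prodGaussian
    rw [h, Finset.mul_sum]
    refine Finset.sum_le_sum fun i _ => ?_
    have h1 := variance_coord_sq (a i) (hw i)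
    simp only [Pi.zero_apply]
    rw [h1]
    nlinarith [mul_le_mul_of_nonneg_right (hb i) (mul_nonneg (ha i) (hw i))]
  have hcheb := meas_ge_le_variance_div_sq hW hc
  rw [hmean] at hcheb
  have hS : MeasurableSet {θ | c ≤ |wsq a θ - ∑ i, a i * w i|} :=
    measurableSet_le measurable_const ((continuous_wsq a).measurable.sub_const _).abs
  calc ENNReal.ofReal (1 - 2 * b * (∑ i, a i * w i) / c ^ 2)
      ≤ 1 - ENNReal.ofReal (Var[wsq a; prodGaussian 0 w] / c ^ 2) := by
        rw [ENNReal.ofReal_sub _ (div_nonneg ((variance_nonneg _ _).trans hvar) (sq_nonneg _)),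
          ENNReal.ofReal_one]
        exact tsub_le_tsub_left (ENNReal.ofReal_le_ofReal
          (div_le_div_of_nonneg_right hvar (sq_nonneg _))) _
    _ ≤ 1 - (prodGaussian 0 w) {θ | c ≤ |wsq a θ - ∑ i, a i * w i|} := tsub_le_tsub_left hcheb _
    _ = (prodGaussian 0 w) {θ | c ≤ |wsq a θ - ∑ i, a i * w i|}ᶜ :=
        (prob_compl_eq_one_sub hS).symm
    _ = ∫⁻ θ, {θ | c ≤ |wsq a θ - ∑ i, a i * w i|}ᶜ.indicator 1 θ ∂(prodGaussian 0 w) :=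
        (lintegral_indicator_one hS.compl).symm
    _ ≤ _ := by
        refine lintegral_mono fun θ => ?_
        by_cases hθ : θ ∈ {θ | c ≤ |wsq a θ - ∑ i, a i * w i|}ᶜ
        · rw [Set.indicator_of_mem hθ]
          have h1 : |wsq a θ - ∑ i, a i * w i| < c := by simpa using hθ
          have h2 : 0 ≤ wsq a θ := Finset.sum_nonneg fun i _ => mul_nonneg (ha i) (sq_nonneg _)
          rw [hρ _ h2 (by linarith [(abs_lt.1 h1).2])]
          simp
        · rw [Set.indicator_of_notMem hθ]
          exact zero_le

lemma prior_mass_le_one {ι : Type*} [Fintype ι] {a w : ι → ℝ} {ρ : ℝ → ℝ} (hρ : ∀ t, |ρ t| ≤ 1) :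
    ∫⁻ θ, ENNReal.ofReal (ρ (wsq a θ) ^ 2) ∂(prodGaussian 0 w) ≤ 1 := by
  calc _ ≤ ∫⁻ θ, 1 ∂(prodGaussian 0 w) := by
        refine lintegral_mono fun θ => ?_
        have := (sq_le_one_iff_abs_le_one (ρ (wsq a θ))).2 (hρ _)
        simpa using this
    _ = 1 := by simp

/-! ### The normal experiment -/

/-- The risk for the loss given by the norm of `L²(μ)`. -/
def riskWith (μ : Measure I) (g : I → C(I, ℝ) → ℝ) (l : ℝ) {n : ℕ} (T : Estimator n)
    (S : C(I, ℝ)) : ℝ≥0∞ :=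
  ⨆ p ∈ noiseFamily n l,
    ∫⁻ y, (∫⁻ x, ENNReal.ofReal ((T.1 y x - S x) ^ 2) ∂μ) ∂(obsLaw g S p)

/-- The normalized counting measure of the design. -/
def designMeasure (n : ℕ) : Measure I :=
  ENNReal.ofReal (1 / (n : ℝ)) • ∑ j, Measure.dirac (design n j)

instance (n : ℕ) : IsFiniteMeasure (designMeasure n) := by
  unfold designMeasure
  exact Measure.smul_finite _ ENNReal.ofReal_ne_top

/-- Both risks of the theorem are `L²(μ)` risks, for the design measure and for Lebesgue measure;
from here on a single argument treats a general `μ`. -/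
lemma riskEmp_eq (g : I → C(I, ℝ) → ℝ) (l : ℝ) {n : ℕ} (T : Estimator n) (S : C(I, ℝ)) :
    riskEmp g l T S = riskWith (designMeasure n) g l T S := by
  unfold riskEmp riskWith designMeasure
  refine iSup_congr fun p => iSup_congr fun _ => lintegral_congr fun y => ?_
  rw [lintegral_smul_measure, lintegral_finsetSum_measure, ENNReal.ofReal_mul (by positivity),
    ENNReal.ofReal_sum_of_nonneg fun _ _ => sq_nonneg _]
  simp only [lintegral_dirac, smul_eq_mul]

/-- The fourth moment of the standard normal law is 3, which is the role of the bound `3 ≤ l`. -/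
lemma stdGaussian_mem_noiseFamily (n : ℕ) {l : ℝ} (hl : 3 ≤ l) :
    Measure.pi (fun _ : Fin n => gaussianReal 0 1) ∈ noiseFamily n l := by
  have hmp : ∀ j : Fin n, MeasurePreserving (fun ξ : Fin n → ℝ => ξ j)
      (Measure.pi (fun _ : Fin n => gaussianReal 0 1)) (gaussianReal 0 1) := fun j =>
    measurePreserving_eval _ j
  have hint : ∀ (j : Fin n) (f : ℝ → ℝ), Continuous f →
      ∫ ξ, f (ξ j) ∂(Measure.pi (fun _ : Fin n => gaussianReal 0 1)) =
        ∫ x, f x ∂(gaussianReal 0 1) := fun j f hf =>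
    integral_comp_eval (μ := fun _ : Fin n => gaussianReal 0 1) (i := j) (f := f)
      hf.aestronglyMeasurable
  refine ⟨inferInstance, iIndepFun_pi (X := fun _ => id) (fun _ => aemeasurable_id), fun j =>
      ⟨?_, ?_, ?_, ?_⟩⟩
  · exact (memLp_id_gaussianReal' (μ := 0) (v := 1) 4 (by simp)).comp_measurePreserving (hmp j)
  · rw [hint j (fun x => x) (by fun_prop)]; exact integral_std_one
  · rw [hint j (fun x => x ^ 2) (by fun_prop)]; exact integral_std_two
  · rw [hint j (fun x => x ^ 4) (by fun_prop), integral_std_four]; exact hl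

lemma obsLaw_stdGaussian {g : I → C(I, ℝ) → ℝ} {n : ℕ} {S : C(I, ℝ)}
    (hg : ∀ j : Fin n, 0 ≤ g (design n j) S) :
    obsLaw g S (Measure.pi (fun _ : Fin n => gaussianReal 0 1)) =
      prodGaussian (fun j => S (design n j)) (fun j => g (design n j) S ^ 2) := by
  unfold obsLaw prodGaussian
  have hf : ∀ j : Fin n, AEMeasurable (fun x : ℝ => S (design n j) + g (design n j) S * x)
      (gaussianReal 0 1) := fun j => by fun_prop
  have : ∀ j : Fin n, IsProbabilityMeasure ((gaussianReal 0 1).map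
      (fun x : ℝ => S (design n j) + g (design n j) S * x)) := fun j =>
    Measure.isProbabilityMeasure_map (hf j)
  rw [Measure.pi_map_pi hf]
  congr 1
  ext1 j
  rw [gaussianReal_eq_map _ (sq_nonneg _), Real.sqrt_sq (hg j)]

lemma normal_risk_le {g : I → C(I, ℝ) → ℝ} {n : ℕ} {l : ℝ} (hl : 3 ≤ l) (μ : Measure I)
    (T : Estimator n) {S : C(I, ℝ)} (hg : ∀ j : Fin n, 0 ≤ g (design n j) S) :
    ∫⁻ y, (∫⁻ x, ENNReal.ofReal ((T.1 y x - S x) ^ 2) ∂μ)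
      ∂(prodGaussian (fun j => S (design n j)) (fun j => g (design n j) S ^ 2)) ≤
      riskWith μ g l T S := by
  rw [← obsLaw_stdGaussian hg]
  exact le_iSup₂ (f := fun p _ => ∫⁻ y, (∫⁻ x, ENNReal.ofReal ((T.1 y x - S x) ^ 2) ∂μ)
    ∂(obsLaw g S p)) _ (stdGaussian_mem_noiseFamily n hl)

/-! ### Bessel's inequality -/

lemma bessel {α ι : Type*} [MeasurableSpace α] [Fintype ι] [DecidableEq ι] {μ : Measure α}
    [IsFiniteMeasure μ] {φ : ι → α → ℝ} (hφ : ∀ i, Measurable (φ i)) {K : ℝ}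
    (hK : ∀ i x, |φ i x| ≤ K)
    (horth : ∀ i j, ∫ x, φ i x * φ j x ∂μ = if i = j then 1 else 0) {u : α → ℝ}
    (hu : MemLp u 2 μ) :
    ∑ i, (∫ x, u x * φ i x ∂μ) ^ 2 ≤ ∫ x, u x ^ 2 ∂μ := by
  set c : ι → ℝ := fun i => ∫ x, u x * φ i x ∂μ with hc
  have hφ2 : ∀ i, MemLp (φ i) 2 μ := fun i =>
    MemLp.of_bound (hφ i).aestronglyMeasurable K (ae_of_all _ fun x => hK i x)
  have i1 : ∀ i, Integrable (fun x => u x * φ i x) μ := fun i => hu.integrable_mul (hφ2 i)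
  have i2 : ∀ i j, Integrable (fun x => φ i x * φ j x) μ := fun i j => (hφ2 i).integrable_mul
      (hφ2 j)
  have h0 : 0 ≤ ∫ x, (u x - ∑ i, c i * φ i x) ^ 2 ∂μ := integral_nonneg fun _ => sq_nonneg _
  have hexp : ∀ x, (u x - ∑ i, c i * φ i x) ^ 2 = u x ^ 2 - ∑ i, 2 * c i * (u x * φ i x) +
      ∑ i, ∑ j, c i * c j * (φ i x * φ j x) := by
    intro x
    have h1 : (∑ i, c i * φ i x) ^ 2 = ∑ i, ∑ j, c i * c j * (φ i x * φ j x) := by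
      rw [sq, Finset.sum_mul_sum]
      exact Finset.sum_congr rfl fun i _ => Finset.sum_congr rfl fun j _ => by ring
    have h2 : ∑ i, 2 * c i * (u x * φ i x) = 2 * u x * ∑ i, c i * φ i x := by
      rw [Finset.mul_sum]
      exact Finset.sum_congr rfl fun i _ => by ring
    rw [h2, ← h1]; ring
  simp_rw [hexp] at h0
  have i3 : Integrable (fun x => ∑ i, 2 * c i * (u x * φ i x)) μ :=
    integrable_finsetSum _ fun i _ => (i1 i).const_mul _
  have i4 : Integrable (fun x => ∑ i, ∑ j, c i * c j * (φ i x * φ j x)) μ :=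
    integrable_finsetSum _ fun i _ => integrable_finsetSum _ fun j _ => (i2 i j).const_mul _
  have i5 : Integrable (fun x => u x ^ 2 - ∑ i, 2 * c i * (u x * φ i x)) μ := hu.integrable_sq.sub
      i3
  rw [integral_add i5 i4, integral_sub hu.integrable_sq i3,
    integral_finsetSum _ fun i _ => (i1 i).const_mul _,
    integral_finsetSum _ fun i _ => integrable_finsetSum _ fun j _ => (i2 i j).const_mul _] at h0
  have h3 : ∀ i, ∫ x, ∑ j, c i * c j * (φ i x * φ j x) ∂μ = c i ^ 2 := by
    intro i
    rw [integral_finsetSum _ fun j _ => (i2 i j).const_mul _]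
    simp_rw [integral_const_mul, horth]
    simp [sq]
  simp_rw [h3, integral_const_mul] at h0
  have h4 : ∑ i, 2 * c i * ∫ x, u x * φ i x ∂μ = 2 * ∑ i, c i ^ 2 := by
    rw [Finset.mul_sum]
    exact Finset.sum_congr rfl fun i _ => by simp only [hc]; ring
  rw [h4] at h0
  linarith

/-- The lower integral is superadditive for arbitrary functions, which spares all measurability
checks on the conditional risks. -/
lemma sum_lintegral_le {α ι : Type*} [MeasurableSpace α] {μ : Measure α} (s : Finset ι)
    (f : ι → α → ℝ≥0∞) : ∑ i ∈ s, ∫⁻ x, f i x ∂μ ≤ ∫⁻ x, ∑ i ∈ s, f i x ∂μ := by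
  classical
  induction s using Finset.induction_on with
  | empty => simp
  | insert i s hi ih =>
    simp only [Finset.sum_insert hi]
    exact (add_le_add le_rfl ih).trans (le_lintegral_add _ _)

/-- Bessel's inequality for the deviation of a measurable function `t` from a continuous one. -/
lemma bessel_loss {ι : Type*} [Fintype ι] [DecidableEq ι] {μ : Measure I}
    [IsFiniteMeasure μ] {φ : ι → I → ℝ} (hφ : ∀ i, Measurable (φ i)) {K : ℝ}
    (hK : ∀ i x, |φ i x| ≤ K)
    (horth : ∀ i j, ∫ x, φ i x * φ j x ∂μ = if i = j then 1 else 0) {t : I → ℝ}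
    (ht : Measurable t) (S : C(I, ℝ)) :
    ∑ i, ENNReal.ofReal ((∫ x, t x * φ i x ∂μ - ∫ x, S x * φ i x ∂μ) ^ 2) ≤
      ∫⁻ x, ENNReal.ofReal ((t x - S x) ^ 2) ∂μ := by
  -- An infinite loss dominates everything. With finite loss, `t` itself is square integrable
  -- because `S` is bounded, and the coefficients of `t - S` may be split.
  by_cases htop : ∫⁻ x, ENNReal.ofReal ((t x - S x) ^ 2) ∂μ = ⊤
  · rw [htop]; exact le_top
  have hS : MemLp (fun x => S x) 2 μ := MemLp.of_bound S.continuous.aestronglyMeasurable ‖S‖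
    (ae_of_all _ fun x => S.norm_coe_le_norm x)
  have mu : Measurable fun x => t x - S x := ht.sub S.continuous.measurable
  have iu : Integrable (fun x => (t x - S x) ^ 2) μ := by
    refine ⟨(mu.pow_const 2).aestronglyMeasurable, ?_⟩
    rw [hasFiniteIntegral_iff_ofReal (ae_of_all _ fun _ => sq_nonneg _)]
    exact lt_top_iff_ne_top.2 htop
  have hu : MemLp (fun x => t x - S x) 2 μ :=
    (memLp_two_iff_integrable_sq mu.aestronglyMeasurable).2 iu
  have ht2 : MemLp t 2 μ := by
    have := hu.add hS
    refine this.ae_eq (ae_of_all _ fun x => by simp)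
  have hφ2 : ∀ i, MemLp (φ i) 2 μ := fun i =>
    MemLp.of_bound (hφ i).aestronglyMeasurable K (ae_of_all _ fun x => hK i x)
  have hsub : ∀ i, ∫ x, t x * φ i x ∂μ - ∫ x, S x * φ i x ∂μ = ∫ x, (t x - S x) * φ i x ∂μ := by
    intro i
    have h1 : Integrable (fun x => t x * φ i x) μ := ht2.integrable_mul (hφ2 i)
    have h2 : Integrable (fun x => S x * φ i x) μ := hS.integrable_mul (hφ2 i)
    rw [← integral_sub h1 h2]
    simp_rw [sub_mul]
  simp_rw [hsub]
  rw [← ofReal_integral_eq_lintegral_ofReal iu (ae_of_all _ fun _ => sq_nonneg _),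
    ← ENNReal.ofReal_sum_of_nonneg fun _ _ => sq_nonneg _]
  exact ENNReal.ofReal_le_ofReal (bessel hφ hK horth hu)

/-! ### The lower bound for a finite-dimensional family -/

section Family

variable {ι : Type*} [Fintype ι]

/-- The function `∑ θ_i e_i`. -/
def synth (e : ι → C(I, ℝ)) : (ι → ℝ) →L[ℝ] C(I, ℝ) :=
  ∑ i, (ContinuousLinearMap.proj (R := ℝ) (φ := fun _ : ι => ℝ) i).smulRight (e i)

lemma synth_apply (e : ι → C(I, ℝ)) (θ : ι → ℝ) : synth e θ = ∑ i, θ i • e i := by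
  simp [synth]

lemma synth_apply_apply (e : ι → C(I, ℝ)) (θ : ι → ℝ) (x : I) :
    synth e θ x = ∑ i, θ i * e i x := by
  simp [synth_apply]

lemma synth_single [DecidableEq ι] (e : ι → C(I, ℝ)) (i : ι) : synth e (Pi.single i 1) = e i := by
  rw [synth_apply, Finset.sum_eq_single i]
  · simp
  · intro j _ hj; simp [hj]
  · simp

/-- The functional `S ↦ ∫ S φ dμ` on the family. -/
def coeffCLM (e : ι → C(I, ℝ)) (μ : Measure I) (φ : I → ℝ) : (ι → ℝ) →L[ℝ] ℝ :=
  ∑ i, (∫ x, e i x * φ x ∂μ) • ContinuousLinearMap.proj (R := ℝ) (φ := fun _ : ι => ℝ) i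

lemma coeffCLM_single [DecidableEq ι] (e : ι → C(I, ℝ)) (μ : Measure I) (φ : I → ℝ) (i : ι) :
    coeffCLM e μ φ (Pi.single i 1) = ∫ x, e i x * φ x ∂μ := by
  rw [coeffCLM, _root_.sum_apply, Finset.sum_eq_single i]
  · simp
  · intro j _ hj; simp [hj]
  · simp

lemma coeffCLM_apply (e : ι → C(I, ℝ)) (μ : Measure I) [IsFiniteMeasure μ] {φ : I → ℝ}
    (hφ : Measurable φ) {K : ℝ} (hK : ∀ x, |φ x| ≤ K) (θ : ι → ℝ) :
    coeffCLM e μ φ θ = ∫ x, synth e θ x * φ x ∂μ := by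
  have hφ2 : MemLp φ 2 μ :=
    MemLp.of_bound hφ.aestronglyMeasurable K (ae_of_all _ fun x => hK x)
  have i1 : ∀ i, Integrable (fun x => e i x * φ x) μ := fun i =>
    (MemLp.of_bound (e i).continuous.aestronglyMeasurable ‖e i‖
      (ae_of_all _ fun x => (e i).norm_coe_le_norm x) : MemLp (fun x => e i x) 2 μ).integrable_mul
          hφ2
  simp_rw [synth_apply_apply, Finset.sum_mul, mul_assoc]
  rw [integral_finsetSum _ fun i _ => (i1 i).const_mul _]
  simp_rw [integral_const_mul]
  simp [coeffCLM, mul_comm]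

/-- The Bayes lower bound for the risk over the family `∑ θ_i e_i`, `∑ a_i θ_i² < R`. -/
theorem bayes_family [DecidableEq ι] {g : I → C(I, ℝ) → ℝ} (hg0 : ∀ x S, 0 ≤ g x S)
    (h2 : CondH2 g) {n : ℕ} {l : ℝ} (hl : 3 ≤ l) {μ : Measure I} [IsFiniteMeasure μ]
    (e : ι → C(I, ℝ)) {φ : ι → I → ℝ} (hφ : ∀ i, Measurable (φ i)) {K : ℝ}
    (hK : ∀ i x, |φ i x| ≤ K)
    (horth : ∀ i j, ∫ x, φ i x * φ j x ∂μ = if i = j then 1 else 0)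
    {a w : ι → ℝ} (ha : ∀ i, 0 ≤ a i) (hw : ∀ i, 0 < w i)
    {ρ ρ' : ℝ → ℝ} (hρ : ∀ t, HasDerivAt ρ (ρ' t) t) {L R₀ R : ℝ} (hR : R₀ < R)
    (hρ0 : ∀ t, R₀ ≤ t → ρ t = 0) (hρ1 : ∀ t, |ρ t| ≤ 1) (hρ' : ∀ t, |ρ' t| ≤ L)
    (hρm : Measurable ρ')
    (hpos : ∀ θ, wsq a θ < R → ∀ j, 0 < g (design n j) (synth e θ)) {J : ι → ℝ} (hJ0 : ∀ i, 0 ≤ J i)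
    (hJ : ∀ i θ, wsq a θ < R → ∑ j, ((e i (design n j)) ^ 2 / (g (design n j) (synth e θ)) ^ 2 +
      (fderiv ℝ (fun u : C(I, ℝ) => (g (design n j) u) ^ 2) (synth e θ) (e i)) ^ 2 /
        (2 * ((g (design n j) (synth e θ)) ^ 2) ^ 2)) ≤ J i)
    {Z : ℝ} (hZ0 : 0 ≤ Z)
    (hZ : ∫⁻ θ, ENNReal.ofReal (ρ (wsq a θ) ^ 2) ∂(prodGaussian 0 w) = ENNReal.ofReal Z)
    (T : Estimator n) {X : ℝ≥0∞} (hX : ∀ θ, wsq a θ < R → riskWith μ g l T (synth e θ) ≤ X) :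
    ∑ i, ENNReal.ofReal (((∫ x, e i x * φ i x ∂μ) * Z) ^ 2 /
      (J i * Z + w i * (4 * L * a i + 1 / w i) ^ 2)) ≤ X * ENNReal.ofReal Z := by
  set M : Fin n → (ι → ℝ) →L[ℝ] ℝ := fun j =>
    (ContinuousMap.evalCLM ℝ (design n j)).comp (synth e) with hM
  set v : Fin n → (ι → ℝ) → ℝ := fun j θ => (g (design n j) (synth e θ)) ^ 2 with hv
  have hMa : ∀ j θ, M j θ = synth e θ (design n j) := fun j θ => rfl
  have hvd : ∀ j, Differentiable ℝ (v j) := fun j => (h2 (design n j)).comp (synth e).differentiable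
  have hfd : ∀ j θ u, fderiv ℝ (v j) θ u =
      fderiv ℝ (fun u : C(I, ℝ) => (g (design n j) u) ^ 2) (synth e θ) (synth e u) := by
    intro j θ u
    have := fderiv_comp θ (h2 (design n j) (synth e θ)) (synth e).differentiableAt
    have h : v j = (fun u : C(I, ℝ) => (g (design n j) u) ^ 2) ∘ synth e := rfl
    rw [h, this, ContinuousLinearMap.fderiv]
    rfl
  set Tc : ι → (Fin n → ℝ) → ℝ := fun i y => ∫ x, T.1 y x * φ i x ∂μ with hTc
  -- The coefficients of an estimate are measurable in the observations because the estimator is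
  -- jointly measurable.
  have mTc : ∀ i, Measurable (Tc i) := by
    intro i
    have h1 : Measurable fun z : (Fin n → ℝ) × I => T.1 z.1 z.2 * φ i z.2 :=
      T.2.mul ((hφ i).comp measurable_snd)
    exact (h1.stronglyMeasurable.integral_prod_right' (ν := μ)).measurable
  have hvpos : ∀ θ, wsq a θ < R → ∀ j, 0 < v j θ := fun θ h j => pow_pos (hpos θ h j) 2
  -- The estimated functional is `∫ S φ_i`, not the parameter `θ_i`. It may depend on other
  -- coordinates too, since the cutoff destroys orthogonality, but the van Trees bound only involves
  -- its derivative in direction `i`, which is `∫ e_i φ_i`.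
  have hcoord : ∀ i, ENNReal.ofReal (((∫ x, e i x * φ i x ∂μ) * Z) ^ 2 /
      (J i * Z + w i * (4 * L * a i + 1 / w i) ^ 2)) ≤
      ∫⁻ θ, ENNReal.ofReal (ρ (wsq a θ) ^ 2) *
        ∫⁻ y, ENNReal.ofReal ((Tc i y - coeffCLM e μ (φ i) θ) ^ 2)
        ∂(prodGaussian (fun j => M j θ) (fun j => v j θ)) ∂(prodGaussian 0 w) := by
    intro i
    have h := bayes_coordinate M hvd ha hw hρ hR hρ0 hρ1 hρ' hρm hvpos i (hJ0 i)
      (fun θ hθ => by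
        simp_rw [hfd, hMa, synth_single]
        exact hJ i θ hθ) (coeffCLM e μ (φ i)) (mTc i) hZ0 hZ
    rwa [coeffCLM_single] at h
  refine (Finset.sum_le_sum fun i _ => hcoord i).trans ((sum_lintegral_le _ _).trans ?_)
  have mρ : Measurable ρ := (continuous_iff_continuousAt.2 fun t => (hρ t).continuousAt).measurable
  have mρw : Measurable fun θ => ENNReal.ofReal (ρ (wsq a θ) ^ 2) :=
    ((mρ.comp (continuous_wsq a).measurable).pow_const 2).ennreal_ofReal
  rw [← hZ, mul_comm X, ← lintegral_mul_const _ mρw]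
  refine lintegral_mono fun θ => ?_
  rw [← Finset.mul_sum]
  rcases lt_or_ge (wsq a θ) R with h | h
  · refine mul_le_mul_right ?_ _
    refine (sum_lintegral_le _ _).trans (le_trans (lintegral_mono fun y => ?_)
      ((normal_risk_le hl μ T fun j => hg0 _ _).trans (hX θ h)))
    simp_rw [coeffCLM_apply e μ (hφ _) (hK _)]
    exact bessel_loss hφ hK horth (T.2.comp measurable_prodMk_left) _
  · simp [hρ0 _ (hR.le.trans h)]

end Family

/-! ### The sine system -/

/-- The functions `√2 sin (π i u)`. -/
def sine (i : ℕ) (u : ℝ) : ℝ := Real.sqrt 2 * Real.sin (Real.pi * i * u)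

@[fun_prop]
lemma continuous_sine (i : ℕ) : Continuous (sine i) := by unfold sine; fun_prop

lemma abs_sine_le (i : ℕ) (u : ℝ) : |sine i u| ≤ Real.sqrt 2 := by
  unfold sine
  rw [abs_mul, abs_of_nonneg (Real.sqrt_nonneg 2)]
  exact mul_le_of_le_one_right (Real.sqrt_nonneg 2) (Real.abs_sin_le_one _)

lemma sine_sq_le (i : ℕ) (u : ℝ) : sine i u ^ 2 ≤ 2 := by
  rw [← sq_abs, ← Real.sq_sqrt (show (0 : ℝ) ≤ 2 by norm_num)]
  exact pow_le_pow_left₀ (abs_nonneg _) (abs_sine_le i u) 2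

/-- Each differentiation shifts the phase of a sine by `π / 2`, so the product of two derivatives of
order `p` brings in the phase `p π`. -/
lemma integral_cos_pi_mul {N : ℤ} (hN : N ≠ 0) (p : ℕ) :
    ∫ u in (0 : ℝ)..1, Real.cos (Real.pi * N * u + p * Real.pi) = 0 := by
  have hc : Real.pi * (N : ℝ) ≠ 0 := mul_ne_zero Real.pi_ne_zero (by exact_mod_cast hN)
  rw [intervalIntegral.integral_comp_mul_add (fun x => Real.cos x) hc, integral_cos]
  have h1 : Real.pi * (N : ℝ) * 1 + p * Real.pi = ((N + p : ℤ) : ℝ) * Real.pi := by push_cast; ring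
  have h2 : Real.pi * (N : ℝ) * 0 + p * Real.pi = (p : ℝ) * Real.pi := by ring
  rw [h1, h2, Real.sin_int_mul_pi, Real.sin_nat_mul_pi]
  simp

/-- The orthogonality of the sine system and of its derivatives. -/
lemma integral_sin_mul_sin (p : ℕ) {i l : ℕ} (hi : 1 ≤ i) :
    ∫ u in (0 : ℝ)..1, (Real.sqrt 2 * Real.sin (Real.pi * i * u + p * Real.pi / 2)) *
      (Real.sqrt 2 * Real.sin (Real.pi * l * u + p * Real.pi / 2)) = if i = l then 1 else 0 := by
  have h : ∀ u : ℝ, (Real.sqrt 2 * Real.sin (Real.pi * i * u + p * Real.pi / 2)) *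
      (Real.sqrt 2 * Real.sin (Real.pi * l * u + p * Real.pi / 2)) =
      Real.cos (Real.pi * ((i - l : ℤ) : ℝ) * u + (0 : ℕ) * Real.pi) -
        Real.cos (Real.pi * ((i + l : ℤ) : ℝ) * u + p * Real.pi) := by
    intro u
    have h2 : Real.sqrt 2 * Real.sqrt 2 = 2 := Real.mul_self_sqrt (by norm_num)
    have e1 : Real.pi * ((i - l : ℤ) : ℝ) * u + (0 : ℕ) * Real.pi =
      (Real.pi * i * u + p * Real.pi / 2) - (Real.pi * l * u + p * Real.pi / 2) := by
      push_cast; ring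
    have e2 : Real.pi * ((i + l : ℤ) : ℝ) * u + p * Real.pi =
      (Real.pi * i * u + p * Real.pi / 2) + (Real.pi * l * u + p * Real.pi / 2) := by
      push_cast; ring
    rw [e1, e2, Real.cos_sub, Real.cos_add (Real.pi * i * u + p * Real.pi / 2)]
    linear_combination (Real.sin (Real.pi * i * u + p * Real.pi / 2) *
      Real.sin (Real.pi * l * u + p * Real.pi / 2)) * h2
  simp_rw [h]
  rw [intervalIntegral.integral_sub (Continuous.intervalIntegrable (by fun_prop) _ _)
    (Continuous.intervalIntegrable (by fun_prop) _ _), integral_cos_pi_mul (by omega) p]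
  split_ifs with hil
  · subst hil; simp
  · rw [integral_cos_pi_mul (by omega)]; simp

lemma integral_sine_mul_sine {i l : ℕ} (hi : 1 ≤ i) :
    ∫ u in (0 : ℝ)..1, sine i u * sine l u = if i = l then 1 else 0 := by
  have := integral_sin_mul_sin 0 (l := l) hi
  simpa [sine] using this

lemma sum_cos_telescope (q : ℕ) (x : ℝ) :
    2 * Real.sin (x / 2) * ∑ r ∈ Finset.range q, Real.cos (x * (r + 1)) =
      Real.sin (x * q + x / 2) - Real.sin (x / 2) := by
  induction q with
  | zero => simp
  | succ q ih =>
    rw [Finset.sum_range_succ, mul_add, ih]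
    push_cast
    have e1 : x * (q + 1) + x / 2 = x * (q + 1) + x / 2 := rfl
    have e2 : x * q + x / 2 = x * (q + 1) - x / 2 := by ring
    rw [e2, Real.sin_sub, Real.sin_add]
    ring

/-- In the telescoped sum with `x = π N / q`, the upper term is `sin (N π + x/2) = (-1)^N sin
(x/2)`. The condition `0 < N < 2q` keeps `sin (x/2)` positive, so it can be divided out. -/
lemma sum_cos_grid {q N : ℕ} (hN : 0 < N) (hNq : N < 2 * q) :
    ∑ r ∈ Finset.range q, Real.cos (Real.pi * N * ((r + 1) / q)) = ((-1) ^ N - 1) / 2 := by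
  have hq : 0 < q := by omega
  have hq' : (0 : ℝ) < q := by exact_mod_cast hq
  have h := sum_cos_telescope q (Real.pi * N / q)
  have e1 : Real.pi * N / q * q = N * Real.pi := by field_simp
  rw [e1, add_comm ((N : ℝ) * Real.pi), Real.sin_add_nat_mul_pi] at h
  have hs : 0 < Real.sin (Real.pi * N / q / 2) := by
    apply Real.sin_pos_of_pos_of_lt_pi
    · positivity
    · rw [div_div, div_lt_iff₀ (by positivity)]
      have : (N : ℝ) < 2 * q := by exact_mod_cast hNq
      nlinarith [Real.pi_pos]
  have e2 : ∀ r : ℕ, Real.pi * N * (((r : ℝ) + 1) / q) = Real.pi * N / q * (r + 1) := fun r => by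
    ring
  simp_rw [e2]
  have h3 : 2 * Real.sin (Real.pi * N / q / 2) *
      (∑ r ∈ Finset.range q, Real.cos (Real.pi * N / q * (r + 1)) - ((-1) ^ N - 1) / 2) = 0 := by
    rw [mul_sub, h]; ring
  rcases mul_eq_zero.1 h3 with h4 | h4
  · exact absurd h4 (by positivity)
  · linarith

/-- The frequencies `i - l` and `i + l` have the same parity, so the two cosine sums coincide and
cancel. Orthogonality on the grid is therefore exact for frequencies below `q`. -/
lemma sum_sine_mul_sine {q i l : ℕ} (hi : 1 ≤ i) (hl : 1 ≤ l) (hiq : i < q) (hlq : l < q) :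
    (1 / (q : ℝ)) * ∑ r ∈ Finset.range q, sine i ((r + 1) / q) * sine l ((r + 1) / q) =
      if i = l then 1 else 0 := by
  wlog hle : l ≤ i generalizing i l
  · have := this hl hi hlq hiq (by omega)
    simp_rw [mul_comm (sine i _), this, eq_comm]
  have hq' : (0 : ℝ) < q := by exact_mod_cast (by omega : 0 < q)
  have h : ∀ u : ℝ, sine i u * sine l u = Real.cos (Real.pi * ((i - l : ℕ) : ℝ) * u) -
        Real.cos (Real.pi * ((i + l : ℕ) : ℝ) * u) := by
    intro u
    have h2 : Real.sqrt 2 * Real.sqrt 2 = 2 := Real.mul_self_sqrt (by norm_num)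
    have e1 : Real.pi * ((i - l : ℕ) : ℝ) * u = Real.pi * i * u - Real.pi * l * u := by
      push_cast [Nat.cast_sub hle]; ring
    have e2 : Real.pi * ((i + l : ℕ) : ℝ) * u = Real.pi * i * u + Real.pi * l * u := by
      push_cast; ring
    rw [e1, e2, Real.cos_sub, Real.cos_add]
    unfold sine
    linear_combination (Real.sin (Real.pi * i * u) * Real.sin (Real.pi * l * u)) * h2
  simp_rw [h]
  rw [Finset.sum_sub_distrib, sum_cos_grid (by omega : 0 < i + l) (by omega)]
  split_ifs with hil
  · subst hil
    simp [← two_mul, hq'.ne']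
  · rw [sum_cos_grid (by omega : 0 < i - l) (by omega)]
    have : ((-1 : ℝ)) ^ (i + l) = (-1) ^ (i - l) := by
      have : i + l = (i - l) + 2 * l := by omega
      rw [this, pow_add, pow_mul]; simp
    rw [this]; simp

/-! ### Cutoff functions -/

/-- A smooth cutoff function on `[0,1]` with transition zones of width `η`. -/
structure IsCutoff (χ : ℝ → ℝ) (η : ℝ) : Prop where
  pos : 0 < η
  smooth : ∀ n : ℕ, ContDiff ℝ n χ
  nonneg : ∀ u, 0 ≤ χ u
  le_one : ∀ u, χ u ≤ 1
  eq_one : ∀ u, η ≤ u → u ≤ 1 - η → χ u = 1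
  eq_zero : ∀ u, (u ≤ η / 2 ∨ 1 - η / 2 ≤ u) → χ u = 0

lemma exists_isCutoff {η : ℝ} (h0 : 0 < η) (h1 : η < 1 / 2) : ∃ χ, IsCutoff χ η := by
  let f : ContDiffBump (1 / 2 : ℝ) :=
    ⟨1 / 2 - η, 1 / 2 - η / 2, by linarith, by linarith⟩
  refine ⟨f, h0, fun n => f.contDiff, fun u => f.nonneg, fun u => f.le_one, fun u h2 h3 => ?_,
    fun u h => ?_⟩
  · apply f.one_of_mem_closedBall
    rw [Metric.mem_closedBall, Real.dist_eq, abs_le]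
    change -(1 / 2 - η) ≤ _ ∧ _ ≤ 1 / 2 - η
    constructor <;> linarith
  · apply f.zero_of_le_dist
    rw [Real.dist_eq, le_abs]
    change 1 / 2 - η / 2 ≤ _ ∨ 1 / 2 - η / 2 ≤ _
    rcases h with h | h
    · right; linarith
    · left; linarith

lemma IsCutoff.continuous {χ : ℝ → ℝ} {η : ℝ} (h : IsCutoff χ η) : Continuous χ :=
  (h.smooth 0).continuous

lemma IsCutoff.eq_zero_of_notMem {χ : ℝ → ℝ} {η : ℝ} (h : IsCutoff χ η) {u : ℝ}
    (hu : u ∉ Set.Ioc (0 : ℝ) 1) : χ u = 0 := by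
  apply h.eq_zero
  have := h.pos
  simp only [Set.mem_Ioc, not_and, not_le] at hu
  by_contra hc
  push Not at hc
  have := hu (by linarith)
  linarith [hc.2]

/-! ### Integration over a window -/

/-- The measure `μ` on `[0,1]` restricted to the window `(mh, (m+1)h]`, `h = q/n`, and transported
to the unit interval is `h` times the functional `Λ`. -/
def WindowFormula (μ : Measure I) (n q : ℕ) (Λ : (ℝ → ℝ) → ℝ) : Prop :=
  ∀ m : ℕ, (m + 1) * q ≤ n → ∀ F : ℝ → ℝ, (∀ u, u ∉ Set.Ioc (0 : ℝ) 1 → F u = 0) →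
    ∫ x : I, F ((x : ℝ) * n / q - m) ∂μ = (q : ℝ) / n * Λ F

/-- The average over the grid `1/q, 2/q, …, 1`. -/
def gridMean (q : ℕ) (F : ℝ → ℝ) : ℝ := (1 / (q : ℝ)) * ∑ r ∈ Finset.range q, F ((r + 1) / q)

/-- The integral over the unit interval. -/
def unitMean (F : ℝ → ℝ) : ℝ := ∫ u in (0 : ℝ)..1, F u

lemma integral_unitInterval (f : ℝ → ℝ) : ∫ x : I, f x = ∫ x in (0 : ℝ)..1, f x := by
  rw [intervalIntegral.integral_of_le zero_le_one, ← integral_Icc_eq_integral_Ioc]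
  exact integral_subtype measurableSet_Icc f

/-- A linear change of variables on the whole line, `F` being zero off the unit interval and the
window lying inside `[0,1]`. -/
lemma windowFormula_volume {n q : ℕ} (hq : 0 < q) : WindowFormula volume n q unitMean := by
  intro m hm F hF
  have hn : 0 < n := lt_of_lt_of_le (by positivity) hm
  have hq' : (0 : ℝ) < q := by exact_mod_cast hq
  have hn' : (0 : ℝ) < n := by exact_mod_cast hn
  have hm' : ((m : ℝ) + 1) * q ≤ n := by exact_mod_cast hm
  rw [integral_unitInterval (fun x => F (x * n / q - m)), unitMean,
    intervalIntegral.integral_of_le zero_le_one, intervalIntegral.integral_of_le zero_le_one,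
    setIntegral_eq_integral_of_forall_compl_eq_zero,
        setIntegral_eq_integral_of_forall_compl_eq_zero]
  · have e : ∀ x : ℝ, x * n / q - m = (x / ((q : ℝ) / n)) - m := fun x => by field_simp
    simp_rw [e]
    rw [Measure.integral_comp_div (fun y => F (y - m)), integral_sub_right_eq_self F (m : ℝ),
      abs_of_pos (by positivity), smul_eq_mul]
  · exact fun u hu => hF u hu
  · intro x hx
    apply hF
    simp only [Set.mem_Ioc, not_and, not_le] at hx ⊢
    intro h1
    have h2 : 0 < x := by
      by_contra h3
      have : x * n / q ≤ 0 := div_nonpos_of_nonpos_of_nonneg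
        (mul_nonpos_of_nonpos_of_nonneg (not_lt.1 h3) hn'.le) hq'.le
      have : (0 : ℝ) ≤ m := Nat.cast_nonneg m
      linarith
    have h3 := hx h2
    have h4 : (m : ℝ) + 1 < x * n / q := by
      rw [lt_div_iff₀ hq']
      nlinarith
    linarith

lemma integral_designMeasure (n : ℕ) (f : I → ℝ) :
    ∫ x, f x ∂(designMeasure n) = (1 / (n : ℝ)) * ∑ j : Fin n, f (design n j) := by
  unfold designMeasure
  rw [integral_smul_measure, integral_finsetSum_measure fun j _ => integrable_dirac (by simp),
    ENNReal.toReal_ofReal (by positivity)]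
  simp

/-- Because the window length is a whole number `q` of design steps and the window is open on the
left and closed on the right, it contains exactly `q` design points. They rescale to the same grid
`1/q, …, 1` in every window. -/
lemma windowFormula_design {n q : ℕ} (hq : 0 < q) :
    WindowFormula (designMeasure n) n q (gridMean q) := by
  intro m hm F hF
  have hn : 0 < n := lt_of_lt_of_le (by positivity) hm
  have hq' : (0 : ℝ) < q := by exact_mod_cast hq
  have hn' : (0 : ℝ) < n := by exact_mod_cast hn
  rw [integral_designMeasure]
  have h1 : ∑ j : Fin n, F ((design n j : ℝ) * n / q - m) =
      ∑ j ∈ Finset.range n, F (((j : ℝ) + 1) / q - m) := by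
    rw [← Fin.sum_univ_eq_sum_range (fun j => F (((j : ℝ) + 1) / q - m))]
    refine Finset.sum_congr rfl fun j _ => ?_
    simp only [design]
    congr 2
    field_simp
  have h2 : ∑ j ∈ Finset.range n, F (((j : ℝ) + 1) / q - m) =
      ∑ j ∈ Finset.Ico (m * q) ((m + 1) * q), F (((j : ℝ) + 1) / q - m) := by
    symm
    apply Finset.sum_subset
    · intro j hj
      simp only [Finset.mem_Ico, Finset.mem_range] at hj ⊢
      omega
    · intro j hj hj'
      apply hF
      intro hmem
      apply hj'
      rw [Finset.mem_Ico]
      obtain ⟨h3, h4⟩ := hmem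
      have h5 : (m : ℝ) * q < j + 1 := by
        rw [← lt_div_iff₀ hq']; linarith
      have h6 : (j : ℝ) + 1 ≤ (m + 1) * q := by
        rw [← div_le_iff₀ hq']; linarith
      have h5' : m * q < j + 1 := by exact_mod_cast h5
      have h6' : j + 1 ≤ (m + 1) * q := by exact_mod_cast h6
      omega
  rw [h1, h2, Finset.sum_Ico_eq_sum_range]
  have h3 : (m + 1) * q - m * q = q := by rw [add_mul, one_mul]; omega
  rw [h3, gridMean]
  have h4 : ∀ r : ℕ, (((m * q + r : ℕ) : ℝ) + 1) / q - m = (r + 1) / q := fun r => by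
    push_cast; field_simp; ring
  simp_rw [h4]
  field_simp

/-- The cutoff differs from 1 only on two zones of length `η`, where the squared sine is at most 2.
-/
lemma unitMean_cutoff_ge {χ : ℝ → ℝ} {η : ℝ} (hχ : IsCutoff χ η) (hη : η < 1 / 2) {i : ℕ}
    (hi : 1 ≤ i) : 1 - 4 * η ≤ unitMean fun u => χ u * sine i u * sine i u := by
  have h0 := hχ.pos
  have hc := hχ.continuous
  have h1 := integral_sine_mul_sine (l := i) hi
  rw [if_pos rfl] at h1
  have hI : ∀ (f : ℝ → ℝ) (_ : Continuous f) a b, IntervalIntegrable f volume a b :=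
    fun f hf a b => hf.intervalIntegrable a b
  have hle : unitMean (fun u => (1 - χ u) * sine i u ^ 2) ≤ 4 * η := by
    unfold unitMean
    have hcont : Continuous fun u => (1 - χ u) * sine i u ^ 2 := by fun_prop
    have hb : ∀ u, (1 - χ u) * sine i u ^ 2 ≤ 2 := fun u => by
      nlinarith [hχ.nonneg u, hχ.le_one u, sine_sq_le i u, sq_nonneg (sine i u)]
    rw [← intervalIntegral.integral_add_adjacent_intervals (hI _ hcont 0 η) (hI _ hcont η 1),
      ← intervalIntegral.integral_add_adjacent_intervals (hI _ hcont η (1 - η)) (hI _ hcont _ 1)]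
    have e1 : ∫ u in (0 : ℝ)..η, (1 - χ u) * sine i u ^ 2 ≤ ∫ u in (0 : ℝ)..η, (2 : ℝ) :=
      intervalIntegral.integral_mono_on h0.le (hI _ hcont _ _) (by simp) fun u _ => hb u
    have e2 : ∫ u in (1 - η)..1, (1 - χ u) * sine i u ^ 2 ≤ ∫ u in (1 - η)..1, (2 : ℝ) :=
      intervalIntegral.integral_mono_on (by linarith) (hI _ hcont _ _) (by simp) fun u _ => hb u
    have e3 : ∫ u in η..(1 - η), (1 - χ u) * sine i u ^ 2 = 0 := by
      rw [intervalIntegral.integral_congr (g := fun _ => (0 : ℝ))]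
      · simp
      · intro u hu
        rw [Set.uIcc_of_le (by linarith)] at hu
        simp [hχ.eq_one u hu.1 hu.2]
    simp only [intervalIntegral.integral_const, smul_eq_mul] at e1 e2
    linarith
  have h2 : unitMean (fun u => (1 - χ u) * sine i u ^ 2) =
      1 - unitMean fun u => χ u * sine i u * sine i u := by
    unfold unitMean
    have e : ∀ u, (1 - χ u) * sine i u ^ 2 =
        sine i u * sine i u - χ u * sine i u * sine i u := fun u => by ring
    simp_rw [e]
    rw [intervalIntegral.integral_sub (hI _ (by fun_prop) _ _) (hI _ (by fun_prop) _ _), h1]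
  linarith

lemma gridMean_cutoff_ge {χ : ℝ → ℝ} {η : ℝ} (hχ : IsCutoff χ η) (hη : η < 1 / 2) {i q : ℕ}
    (hi : 1 ≤ i) (hiq : i < q) :
    1 - 4 * η - 2 / q ≤ gridMean q fun u => χ u * sine i u * sine i u := by
  have h0 := hχ.pos
  have hq : (0 : ℝ) < q := by exact_mod_cast (by omega : 0 < q)
  have h1 := sum_sine_mul_sine hi hi hiq hiq
  rw [if_pos rfl] at h1
  set A := Finset.range ⌊η * q⌋₊
  -- The grid points in the two transition zones are counted. Rounding can add one point on the
  -- right, hence the extra `2 / q` compared with the integral.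
  set B := Finset.Ico ⌊(1 - η) * q⌋₊ q
  have hpt : ∀ r ∈ Finset.range q, (1 - χ ((r + 1) / q)) * sine i ((r + 1) / q) ^ 2 ≤
      (if r ∈ A then (2 : ℝ) else 0) + (if r ∈ B then (2 : ℝ) else 0) := by
    intro r hr
    rw [Finset.mem_range] at hr
    set u : ℝ := ((r : ℝ) + 1) / q with hu
    have hb : (1 - χ u) * sine i u ^ 2 ≤ 2 := by
      nlinarith [hχ.nonneg u, hχ.le_one u, sine_sq_le i u, sq_nonneg (sine i u)]
    by_cases hA : u < η
    · have : r ∈ A := by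
        rw [Finset.mem_range, ← Nat.add_one_le_iff, Nat.le_floor_iff (by positivity)]
        rw [hu, div_lt_iff₀ hq] at hA
        push_cast; linarith
      rw [if_pos this]
      split_ifs <;> linarith
    by_cases hB : 1 - η < u
    · have : r ∈ B := by
        rw [Finset.mem_Ico]
        refine ⟨?_, hr⟩
        rw [← Nat.lt_add_one_iff, Nat.floor_lt (by nlinarith)]
        rw [hu, lt_div_iff₀ hq] at hB
        push_cast; linarith
      rw [if_pos this]
      split_ifs <;> linarith
    rw [hχ.eq_one u (not_lt.1 hA) (not_lt.1 hB)]
    simp only [sub_self, zero_mul]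
    split_ifs <;> norm_num
  have hsum := Finset.sum_le_sum hpt
  have hAc : (A.card : ℝ) ≤ η * q := by
    simp only [A, Finset.card_range]
    exact Nat.floor_le (by positivity)
  have hBc : (B.card : ℝ) ≤ η * q + 1 := by
    simp only [B, Nat.card_Ico]
    have h3 : ⌊(1 - η) * q⌋₊ ≤ q := by
      apply Nat.floor_le_of_le
      nlinarith
    rw [Nat.cast_sub h3]
    have := Nat.lt_floor_add_one ((1 - η) * q)
    linarith
  have hbound : ∑ r ∈ Finset.range q, ((if r ∈ A then (2 : ℝ) else 0) +
      (if r ∈ B then (2 : ℝ) else 0)) ≤ 4 * η * q + 2 := by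
    rw [Finset.sum_add_distrib, ← Finset.sum_filter, ← Finset.sum_filter, Finset.sum_const,
      Finset.sum_const]
    have h3 : ((Finset.range q).filter (· ∈ A)).card ≤ A.card :=
      Finset.card_le_card fun r hr => (Finset.mem_filter.1 hr).2
    have h4 : ((Finset.range q).filter (· ∈ B)).card ≤ B.card :=
      Finset.card_le_card fun r hr => (Finset.mem_filter.1 hr).2
    have h3' : (((Finset.range q).filter (· ∈ A)).card : ℝ) ≤ A.card := by exact_mod_cast h3
    have h4' : (((Finset.range q).filter (· ∈ B)).card : ℝ) ≤ B.card := by exact_mod_cast h4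
    simp only [nsmul_eq_mul]
    linarith
  have h2 : ∑ r ∈ Finset.range q, (1 - χ ((r + 1) / q)) * sine i ((r + 1) / q) ^ 2 =
      ∑ r ∈ Finset.range q, sine i ((r + 1) / q) * sine i ((r + 1) / q) -
      ∑ r ∈ Finset.range q, χ ((r + 1) / q) * sine i ((r + 1) / q) * sine i ((r + 1) / q) := by
    rw [← Finset.sum_sub_distrib]
    exact Finset.sum_congr rfl fun r _ => by ring
  have h5 : (1 / (q : ℝ)) * (∑ r ∈ Finset.range q, sine i ((r + 1) / q) * sine i ((r + 1) / q) -
      ∑ r ∈ Finset.range q, χ ((r + 1) / q) * sine i ((r + 1) / q) * sine i ((r + 1) / q)) ≤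
      (1 / (q : ℝ)) * (4 * η * q + 2) :=
    mul_le_mul_of_nonneg_left (by linarith) (by positivity)
  rw [mul_sub, h1] at h5
  have h6 : (1 / (q : ℝ)) * (4 * η * q + 2) = 4 * η + 2 / q := by field_simp
  unfold gridMean
  linarith

/-! ### The localized basis -/

/-- The localized sine functions, extended by zero. -/
def phi (n q m i : ℕ) (x : I) : ℝ :=
  Real.sqrt (n / q) * (Set.Ioc (0 : ℝ) 1).indicator (sine i) ((x : ℝ) * n / q - m)

/-- The localized sine functions, cut off smoothly. -/
def bump {χ : ℝ → ℝ} {η : ℝ} (hχ : IsCutoff χ η) (n q m i : ℕ) : C(I, ℝ) where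
  toFun x := Real.sqrt (n / q) * (χ ((x : ℝ) * n / q - m) * sine i ((x : ℝ) * n / q - m))
  continuous_toFun := by
    have := hχ.continuous
    fun_prop

lemma measurable_phi (n q m i : ℕ) : Measurable (phi n q m i) := by
  unfold phi
  have h : Measurable fun x : I => (x : ℝ) * n / q - m := by fun_prop
  exact measurable_const.mul
    (((continuous_sine i).measurable.indicator measurableSet_Ioc).comp h)

lemma abs_indicator_sine_le (i : ℕ) (u : ℝ) :
    |(Set.Ioc (0 : ℝ) 1).indicator (sine i) u| ≤ Real.sqrt 2 := by
  by_cases hu : u ∈ Set.Ioc (0 : ℝ) 1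
  · rw [Set.indicator_of_mem hu]; exact abs_sine_le i u
  · rw [Set.indicator_of_notMem hu]; simp

lemma abs_phi_le (n q m i : ℕ) (x : I) : |phi n q m i x| ≤ Real.sqrt (n / q) * Real.sqrt 2 := by
  unfold phi
  rw [abs_mul, abs_of_nonneg (Real.sqrt_nonneg _)]
  exact mul_le_mul_of_nonneg_left (abs_indicator_sine_le i _) (Real.sqrt_nonneg _)

lemma bump_eq {χ : ℝ → ℝ} {η : ℝ} (hχ : IsCutoff χ η) (n q m i : ℕ) (x : I) :
    bump hχ n q m i x = χ ((x : ℝ) * n / q - m) * phi n q m i x := by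
  simp only [bump, phi, ContinuousMap.coe_mk]
  by_cases hu : (x : ℝ) * n / q - m ∈ Set.Ioc (0 : ℝ) 1
  · rw [Set.indicator_of_mem hu]; ring
  · rw [Set.indicator_of_notMem hu, hχ.eq_zero_of_notMem hu]; ring

lemma abs_bump_le_abs_phi {χ : ℝ → ℝ} {η : ℝ} (hχ : IsCutoff χ η) (n q m i : ℕ) (x : I) :
    |bump hχ n q m i x| ≤ |phi n q m i x| := by
  rw [bump_eq, abs_mul, abs_of_nonneg (hχ.nonneg _)]
  exact mul_le_of_le_one_left (abs_nonneg _) (hχ.le_one _)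

lemma bump_sq_le_phi_sq {χ : ℝ → ℝ} {η : ℝ} (hχ : IsCutoff χ η) (n q m i : ℕ) (x : I) :
    bump hχ n q m i x ^ 2 ≤ phi n q m i x * phi n q m i x := by
  rw [← sq, ← sq_abs (phi n q m i x), ← sq_abs]
  exact pow_le_pow_left₀ (abs_nonneg _) (abs_bump_le_abs_phi hχ n q m i x) 2

lemma window_disjoint {m m' : ℕ} (h : m ≠ m') {t : ℝ} (h1 : t - m ∈ Set.Ioc (0 : ℝ) 1)
    (h2 : t - m' ∈ Set.Ioc (0 : ℝ) 1) : False := by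
  obtain ⟨a1, a2⟩ := h1
  obtain ⟨b1, b2⟩ := h2
  have h3 : (m : ℝ) < m' + 1 := by linarith
  have h4 : (m' : ℝ) < m + 1 := by linarith
  have h3' : m < m' + 1 := by exact_mod_cast h3
  have h4' : m' < m + 1 := by exact_mod_cast h4
  omega

lemma phi_mul_phi_of_ne {n q m m' : ℕ} (h : m ≠ m') (i i' : ℕ) (x : I) :
    phi n q m i x * phi n q m' i' x = 0 := by
  unfold phi
  by_cases h1 : (x : ℝ) * n / q - m ∈ Set.Ioc (0 : ℝ) 1
  · by_cases h2 : (x : ℝ) * n / q - m' ∈ Set.Ioc (0 : ℝ) 1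
    · exact (window_disjoint h h1 h2).elim
    · simp [Set.indicator_of_notMem h2]
  · simp [Set.indicator_of_notMem h1]

/-- Different windows have disjoint supports. Within one window the normalization `n / q` cancels
the length `q / n`, and orthonormality is that of the sines for `Λ`. -/
lemma integral_phi_mul_phi {μ : Measure I} {n q : ℕ} {Λ : (ℝ → ℝ) → ℝ} (hq : 0 < q)
    (hW : WindowFormula μ n q Λ)
    (hΛ : ∀ F G : ℝ → ℝ, (∀ u ∈ Set.Ioc (0 : ℝ) 1, F u = G u) → Λ F = Λ G)
    (horth : ∀ i l, 1 ≤ i → 1 ≤ l → i < q → l < q →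
      Λ (fun u => sine i u * sine l u) = if i = l then 1 else 0)
    {m m' i i' : ℕ} (hm : (m + 1) * q ≤ n) (hi : 1 ≤ i) (hiq : i < q) (hi' : 1 ≤ i')
    (hiq' : i' < q) :
    ∫ x, phi n q m i x * phi n q m' i' x ∂μ = if m = m' ∧ i = i' then 1 else 0 := by
  by_cases hmm : m = m'
  · subst hmm
    have hn : 0 < n := lt_of_lt_of_le (by positivity) hm
    have hq' : (0 : ℝ) < q := by exact_mod_cast hq
    have hn' : (0 : ℝ) < n := by exact_mod_cast hn
    have h := hW m hm (fun u => (n : ℝ) / q * ((Set.Ioc (0 : ℝ) 1).indicator (sine i) u *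
      (Set.Ioc (0 : ℝ) 1).indicator (sine i') u)) (fun u hu => by
        simp [Set.indicator_of_notMem hu])
    have h2 : ∀ x : I, phi n q m i x * phi n q m i' x = (n : ℝ) / q *
      ((Set.Ioc (0 : ℝ) 1).indicator (sine i) ((x : ℝ) * n / q - m) *
      (Set.Ioc (0 : ℝ) 1).indicator (sine i') ((x : ℝ) * n / q - m)) := by
      intro x
      unfold phi
      have := Real.mul_self_sqrt (show (0 : ℝ) ≤ n / q by positivity)
      linear_combination ((Set.Ioc (0 : ℝ) 1).indicator (sine i) ((x : ℝ) * n / q - m) *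
      (Set.Ioc (0 : ℝ) 1).indicator (sine i') ((x : ℝ) * n / q - m)) * this
    simp_rw [h2]
    rw [integral_const_mul]
    have h3 := hW m hm (fun u => (Set.Ioc (0 : ℝ) 1).indicator (sine i) u *
      (Set.Ioc (0 : ℝ) 1).indicator (sine i') u) (fun u hu => by
        simp [Set.indicator_of_notMem hu])
    rw [h3, hΛ _ (fun u => sine i u * sine i' u) (fun u hu => by
      simp [Set.indicator_of_mem hu]), horth i i' hi hi' hiq hiq']
    simp only [true_and]
    field_simp
  · simp_rw [phi_mul_phi_of_ne hmm]
    simp [hmm]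

lemma integral_bump_mul_phi {μ : Measure I} {n q : ℕ} {Λ : (ℝ → ℝ) → ℝ} (hq : 0 < q)
    (hW : WindowFormula μ n q Λ)
    (hΛ : ∀ F G : ℝ → ℝ, (∀ u ∈ Set.Ioc (0 : ℝ) 1, F u = G u) → Λ F = Λ G)
    {χ : ℝ → ℝ} {η : ℝ} (hχ : IsCutoff χ η) {m i : ℕ} (hm : (m + 1) * q ≤ n) :
    ∫ x, bump hχ n q m i x * phi n q m i x ∂μ = Λ (fun u => χ u * sine i u * sine i u) := by
  have hn : 0 < n := lt_of_lt_of_le (by positivity) hm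
  have hq' : (0 : ℝ) < q := by exact_mod_cast hq
  have hn' : (0 : ℝ) < n := by exact_mod_cast hn
  have h2 : ∀ x : I, bump hχ n q m i x * phi n q m i x = (n : ℝ) / q *
    (χ ((x : ℝ) * n / q - m) * sine i ((x : ℝ) * n / q - m) *
      (Set.Ioc (0 : ℝ) 1).indicator (sine i) ((x : ℝ) * n / q - m)) := by
    intro x
    simp only [phi, bump, ContinuousMap.coe_mk]
    have := Real.mul_self_sqrt (show (0 : ℝ) ≤ n / q by positivity)
    linear_combination (χ ((x : ℝ) * n / q - m) * sine i ((x : ℝ) * n / q - m) *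
      (Set.Ioc (0 : ℝ) 1).indicator (sine i) ((x : ℝ) * n / q - m)) * this
  simp_rw [h2]
  rw [integral_const_mul]
  have h3 := hW m hm (fun u => χ u * sine i u * (Set.Ioc (0 : ℝ) 1).indicator (sine i) u)
    (fun u hu => by simp [Set.indicator_of_notMem hu])
  rw [h3, hΛ _ (fun u => χ u * sine i u * sine i u) (fun u hu => by
      simp [Set.indicator_of_mem hu])]
  field_simp

lemma unitMean_congr (F G : ℝ → ℝ) (h : ∀ u ∈ Set.Ioc (0 : ℝ) 1, F u = G u) :
    unitMean F = unitMean G := by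
  unfold unitMean
  refine intervalIntegral.integral_congr_ae (ae_of_all _ fun u hu => h u ?_)
  rwa [Set.uIoc_of_le zero_le_one] at hu

lemma gridMean_congr (q : ℕ) (F G : ℝ → ℝ) (h : ∀ u ∈ Set.Ioc (0 : ℝ) 1, F u = G u) :
    gridMean q F = gridMean q G := by
  unfold gridMean
  congr 1
  refine Finset.sum_congr rfl fun r hr => h _ ?_
  rw [Finset.mem_range] at hr
  have hq : (0 : ℝ) < q := by exact_mod_cast (by omega : 0 < q)
  have : (r : ℝ) + 1 ≤ q := by exact_mod_cast hr
  exact ⟨by positivity, (div_le_one hq).2 this⟩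

/-- The measures for which the localized sine functions are orthonormal and for which
the smooth cutoff is almost harmless. -/
structure Localizes (μ : Measure I) (n q : ℕ) : Prop where
  orth : ∀ m m' i i' : ℕ, (m + 1) * q ≤ n → 1 ≤ i → i < q → 1 ≤ i' → i' < q →
    ∫ x, phi n q m i x * phi n q m' i' x ∂μ = if m = m' ∧ i = i' then 1 else 0
  diag : ∀ (χ : ℝ → ℝ) (η : ℝ) (hχ : IsCutoff χ η), η < 1 / 2 → ∀ m i : ℕ, (m + 1) * q ≤ n →
    1 ≤ i → i < q → 1 - 4 * η - 2 / q ≤ ∫ x, bump hχ n q m i x * phi n q m i x ∂μ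

lemma localizes_volume {n q : ℕ} (hq : 0 < q) : Localizes volume n q where
  orth m m' i i' hm hi hiq hi' hiq' :=
    integral_phi_mul_phi hq (windowFormula_volume hq) unitMean_congr
      (fun i l hi _ _ _ => integral_sine_mul_sine hi) hm hi hiq hi' hiq'
  diag χ η hχ hη m i hm hi hiq := by
    rw [integral_bump_mul_phi hq (windowFormula_volume hq) unitMean_congr hχ hm]
    have := unitMean_cutoff_ge hχ hη hi
    have h2 : (0 : ℝ) ≤ 2 / q := by positivity
    linarith

lemma localizes_design {n q : ℕ} (hq : 0 < q) : Localizes (designMeasure n) n q where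
  orth m m' i i' hm hi hiq hi' hiq' :=
    integral_phi_mul_phi hq (windowFormula_design hq) (gridMean_congr q)
      (fun i l hi hl hiq hlq => sum_sine_mul_sine hi hl hiq hlq) hm hi hiq hi' hiq'
  diag χ η hχ hη m i hm hi hiq := by
    rw [integral_bump_mul_phi hq (windowFormula_design hq) (gridMean_congr q) hχ hm]
    exact gridMean_cutoff_ge hχ hη hi hiq

/-- The empirical norm of the localized functions. -/
lemma sum_bump_sq_le {χ : ℝ → ℝ} {η : ℝ} (hχ : IsCutoff χ η) {n q m i : ℕ}
    (hm : (m + 1) * q ≤ n) (hi : 1 ≤ i) (hiq : i < q) :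
    ∑ j : Fin n, bump hχ n q m i (design n j) ^ 2 ≤ n := by
  have hq : 0 < q := by omega
  have hn : 0 < n := lt_of_lt_of_le (by positivity) hm
  have hn' : (0 : ℝ) < n := by exact_mod_cast hn
  have h := (localizes_design (n := n) hq).orth m m i i hm hi hiq hi hiq
  rw [integral_designMeasure] at h
  simp only [and_self, if_true] at h
  have h2 : ∑ j : Fin n, phi n q m i (design n j) * phi n q m i (design n j) = n := by
    rw [one_div, inv_mul_eq_iff_eq_mul₀ hn'.ne', mul_one] at h
    exact h
  rw [← h2]
  exact Finset.sum_le_sum fun j _ => bump_sq_le_phi_sq hχ n q m i _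

lemma l2norm_bump_le {χ : ℝ → ℝ} {η : ℝ} (hχ : IsCutoff χ η) {n q m i : ℕ}
    (hm : (m + 1) * q ≤ n) (hi : 1 ≤ i) (hiq : i < q) : l2norm (bump hχ n q m i) ≤ 1 := by
  have hq : 0 < q := by omega
  unfold l2norm
  rw [Real.sqrt_le_iff, one_pow]
  refine ⟨zero_le_one, ?_⟩
  have h := (localizes_volume (n := n) hq).orth m m i i hm hi hiq hi hiq
  simp only [and_self, if_true] at h
  rw [← h]
  have hphi : MemLp (phi n q m i) 2 volume :=
    MemLp.of_bound (measurable_phi n q m i).aestronglyMeasurable _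
      (ae_of_all _ fun x => abs_phi_le n q m i x)
  refine integral_mono_of_nonneg (ae_of_all _ fun _ => sq_nonneg _) (hphi.integrable_mul hphi)
    (ae_of_all _ fun x => bump_sq_le_phi_sq hχ n q m i x)

/-- The function has height of order `h^{-1/2}` and lives on a window of length `h = q / n`, so its
integral is of order `√h`: small for short windows, unlike its `L²` norm. -/
lemma l1norm_bump_le {χ : ℝ → ℝ} {η : ℝ} (hχ : IsCutoff χ η) {n q m i : ℕ} (hq : 0 < q)
    (hm : (m + 1) * q ≤ n) : l1norm (bump hχ n q m i) ≤ Real.sqrt (2 * q / n) := by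
  have hn : 0 < n := lt_of_lt_of_le (by positivity) hm
  have hq' : (0 : ℝ) < q := by exact_mod_cast hq
  have hn' : (0 : ℝ) < n := by exact_mod_cast hn
  unfold l1norm
  have h := windowFormula_volume hq m hm (fun u => Real.sqrt (n / q) * |χ u * sine i u|)
    (fun u hu => by simp [hχ.eq_zero_of_notMem hu])
  have h2 : ∀ x : I, |bump hχ n q m i x| = Real.sqrt (n / q) *
      |χ ((x : ℝ) * n / q - m) * sine i ((x : ℝ) * n / q - m)| := by
    intro x
    simp only [bump, ContinuousMap.coe_mk]
    rw [abs_mul, abs_of_nonneg (Real.sqrt_nonneg _)]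
  simp_rw [h2]
  rw [h]
  have h3 : unitMean (fun u => Real.sqrt (n / q) * |χ u * sine i u|) ≤
      Real.sqrt (n / q) * Real.sqrt 2 := by
    unfold unitMean
    have hc := hχ.continuous
    have : ∫ u in (0 : ℝ)..1, Real.sqrt (n / q) * |χ u * sine i u| ≤
        ∫ u in (0 : ℝ)..1, Real.sqrt (n / q) * Real.sqrt 2 := by
      refine intervalIntegral.integral_mono_on zero_le_one
        (Continuous.intervalIntegrable (by fun_prop) _ _) (by simp) fun u _ => ?_
      refine mul_le_mul_of_nonneg_left ?_ (Real.sqrt_nonneg _)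
      rw [abs_mul, abs_of_nonneg (hχ.nonneg u)]
      exact (mul_le_of_le_one_left (abs_nonneg _) (hχ.le_one u)).trans (abs_sine_le i u)
    simpa using this
  calc (q : ℝ) / n * unitMean (fun u => Real.sqrt (n / q) * |χ u * sine i u|)
      ≤ (q : ℝ) / n * (Real.sqrt (n / q) * Real.sqrt 2) :=
        mul_le_mul_of_nonneg_left h3 (by positivity)
    _ = Real.sqrt (2 * q / n) := by
        rw [← Real.sqrt_mul (by positivity)]
        have h4 : (q : ℝ) / n = Real.sqrt (((q : ℝ) / n) ^ 2) := (Real.sqrt_sq (by positivity)).symm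
        rw [h4, ← Real.sqrt_mul (sq_nonneg _)]
        congr 1
        field_simp

/-! ### Sobolev norms of trigonometric polynomials with a cutoff -/

@[fun_prop]
lemma contDiff_sine (i : ℕ) {n : WithTop ℕ∞} : ContDiff ℝ n (sine i) := by unfold sine; fun_prop

lemma iteratedDeriv_sine (i p : ℕ) : iteratedDeriv p (sine i) = fun u =>
    (Real.pi * i) ^ p * (Real.sqrt 2 * Real.sin (Real.pi * i * u + p * Real.pi / 2)) := by
  induction p with
  | zero => ext u; simp [sine]
  | succ p ih =>
    rw [iteratedDeriv_succ, ih]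
    ext u
    have h : HasDerivAt (fun u : ℝ => (Real.pi * i) ^ p *
        (Real.sqrt 2 * Real.sin (Real.pi * i * u + p * Real.pi / 2)))
        ((Real.pi * i) ^ p * (Real.sqrt 2 * (Real.cos (Real.pi * i * u + p * Real.pi / 2) *
          (Real.pi * i)))) u := by
      have := ((((hasDerivAt_id u).const_mul (Real.pi * i)).add_const
          (p * Real.pi / 2)).sin.const_mul
        (Real.sqrt 2)).const_mul ((Real.pi * i) ^ p)
      simpa using this
    rw [h.deriv]
    have e : Real.pi * i * u + ((p + 1 : ℕ) : ℝ) * Real.pi / 2 =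
      (Real.pi * i * u + p * Real.pi / 2) + Real.pi / 2 := by push_cast; ring
    rw [e, Real.sin_add_pi_div_two]
    ring

/-- The sine polynomial with the coefficients `c`. -/
def sinePoly (s : Finset ℕ) (c : ℕ → ℝ) (u : ℝ) : ℝ := ∑ i ∈ s, c i * sine i u

lemma contDiff_sinePoly (s : Finset ℕ) (c : ℕ → ℝ) {n : WithTop ℕ∞} :
    ContDiff ℝ n (sinePoly s c) := by
  unfold sinePoly
  fun_prop

lemma iteratedDeriv_sinePoly (s : Finset ℕ) (c : ℕ → ℝ) (p : ℕ) (u : ℝ) :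
    iteratedDeriv p (sinePoly s c) u = ∑ i ∈ s, c i * (Real.pi * i) ^ p *
      (Real.sqrt 2 * Real.sin (Real.pi * i * u + p * Real.pi / 2)) := by
  unfold sinePoly
  rw [iteratedDeriv_fun_sum fun i _ => by fun_prop]
  refine Finset.sum_congr rfl fun i _ => ?_
  rw [iteratedDeriv_const_mul_field, iteratedDeriv_sine]
  ring

lemma integral_iteratedDeriv_sinePoly_sq {s : Finset ℕ} (hs : ∀ i ∈ s, 1 ≤ i) (c : ℕ → ℝ) (p : ℕ) :
    ∫ u in (0 : ℝ)..1, iteratedDeriv p (sinePoly s c) u ^ 2 =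
      ∑ i ∈ s, (Real.pi * i) ^ (2 * p) * c i ^ 2 := by
  have h : ∀ u, iteratedDeriv p (sinePoly s c) u ^ 2 = ∑ i ∈ s, ∑ l ∈ s,
      (c i * (Real.pi * i) ^ p * (c l * (Real.pi * l) ^ p)) *
      ((Real.sqrt 2 * Real.sin (Real.pi * i * u + p * Real.pi / 2)) *
        (Real.sqrt 2 * Real.sin (Real.pi * l * u + p * Real.pi / 2))) := by
    intro u
    rw [iteratedDeriv_sinePoly, sq, Finset.sum_mul_sum]
    exact Finset.sum_congr rfl fun i _ => Finset.sum_congr rfl fun l _ => by ring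
  simp_rw [h]
  rw [intervalIntegral.integral_finsetSum fun i _ =>
    Continuous.intervalIntegrable (by fun_prop) _ _]
  refine Finset.sum_congr rfl fun i hi => ?_
  rw [intervalIntegral.integral_finsetSum fun l _ =>
    Continuous.intervalIntegrable (by fun_prop) _ _]
  simp_rw [intervalIntegral.integral_const_mul, integral_sin_mul_sin p (hs i hi)]
  simp only [mul_ite, mul_one, mul_zero, Finset.sum_ite_eq, hi, if_true]
  ring

/-- Passing from order `p < k` to order `k` multiplies each coefficient by `(π i)^{k-p} ≥ i₀`, so
derivatives of lower order are negligible for high frequencies. -/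
lemma integral_iteratedDeriv_sinePoly_sq_le {s : Finset ℕ} {i₀ k p : ℕ} (h0 : 1 ≤ i₀)
    (hs : ∀ i ∈ s, i₀ ≤ i) (c : ℕ → ℝ) (hp : p < k) :
    ∫ u in (0 : ℝ)..1, iteratedDeriv p (sinePoly s c) u ^ 2 ≤
      (∑ i ∈ s, (Real.pi * i) ^ (2 * k) * c i ^ 2) / (i₀ : ℝ) ^ 2 := by
  have hi0 : (1 : ℝ) ≤ i₀ := by exact_mod_cast h0
  rw [integral_iteratedDeriv_sinePoly_sq (fun i hi => h0.trans (hs i hi)), Finset.sum_div]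
  refine Finset.sum_le_sum fun i hi => ?_
  have h1 : (i₀ : ℝ) ≤ i := by exact_mod_cast hs i hi
  have h2 : (i₀ : ℝ) ≤ Real.pi * i := by nlinarith [Real.pi_gt_three]
  rw [le_div_iff₀ (by positivity)]
  have h3 : (i₀ : ℝ) ^ 2 ≤ (Real.pi * i) ^ (2 * (k - p)) :=
    calc (i₀ : ℝ) ^ 2 ≤ (i₀ : ℝ) ^ (2 * (k - p)) := pow_le_pow_right₀ hi0 (by omega)
      _ ≤ _ := pow_le_pow_left₀ (by positivity) h2 _
  have h4 : (Real.pi * i) ^ (2 * k) = (Real.pi * i) ^ (2 * p) * (Real.pi * i) ^ (2 * (k - p)) := by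
    rw [← pow_add]; congr 1; omega
  rw [h4, mul_right_comm]
  exact mul_le_mul_of_nonneg_right (mul_le_mul_of_nonneg_left h3 (by positivity)) (sq_nonneg _)

/-- Treats a Leibniz sum in which `F` is differentiated fewer than `k` times; `τ l` is the order
falling on `F` and is injective, so each order is counted once. It serves for all terms when `j <
k`, and for all but the leading term when `j = k`. -/
lemma leibniz_lower {χ F : ℝ → ℝ} {k j : ℕ} {K : ℝ} {u : ℝ}
    (hK : ∀ l ≤ k, |iteratedDeriv l χ u| ≤ K) {s : Finset ℕ} {τ : ℕ → ℕ}
    (hs : s.card ≤ k + 1) (hjk : j ≤ k) (hl : ∀ l ∈ s, l ≤ k) (hτ : ∀ l ∈ s, τ l < k)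
    (hinj : Set.InjOn τ s) :
    (∑ l ∈ s, (j.choose l : ℝ) * iteratedDeriv l χ u * iteratedDeriv (τ l) F u) ^ 2 ≤
      (k + 1) * (2 ^ k * K) ^ 2 * ∑ p ∈ Finset.range k, iteratedDeriv p F u ^ 2 := by
  have h1 := sq_sum_le_card_mul_sum_sq (s := s)
    (f := fun l => (j.choose l : ℝ) * iteratedDeriv l χ u * iteratedDeriv (τ l) F u)
  have h2 : ∀ l ∈ s, ((j.choose l : ℝ) * iteratedDeriv l χ u * iteratedDeriv (τ l) F u) ^ 2 ≤
      (2 ^ k * K) ^ 2 * iteratedDeriv (τ l) F u ^ 2 := by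
    intro l hls
    rw [mul_pow]
    refine mul_le_mul_of_nonneg_right ?_ (sq_nonneg _)
    rw [← sq_abs]
    refine pow_le_pow_left₀ (abs_nonneg _) ?_ 2
    rw [abs_mul, abs_of_nonneg (by positivity)]
    have h3 : (j.choose l : ℝ) ≤ 2 ^ k := by
      have : j.choose l ≤ 2 ^ k := (Nat.choose_le_two_pow j l).trans
        (Nat.pow_le_pow_right (by norm_num) hjk)
      exact_mod_cast this
    exact mul_le_mul h3 (hK l (hl l hls)) (abs_nonneg _) (by positivity)
  have h3 : ∑ l ∈ s, iteratedDeriv (τ l) F u ^ 2 ≤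
      ∑ p ∈ Finset.range k, iteratedDeriv p F u ^ 2 := by
    rw [← Finset.sum_image (f := fun p => iteratedDeriv p F u ^ 2) hinj]
    refine Finset.sum_le_sum_of_subset_of_nonneg ?_ fun _ _ _ => sq_nonneg _
    intro p hp
    obtain ⟨l, hls, rfl⟩ := Finset.mem_image.1 hp
    exact Finset.mem_range.2 (hτ l hls)
  have hs' : (s.card : ℝ) ≤ k + 1 := by exact_mod_cast hs
  calc _ ≤ (s.card : ℝ) * ∑ l ∈ s,
        ((j.choose l : ℝ) * iteratedDeriv l χ u * iteratedDeriv (τ l) F u) ^ 2 := h1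
    _ ≤ (k + 1) * ∑ l ∈ s, (2 ^ k * K) ^ 2 * iteratedDeriv (τ l) F u ^ 2 :=
        mul_le_mul hs' (Finset.sum_le_sum h2) (Finset.sum_nonneg fun _ _ => sq_nonneg _)
          (by positivity)
    _ = (k + 1) * (2 ^ k * K) ^ 2 * ∑ l ∈ s, iteratedDeriv (τ l) F u ^ 2 := by
        rw [← Finset.mul_sum]; ring
    _ ≤ _ := mul_le_mul_of_nonneg_left h3 (by positivity)

/-- A smooth cutoff increases the Sobolev norm of a sine polynomial with high frequencies only
slightly. -/
theorem exists_cutoff_sobolev {χ : ℝ → ℝ} {η : ℝ} (hχ : IsCutoff χ η) (k : ℕ) {ε : ℝ}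
    (hε : 0 < ε) : ∃ i₁ : ℕ, 1 ≤ i₁ ∧ ∀ (s : Finset ℕ) (c : ℕ → ℝ), (∀ i ∈ s, i₁ ≤ i) →
      (∀ j < k, ∫ u in (0 : ℝ)..1, iteratedDeriv j (fun u => χ u * sinePoly s c u) u ^ 2 ≤
        ε * ∑ i ∈ s, (Real.pi * i) ^ (2 * k) * c i ^ 2) ∧
      ∫ u in (0 : ℝ)..1, iteratedDeriv k (fun u => χ u * sinePoly s c u) u ^ 2 ≤
        (1 + 2 * ε) * ∑ i ∈ s, (Real.pi * i) ^ (2 * k) * c i ^ 2 := by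
  have hK1 : ∀ l : ℕ, ∃ K : ℝ, ∀ u ∈ Set.Icc (0 : ℝ) 1, |iteratedDeriv l χ u| ≤ K := by
    intro l
    obtain ⟨K, hK⟩ := isCompact_Icc.exists_bound_of_continuousOn
      (s := Set.Icc (0 : ℝ) 1) ((hχ.smooth l).continuous_iteratedDeriv' l).continuousOn
    exact ⟨K, fun u hu => by simpa using hK u hu⟩
  choose K0 hK0 using hK1
  set K : ℝ := ∑ l ∈ Finset.range (k + 1), |K0 l| with hKdef
  have hK : ∀ u ∈ Set.Icc (0 : ℝ) 1, ∀ l ≤ k, |iteratedDeriv l χ u| ≤ K := by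
    intro u hu l hl
    refine (hK0 l u hu).trans ((le_abs_self _).trans ?_)
    exact Finset.single_le_sum (f := fun l => |K0 l|) (fun _ _ => abs_nonneg _)
      (Finset.mem_range.2 (by omega))
  set B : ℝ := (k + 1) * (2 ^ k * K) ^ 2 with hB
  have hB0 : 0 ≤ B := by positivity
  obtain ⟨i₁, hi₁⟩ := exists_nat_ge ((1 + 1 / ε) * B * k / ε + 1)
  have hi1' : (1 : ℝ) ≤ i₁ := by
    have : 0 ≤ (1 + 1 / ε) * B * k / ε := by positivity
    linarith
  have hi1 : 1 ≤ i₁ := by exact_mod_cast hi1'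
  refine ⟨i₁, hi1, fun s c hs => ?_⟩
  set A : ℝ := ∑ i ∈ s, (Real.pi * i) ^ (2 * k) * c i ^ 2 with hA
  have hA0 : 0 ≤ A := Finset.sum_nonneg fun i _ =>
    mul_nonneg (by rw [pow_mul]; positivity) (sq_nonneg _)
  set F := sinePoly s c with hF
  have hFc : ∀ p, Continuous (iteratedDeriv p F) := fun p =>
    (contDiff_sinePoly s c (n := (p : ℕ))).continuous_iteratedDeriv' p
  have hFc2 : ∀ p, Continuous fun u => iteratedDeriv p F u ^ 2 := fun p => (hFc p).pow 2
  have hPc : ∀ p, Continuous (iteratedDeriv p (fun u => χ u * F u)) := fun p =>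
    ((hχ.smooth p).mul (contDiff_sinePoly s c)).continuous_iteratedDeriv' p
  have hI : ∀ (f : ℝ → ℝ) (_ : Continuous f), IntervalIntegrable f volume 0 1 :=
    fun f hf => hf.intervalIntegrable 0 1
  set E : ℝ → ℝ := fun u => ∑ p ∈ Finset.range k, iteratedDeriv p F u ^ 2 with hE
  have hEc : Continuous E := by
    simp only [hE]
    exact continuous_finsetSum _ fun p _ => (hFc p).pow 2
  have hEint : ∫ u in (0 : ℝ)..1, E u ≤ k * (A / (i₁ : ℝ) ^ 2) := by
    simp only [hE]
    rw [intervalIntegral.integral_finsetSum fun p _ => hI _ (hFc2 p)]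
    refine (Finset.sum_le_card_nsmul _ _ _ fun p hp =>
      integral_iteratedDeriv_sinePoly_sq_le hi1 hs c (Finset.mem_range.1 hp)).trans (le_of_eq ?_)
    rw [Finset.card_range, nsmul_eq_mul, hA]
  have hfin : (1 + 1 / ε) * (B * ∫ u in (0 : ℝ)..1, E u) ≤ ε * A := by
    have h1 : (1 + 1 / ε) * B * k / ε ≤ (i₁ : ℝ) ^ 2 := by nlinarith
    rw [div_le_iff₀ hε] at h1
    calc (1 + 1 / ε) * (B * ∫ u in (0 : ℝ)..1, E u)
        ≤ (1 + 1 / ε) * (B * (k * (A / (i₁ : ℝ) ^ 2))) :=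
          mul_le_mul_of_nonneg_left (mul_le_mul_of_nonneg_left hEint hB0) (by positivity)
      _ = ((1 + 1 / ε) * B * k) * A / (i₁ : ℝ) ^ 2 := by ring
      _ ≤ ε * A := by
          rw [div_le_iff₀ (by positivity)]
          nlinarith
  have hEint0 : 0 ≤ ∫ u in (0 : ℝ)..1, E u :=
    intervalIntegral.integral_nonneg zero_le_one fun u _ => Finset.sum_nonneg fun _ _ => sq_nonneg _
  have hfin' : B * ∫ u in (0 : ℝ)..1, E u ≤ ε * A := by
    refine le_trans ?_ hfin
    have : (1 : ℝ) ≤ 1 + 1 / ε := by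
      have : 0 < 1 / ε := by positivity
      linarith
    nlinarith [mul_nonneg hB0 hEint0]
  have hleib : ∀ j u, iteratedDeriv j (fun u => χ u * F u) u = ∑ l ∈ Finset.range (j + 1),
      (j.choose l : ℝ) * iteratedDeriv l χ u * iteratedDeriv (j - l) F u := fun j u =>
    iteratedDeriv_fun_mul (hχ.smooth j).contDiffAt (contDiff_sinePoly s c).contDiffAt
  refine ⟨fun j hj => ?_, ?_⟩
  · refine le_trans ?_ hfin'
    rw [← intervalIntegral.integral_const_mul]
    refine intervalIntegral.integral_mono_on zero_le_one (hI _ ((hPc j).pow 2))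
      (hI _ (hEc.const_mul B)) fun u hu => ?_
    rw [hleib]
    refine leibniz_lower (hK u hu) (by simp; omega) hj.le ?_ ?_ ?_
    · intro l hl; have := Finset.mem_range.1 hl; omega
    · intro l hl; have := Finset.mem_range.1 hl; omega
    · intro l hl l' hl' h
      have h1 := Finset.mem_range.1 (Finset.mem_coe.1 hl)
      have h2 := Finset.mem_range.1 (Finset.mem_coe.1 hl')
      have h3 : j - l = j - l' := h
      omega
  · have hpt : ∀ u ∈ Set.Icc (0 : ℝ) 1, iteratedDeriv k (fun u => χ u * F u) u ^ 2 ≤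
        (1 + ε) * iteratedDeriv k F u ^ 2 + (1 + 1 / ε) * (B * E u) := by
      intro u hu
      have hdec : iteratedDeriv k (fun u => χ u * F u) u = χ u * iteratedDeriv k F u +
          ∑ l ∈ Finset.Ico 1 (k + 1),
            (k.choose l : ℝ) * iteratedDeriv l χ u * iteratedDeriv (k - l) F u := by
        rw [hleib, Finset.range_eq_Ico, Finset.sum_eq_sum_Ico_succ_bot (by omega)]
        simp
      have hrest := leibniz_lower (F := F) (j := k) (s := Finset.Ico 1 (k + 1))
        (τ := fun l => k - l) (hK u hu) (by simp) le_rfl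
        (fun l hl => by have := Finset.mem_Ico.1 hl; omega)
        (fun l hl => by have := Finset.mem_Ico.1 hl; omega)
        (fun l hl l' hl' h => by
          have h1 := Finset.mem_Ico.1 (Finset.mem_coe.1 hl)
          have h2 := Finset.mem_Ico.1 (Finset.mem_coe.1 hl')
          have h3 : k - l = k - l' := h
          omega)
      rw [hdec]
      set x := χ u * iteratedDeriv k F u
      set y := ∑ l ∈ Finset.Ico 1 (k + 1),
            (k.choose l : ℝ) * iteratedDeriv l χ u * iteratedDeriv (k - l) F u
      have hx : x ^ 2 ≤ iteratedDeriv k F u ^ 2 := by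
        simp only [x, mul_pow]
        have := hχ.nonneg u
        have h1 : χ u ^ 2 ≤ 1 := pow_le_one₀ this (hχ.le_one u)
        exact mul_le_of_le_one_left (sq_nonneg _) h1
      have hy : y ^ 2 ≤ B * E u := hrest
      -- Weighted Young inequality: the leading term costs the factor `1 + ε` and the remainder
      -- another `ε A`, whence `1 + 2ε`.
      have hxy : (x + y) ^ 2 ≤ (1 + ε) * x ^ 2 + (1 + 1 / ε) * y ^ 2 := by
        have : (1 + ε) * x ^ 2 + (1 + 1 / ε) * y ^ 2 - (x + y) ^ 2 = (ε * x - y) ^ 2 / ε := by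
          field_simp; ring
        have h2 : 0 ≤ (ε * x - y) ^ 2 / ε := by positivity
        linarith
      have h3 : 0 < 1 / ε := by positivity
      nlinarith
    have hmain : ∫ u in (0 : ℝ)..1, iteratedDeriv k (fun u => χ u * F u) u ^ 2 ≤
        ∫ u in (0 : ℝ)..1, ((1 + ε) * iteratedDeriv k F u ^ 2 + (1 + 1 / ε) * (B * E u)) := by
      refine intervalIntegral.integral_mono_on zero_le_one (hI _ ((hPc k).pow 2)) (hI _ ?_) hpt
      exact ((hFc2 k).const_mul _).add ((hEc.const_mul B).const_mul _)
    rw [intervalIntegral.integral_add (hI _ ((hFc2 k).const_mul _))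
      (hI _ ((hEc.const_mul B).const_mul _)), intervalIntegral.integral_const_mul,
      intervalIntegral.integral_const_mul, intervalIntegral.integral_const_mul,
      integral_iteratedDeriv_sinePoly_sq (fun i hi => hi1.trans (hs i hi))] at hmain
    linarith

/-! ### Periodization -/

lemma periodize_eventuallyEq {f : ℝ → ℝ} {x : ℝ} (hx : Int.fract x ≠ 0) :
    (fun y => f (Int.fract y)) =ᶠ[𝓝 x] fun y => f (y - ⌊x⌋) := by
  have h1 : (⌊x⌋ : ℝ) < x := by
    have := Int.fract_nonneg x
    have h2 := Int.self_sub_floor x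
    rcases this.lt_or_eq with h | h
    · linarith
    · exact absurd h.symm hx
  filter_upwards [Ioo_mem_nhds h1 (Int.lt_floor_add_one x)] with y hy
  have h2 : ⌊y⌋ = ⌊x⌋ := Int.floor_eq_iff.2 ⟨hy.1.le, hy.2⟩
  rw [← Int.self_sub_floor, h2]

/-- Near an integer the periodization vanishes identically, because `f` vanishes near both ends;
elsewhere it is locally a translate of `f`. -/
lemma contDiff_periodize {f : ℝ → ℝ} {k : ℕ} (hf : ContDiff ℝ k f) {δ : ℝ} (hδ : 0 < δ)
    (h0 : ∀ x ≤ δ, f x = 0) (h1 : ∀ x, 1 - δ ≤ x → f x = 0) :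
    ContDiff ℝ k fun y => f (Int.fract y) := by
  rw [contDiff_iff_contDiffAt]
  intro x
  by_cases hx : Int.fract x = 0
  · have hz : (⌊x⌋ : ℝ) = x := by have := Int.self_sub_floor x; linarith
    have he : (fun y => f (Int.fract y)) =ᶠ[𝓝 x] fun _ => 0 := by
      set d := min δ 1 with hd
      have hd0 : 0 < d := lt_min hδ one_pos
      filter_upwards [Ioo_mem_nhds (show x - d < x by linarith) (show x < x + d by linarith)]
        with y hy
      have hd1 : d ≤ δ := min_le_left _ _
      have hd2 : d ≤ 1 := min_le_right _ _
      rcases lt_or_ge y x with h | h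
      · have h2 : ⌊y⌋ = ⌊x⌋ - 1 := by
          rw [Int.floor_eq_iff]
          push_cast
          constructor <;> linarith [hy.1]
        apply h1
        rw [← Int.self_sub_floor, h2]
        push_cast
        linarith [hy.1]
      · have h2 : ⌊y⌋ = ⌊x⌋ := by
          rw [Int.floor_eq_iff]
          constructor <;> linarith [hy.2]
        apply h0
        rw [← Int.self_sub_floor, h2]
        linarith [hy.2]
    exact contDiffAt_const.congr_of_eventuallyEq he
  · refine ContDiffAt.congr_of_eventuallyEq ?_ (periodize_eventuallyEq hx)
    exact (hf.comp (contDiff_id.sub contDiff_const)).contDiffAt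

lemma periodic_periodize (f : ℝ → ℝ) : Function.Periodic (fun y => f (Int.fract y)) 1 := by
  intro x
  simp

lemma periodize_apply {f : ℝ → ℝ} (h01 : f 0 = f 1) {x : ℝ} (hx : x ∈ Set.Icc (0 : ℝ) 1) :
    f (Int.fract x) = f x := by
  rcases hx.2.lt_or_eq with h | h
  · rw [Int.fract_eq_self.2 ⟨hx.1, h⟩]
  · rw [h]; simp [h01]

lemma iteratedDeriv_periodize (f : ℝ → ℝ) (j : ℕ) {x : ℝ} (hx : x ∈ Set.Ioo (0 : ℝ) 1) :
    iteratedDeriv j (fun y => f (Int.fract y)) x = iteratedDeriv j f x := by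
  have he : (fun y => f (Int.fract y)) =ᶠ[𝓝 x] f := by
    filter_upwards [Ioo_mem_nhds hx.1 hx.2] with y hy
    rw [Int.fract_eq_self.2 ⟨hy.1.le, hy.2⟩]
  exact he.iteratedDeriv_eq j

lemma integral_iteratedDeriv_periodize (f : ℝ → ℝ) (j : ℕ) :
    ∫ x in (0 : ℝ)..1, iteratedDeriv j (fun y => f (Int.fract y)) x ^ 2 =
      ∫ x in (0 : ℝ)..1, iteratedDeriv j f x ^ 2 := by
  rw [intervalIntegral.integral_of_le zero_le_one, intervalIntegral.integral_of_le zero_le_one,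
    integral_Ioc_eq_integral_Ioo, integral_Ioc_eq_integral_Ioo]
  refine setIntegral_congr_fun measurableSet_Ioo fun x hx => ?_
  simp only [iteratedDeriv_periodize f j hx]

/-! ### The family of localized functions -/

/-- The indices of the localized basis: the window and the frequency. -/
abbrev Idx (M i₀ N : ℕ) : Type := Fin M × ↥(Finset.Ico i₀ N)

/-- The localized basis functions. -/
def basisFn {χ : ℝ → ℝ} {η : ℝ} (hχ : IsCutoff χ η) (n q M i₀ N : ℕ) (α : Idx M i₀ N) : C(I, ℝ) :=
  bump hχ n q α.1 α.2

/-- The weights `(π i / h)^{2k}`, `h = q / n`. -/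
def weight (k n q M i₀ N : ℕ) (α : Idx M i₀ N) : ℝ := (Real.pi * (α.2 : ℕ) * (n / q)) ^ (2 * k)

/-- The coefficients in the window `m`. -/
def windowCoeff {M i₀ N : ℕ} (θ : Idx M i₀ N → ℝ) (m : Fin M) (i : ℕ) : ℝ :=
  if h : i ∈ Finset.Ico i₀ N then θ (m, ⟨i, h⟩) else 0

lemma sum_windowCoeff {M i₀ N : ℕ} (θ : Idx M i₀ N → ℝ) (m : Fin M) (f : ℕ → ℝ → ℝ) :
    ∑ i ∈ Finset.Ico i₀ N, f i (windowCoeff θ m i) =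
      ∑ i : ↥(Finset.Ico i₀ N), f i (θ (m, i)) := by
  rw [← Finset.sum_coe_sort]
  refine Finset.sum_congr rfl fun i _ => ?_
  unfold windowCoeff
  rw [dif_pos i.2]

/-- The window profile. -/
def profile (χ : ℝ → ℝ) {M i₀ N : ℕ} (θ : Idx M i₀ N → ℝ) (m : Fin M) (u : ℝ) : ℝ :=
  χ u * sinePoly (Finset.Ico i₀ N) (windowCoeff θ m) u

/-- The function `∑ θ_α e_α` on the real line, before periodization. -/
def glue (χ : ℝ → ℝ) (n q : ℕ) {M i₀ N : ℕ} (θ : Idx M i₀ N → ℝ) (x : ℝ) : ℝ :=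
  ∑ m : Fin M, Real.sqrt (n / q) * profile χ θ m (x * n / q - m)

lemma synth_basisFn {χ : ℝ → ℝ} {η : ℝ} (hχ : IsCutoff χ η) (n q M i₀ N : ℕ)
    (θ : Idx M i₀ N → ℝ) (x : I) :
    synth (basisFn hχ n q M i₀ N) θ x = glue χ n q θ x := by
  rw [synth_apply_apply, Fintype.sum_prod_type]
  unfold glue profile sinePoly
  refine Finset.sum_congr rfl fun m _ => ?_
  rw [sum_windowCoeff θ m (fun i c => c * sine i ((x : ℝ) * n / q - m)), Finset.mul_sum,
    Finset.mul_sum]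
  refine Finset.sum_congr rfl fun i _ => ?_
  simp only [basisFn, bump, ContinuousMap.coe_mk]
  ring

lemma wsq_weight (k n q : ℕ) {M i₀ N : ℕ} (θ : Idx M i₀ N → ℝ) :
    wsq (weight k n q M i₀ N) θ = ((n : ℝ) / q) ^ (2 * k) * ∑ m : Fin M,
      ∑ i ∈ Finset.Ico i₀ N, (Real.pi * i) ^ (2 * k) * windowCoeff θ m i ^ 2 := by
  unfold wsq weight
  rw [Fintype.sum_prod_type, Finset.mul_sum]
  refine Finset.sum_congr rfl fun m _ => ?_
  rw [sum_windowCoeff θ m (fun i c => (Real.pi * i) ^ (2 * k) * c ^ 2), Finset.mul_sum]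
  refine Finset.sum_congr rfl fun i _ => ?_
  rw [mul_pow]; ring

lemma sq_sum_of_disjoint {ι : Type*} (s : Finset ι) (G : ι → ℝ)
    (h : ∀ m ∈ s, ∀ m' ∈ s, m ≠ m' → G m * G m' = 0) : (∑ m ∈ s, G m) ^ 2 = ∑ m ∈ s, G m ^ 2 := by
  classical
  rw [sq, Finset.sum_mul_sum]
  refine Finset.sum_congr rfl fun m hm => ?_
  rw [Finset.sum_eq_single m (fun m' hm' hne => h m hm m' hm' hne.symm) (fun h => absurd hm h), sq]

section

variable {χ : ℝ → ℝ} {η : ℝ} {n q M i₀ N : ℕ}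

lemma contDiff_profile (hχ : IsCutoff χ η) (θ : Idx M i₀ N → ℝ) (m : Fin M) (p : ℕ) : ContDiff ℝ p
    (profile χ θ m) :=
  (hχ.smooth p).mul (contDiff_sinePoly _ _)

lemma iteratedDeriv_profile_eq_zero (hχ : IsCutoff χ η) (θ : Idx M i₀ N → ℝ) (m : Fin M) (j : ℕ)
    {u : ℝ}
    (hu : u ∉ Set.Ioc (0 : ℝ) 1) : iteratedDeriv j (profile χ θ m) u = 0 := by
  have h0 := hχ.pos
  have he : profile χ θ m =ᶠ[𝓝 u] fun _ => 0 := by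
    simp only [Set.mem_Ioc, not_and_or, not_lt, not_le] at hu
    rcases hu with h | h
    · filter_upwards [Iio_mem_nhds (show u < η / 2 by linarith)] with y hy
      unfold profile
      rw [hχ.eq_zero y (Or.inl (le_of_lt hy)), zero_mul]
    · filter_upwards [Ioi_mem_nhds (show 1 - η / 2 < u by linarith)] with y hy
      unfold profile
      rw [hχ.eq_zero y (Or.inr (le_of_lt hy)), zero_mul]
  rw [he.iteratedDeriv_eq]
  simp

lemma contDiff_glue (hχ : IsCutoff χ η) (θ : Idx M i₀ N → ℝ) (p : ℕ) : ContDiff ℝ p (glue χ n q θ)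
    := by
  unfold glue
  refine ContDiff.sum fun m _ => contDiff_const.mul ((contDiff_profile hχ θ m p).comp ?_)
  fun_prop

lemma iteratedDeriv_glue (hχ : IsCutoff χ η) (θ : Idx M i₀ N → ℝ) (j : ℕ) (x : ℝ) :
    iteratedDeriv j (glue χ n q θ) x = ∑ m : Fin M, Real.sqrt (n / q) *
      (((n : ℝ) / q) ^ j * iteratedDeriv j (profile χ θ m) (x * n / q - m)) := by
  have hc : ∀ m : Fin M, ContDiff ℝ j fun x : ℝ => profile χ θ m (x * n / q - m) := fun m =>
    (contDiff_profile hχ θ m j).comp (by fun_prop)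
  unfold glue
  rw [iteratedDeriv_fun_sum fun m _ => (contDiff_const.mul (hc m)).contDiffAt]
  refine Finset.sum_congr rfl fun m _ => ?_
  rw [iteratedDeriv_const_mul_field]
  congr 1
  have e : (fun x : ℝ => profile χ θ m (x * n / q - m)) =
      fun x : ℝ => (fun y => profile χ θ m (y - m)) ((n : ℝ) / q * x) := by
    ext y; congr 1; ring
  have hc2 : ContDiff ℝ j fun y : ℝ => profile χ θ m (y - m) :=
    (contDiff_profile hχ θ m j).comp (by fun_prop)
  rw [e, iteratedDeriv_comp_const_mul hc2, iteratedDeriv_comp_sub_const]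
  simp only
  congr 3
  ring

/-- Derivatives from different windows have disjoint supports, so the square of the sum is the sum
of the squares. The chain rule produces `(n/q)^{2j}`, while the squared normalization is absorbed by
the change of variables. -/
lemma integral_iteratedDeriv_glue_sq (hχ : IsCutoff χ η) (hq : 0 < q) (hM : M * q ≤ n)
    (θ : Idx M i₀ N → ℝ) (j : ℕ) :
    ∫ x in (0 : ℝ)..1, iteratedDeriv j (glue χ n q θ) x ^ 2 =
      ((n : ℝ) / q) ^ (2 * j) * ∑ m : Fin M,
        ∫ u in (0 : ℝ)..1, iteratedDeriv j (profile χ θ m) u ^ 2 := by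
  have hq' : (0 : ℝ) < q := by exact_mod_cast hq
  have hdc : ∀ m : Fin M, Continuous (iteratedDeriv j (profile χ θ m)) := fun m =>
    (contDiff_profile hχ θ m j).continuous_iteratedDeriv' j
  have hsq : ∀ x : ℝ, iteratedDeriv j (glue χ n q θ) x ^ 2 = ∑ m : Fin M,
      ((n : ℝ) / q * ((n : ℝ) / q) ^ (2 * j)) *
        iteratedDeriv j (profile χ θ m) (x * n / q - m) ^ 2 := by
    intro x
    rw [iteratedDeriv_glue hχ, sq_sum_of_disjoint]
    · refine Finset.sum_congr rfl fun m _ => ?_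
      rw [mul_pow, Real.sq_sqrt (by positivity), mul_pow, ← pow_mul]
      ring
    · intro m _ m' _ hne
      by_cases h1 : x * n / q - (m : ℕ) ∈ Set.Ioc (0 : ℝ) 1
      · by_cases h2 : x * n / q - (m' : ℕ) ∈ Set.Ioc (0 : ℝ) 1
        · exact (window_disjoint (fun h => hne (Fin.ext h)) h1 h2).elim
        · rw [iteratedDeriv_profile_eq_zero hχ θ m' j h2]; ring
      · rw [iteratedDeriv_profile_eq_zero hχ θ m j h1]; ring
  simp_rw [hsq]
  rw [intervalIntegral.integral_finsetSum fun m _ =>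
    Continuous.intervalIntegrable (by
      exact continuous_const.mul (((hdc m).comp (by fun_prop)).pow 2)) _ _, Finset.mul_sum]
  refine Finset.sum_congr rfl fun m _ => ?_
  rw [intervalIntegral.integral_const_mul]
  have hm : ((m : ℕ) + 1) * q ≤ n := le_trans (Nat.mul_le_mul_right q m.2) hM
  have hn : 0 < n := lt_of_lt_of_le (by positivity) hm
  have hn' : (0 : ℝ) < n := by exact_mod_cast hn
  have h := windowFormula_volume hq (m : ℕ) hm
    (fun u => iteratedDeriv j (profile χ θ m) u ^ 2)
    (fun u hu => by simp [iteratedDeriv_profile_eq_zero hχ θ m j hu])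
  rw [integral_unitInterval
    (fun x => iteratedDeriv j (profile χ θ m) (x * n / q - (m : ℕ)) ^ 2)] at h
  rw [h]
  unfold unitMean
  field_simp

lemma glue_eq_zero_left (hχ : IsCutoff χ η) (θ : Idx M i₀ N → ℝ) (hq : 0 < q) (hn : 0 < n) {x : ℝ}
    (hx : x ≤ η / 2 * (q / n)) : glue χ n q θ x = 0 := by
  have hq' : (0 : ℝ) < q := by exact_mod_cast hq
  have hn' : (0 : ℝ) < n := by exact_mod_cast hn
  refine Finset.sum_eq_zero fun m _ => ?_
  have h1 : x * n / q ≤ η / 2 := by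
    rw [div_le_iff₀ hq']
    calc x * n ≤ η / 2 * (q / n) * n := mul_le_mul_of_nonneg_right hx hn'.le
      _ = η / 2 * q := by field_simp
  unfold profile
  rw [hχ.eq_zero _ (Or.inl (by have : (0 : ℝ) ≤ (m : ℕ) := Nat.cast_nonneg _; linarith))]
  ring

lemma glue_eq_zero_right (hχ : IsCutoff χ η) (θ : Idx M i₀ N → ℝ) (hq : 0 < q) (hn : 0 < n)
    (hM : M * q ≤ n) {x : ℝ}
    (hx : 1 - η / 2 * (q / n) ≤ x) : glue χ n q θ x = 0 := by
  have hq' : (0 : ℝ) < q := by exact_mod_cast hq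
  have hn' : (0 : ℝ) < n := by exact_mod_cast hn
  have hM' : (M : ℝ) * q ≤ n := by exact_mod_cast hM
  refine Finset.sum_eq_zero fun m _ => ?_
  have h1 : M - η / 2 ≤ x * n / q := by
    rw [le_div_iff₀ hq']
    calc (M - η / 2) * q ≤ n - η / 2 * q := by linarith
      _ = (1 - η / 2 * (q / n)) * n := by field_simp
      _ ≤ x * n := mul_le_mul_of_nonneg_right hx hn'.le
  have h2 : ((m : ℕ) : ℝ) + 1 ≤ M := by exact_mod_cast m.2
  unfold profile
  rw [hχ.eq_zero _ (Or.inr (by linarith))]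
  ring

end

/-- For large frequencies, the ellipsoid `∑ a_α θ_α² ≤ r / (1 + ε)` gives functions of
the class `W^k_r`. -/
theorem exists_mem_sobolevClass {χ : ℝ → ℝ} {η : ℝ} (hχ : IsCutoff χ η) (k : ℕ) {ε : ℝ}
    (hε : 0 < ε) : ∃ i₁ : ℕ, 1 ≤ i₁ ∧ ∀ (i₀ : ℕ), i₁ ≤ i₀ → ∀ (n q M N : ℕ) (r : ℝ), 0 < q →
      0 < M → M * q ≤ n → ∀ θ : Idx M i₀ N → ℝ, (1 + ε) * wsq (weight k n q M i₀ N) θ ≤ r →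
      ∃ S : sobolevClass k r, restrict S = synth (basisFn hχ n q M i₀ N) θ := by
  -- The `k` lower orders cost `ε'` each and the top order costs `2 ε'`. Since `n / q ≥ 1`, the
  -- lower powers of the scale are dominated by the top one.
  set ε' := ε / (k + 2) with hε'
  have hε'0 : 0 < ε' := by positivity
  obtain ⟨i₁, hi₁, h⟩ := exists_cutoff_sobolev hχ k hε'0
  refine ⟨i₁, hi₁, fun i₀ hi₀ n q M N r hq hM0 hM θ hθ => ?_⟩
  have hn : 0 < n := lt_of_lt_of_le (by positivity) hM
  have hq' : (0 : ℝ) < q := by exact_mod_cast hq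
  have hn' : (0 : ℝ) < n := by exact_mod_cast hn
  have hqn : q ≤ n := le_trans (Nat.le_mul_of_pos_left q hM0) hM
  have hδ : 0 < η / 2 * ((q : ℝ) / n) := by have := hχ.pos; positivity
  have hz0 : ∀ x ≤ η / 2 * ((q : ℝ) / n), glue χ n q θ x = 0 := fun x hx =>
    glue_eq_zero_left hχ θ hq hn hx
  have hz1 : ∀ x, 1 - η / 2 * ((q : ℝ) / n) ≤ x → glue χ n q θ x = 0 := fun x hx =>
    glue_eq_zero_right hχ θ hq hn hM hx
  have hratio : (1 : ℝ) ≤ (n : ℝ) / q := by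
    rw [le_div_iff₀ hq', one_mul]; exact_mod_cast hqn
  set A : Fin M → ℝ := fun m =>
    ∑ i ∈ Finset.Ico i₀ N, (Real.pi * i) ^ (2 * k) * windowCoeff θ m i ^ 2 with hA
  have hA0 : ∀ m, 0 ≤ A m := fun m => Finset.sum_nonneg fun i _ =>
    mul_nonneg (by rw [pow_mul]; positivity) (sq_nonneg _)
  have hw := wsq_weight k n q θ
  refine ⟨⟨fun y => glue χ n q θ (Int.fract y), ?_, periodic_periodize _, ?_⟩, ?_⟩
  · exact contDiff_periodize (contDiff_glue hχ θ k) hδ hz0 hz1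
  · simp_rw [integral_iteratedDeriv_periodize, integral_iteratedDeriv_glue_sq hχ hq hM]
    rw [Finset.sum_range_succ]
    have hs : ∀ i ∈ Finset.Ico i₀ N, i₁ ≤ i := fun i hi => hi₀.trans (Finset.mem_Ico.1 hi).1
    have hlow : ∀ j ∈ Finset.range k, ((n : ℝ) / q) ^ (2 * j) * ∑ m : Fin M,
        ∫ u in (0 : ℝ)..1, iteratedDeriv j (profile χ θ m) u ^ 2 ≤
        ε' * wsq (weight k n q M i₀ N) θ := by
      intro j hj
      have hjk := Finset.mem_range.1 hj
      rw [hw]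
      calc _ ≤ ((n : ℝ) / q) ^ (2 * k) * ∑ m : Fin M, ε' * A m := by
            refine mul_le_mul (pow_le_pow_right₀ hratio (by omega))
              (Finset.sum_le_sum fun m _ => (h _ (windowCoeff θ m) hs).1 j hjk)
              (Finset.sum_nonneg fun m _ => intervalIntegral.integral_nonneg zero_le_one
                fun _ _ => sq_nonneg _) (by positivity)
        _ = _ := by rw [← Finset.mul_sum]; ring
    have htop : ((n : ℝ) / q) ^ (2 * k) * ∑ m : Fin M,
        ∫ u in (0 : ℝ)..1, iteratedDeriv k (profile χ θ m) u ^ 2 ≤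
        (1 + 2 * ε') * wsq (weight k n q M i₀ N) θ := by
      rw [hw]
      calc _ ≤ ((n : ℝ) / q) ^ (2 * k) * ∑ m : Fin M, (1 + 2 * ε') * A m := by
            refine mul_le_mul_of_nonneg_left
              (Finset.sum_le_sum fun m _ => (h _ (windowCoeff θ m) hs).2) (by positivity)
        _ = _ := by rw [← Finset.mul_sum]; ring
    have hsum := add_le_add (Finset.sum_le_sum hlow) htop
    refine hsum.trans (le_trans (le_of_eq ?_) hθ)
    rw [Finset.sum_const, Finset.card_range, nsmul_eq_mul]
    have : ε' * (k + 2) = ε := by rw [hε']; field_simp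
    linear_combination (wsq (weight k n q M i₀ N) θ) * this
  · ext x
    rw [synth_basisFn]
    refine periodize_apply (f := glue χ n q θ) ?_ x.2
    rw [hz0 0 hδ.le, hz1 1 (by linarith)]

/-- The functions of the family are uniformly small for large frequencies. -/
lemma norm_synth_sq_le {χ : ℝ → ℝ} {η : ℝ} (hχ : IsCutoff χ η) {k n q M i₀ N : ℕ} (hk : 1 ≤ k)
    (hi₀ : 1 ≤ i₀) (hq : 0 < q) (hqn : q ≤ n) (θ : Idx M i₀ N → ℝ) :
    ‖synth (basisFn hχ n q M i₀ N) θ‖ ^ 2 ≤ 4 / i₀ * wsq (weight k n q M i₀ N) θ := by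
  have hn : 0 < n := lt_of_lt_of_le hq hqn
  have hq' : (0 : ℝ) < q := by exact_mod_cast hq
  have hn' : (0 : ℝ) < n := by exact_mod_cast hn
  have hratio : (1 : ℝ) ≤ (n : ℝ) / q := by
    rw [le_div_iff₀ hq', one_mul]; exact_mod_cast hqn
  have hi0 : (0 : ℝ) < i₀ := by exact_mod_cast hi₀
  have hW0 : 0 ≤ wsq (weight k n q M i₀ N) θ := Finset.sum_nonneg fun α _ =>
    mul_nonneg (by unfold weight; rw [pow_mul]; positivity) (sq_nonneg _)
  have hpt : ∀ x : I, synth (basisFn hχ n q M i₀ N) θ x ^ 2 ≤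
      4 / i₀ * wsq (weight k n q M i₀ N) θ := by
    intro x
    rw [synth_apply_apply, Fintype.sum_prod_type, sq_sum_of_disjoint]
    · unfold wsq
      rw [Fintype.sum_prod_type, Finset.mul_sum]
      refine Finset.sum_le_sum fun m _ => ?_
      have hpos : ∀ i : ↥(Finset.Ico i₀ N), 0 < weight k n q M i₀ N (m, i) := by
        intro i
        have : (0 : ℝ) < (i : ℕ) := by
          have := (Finset.mem_Ico.1 i.2).1
          exact_mod_cast (by omega : 0 < (i : ℕ))
        unfold weight
        have := Real.pi_pos
        positivity
      -- Cauchy–Schwarz weighted by the ellipsoid. It is applied window by window, since at most one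
      -- window contributes at a given point.
      have hcs := Finset.sum_mul_sq_le_sq_mul_sq Finset.univ
        (fun i => Real.sqrt (weight k n q M i₀ N (m, i)) * θ (m, i))
        (fun i => basisFn hχ n q M i₀ N (m, i) x / Real.sqrt (weight k n q M i₀ N (m, i)))
      have e1 : ∀ i, Real.sqrt (weight k n q M i₀ N (m, i)) * θ (m, i) *
          (basisFn hχ n q M i₀ N (m, i) x / Real.sqrt (weight k n q M i₀ N (m, i))) =
          θ (m, i) * basisFn hχ n q M i₀ N (m, i) x := by
        intro i
        have := (Real.sqrt_pos.2 (hpos i)).ne'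
        field_simp
      have e2 : ∀ i, (Real.sqrt (weight k n q M i₀ N (m, i)) * θ (m, i)) ^ 2 =
          weight k n q M i₀ N (m, i) * θ (m, i) ^ 2 := fun i => by
        rw [mul_pow, Real.sq_sqrt (hpos i).le]
      -- As `k ≥ 1` and `n / q ≥ 1`, the weight outgrows both the height of the basis function and
      -- `i²`. The tail of `∑ i⁻²` from `i₀` then yields the factor `4 / i₀`, uniformly in `n` and
      -- `N`.
      have e3 : ∀ i, (basisFn hχ n q M i₀ N (m, i) x /
          Real.sqrt (weight k n q M i₀ N (m, i))) ^ 2 ≤ 2 * (((i : ℕ) : ℝ) ^ 2)⁻¹ := by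
        intro i
        have hi1 : (1 : ℝ) ≤ (i : ℕ) := by
          have := (Finset.mem_Ico.1 i.2).1
          exact_mod_cast (by omega : 1 ≤ (i : ℕ))
        rw [div_pow, Real.sq_sqrt (hpos i).le, div_le_iff₀ (hpos i)]
        have h1 : basisFn hχ n q M i₀ N (m, i) x ^ 2 ≤ 2 * (n / q) := by
          have h2 := (abs_bump_le_abs_phi hχ n q m i x).trans (abs_phi_le n q m i x)
          rw [← sq_abs]
          refine (pow_le_pow_left₀ (abs_nonneg _) h2 2).trans (le_of_eq ?_)
          rw [mul_pow, Real.sq_sqrt (by positivity), Real.sq_sqrt (by norm_num)]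
          ring
        refine h1.trans ?_
        unfold weight
        have h3 : (1 : ℝ) ≤ Real.pi * (i : ℕ) * (n / q) :=
          one_le_mul_of_one_le_of_one_le
            (one_le_mul_of_one_le_of_one_le (by linarith [Real.pi_gt_three]) hi1) hratio
        have h4 : ((i : ℕ) : ℝ) * (n / q) ≤ Real.pi * (i : ℕ) * (n / q) := by
          have : (0 : ℝ) ≤ (i : ℕ) * (n / q) := by positivity
          nlinarith [Real.pi_gt_three]
        have h5 : (((i : ℕ) : ℝ) * (n / q)) ^ 2 ≤ (Real.pi * (i : ℕ) * (n / q)) ^ (2 * k) :=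
          (pow_le_pow_left₀ (by positivity) h4 2).trans (pow_le_pow_right₀ h3 (by omega))
        calc 2 * ((n : ℝ) / q) ≤ 2 * ((n / q) ^ 2) := by nlinarith
          _ = 2 * (((i : ℕ) : ℝ) ^ 2)⁻¹ * (((i : ℕ) : ℝ) * (n / q)) ^ 2 := by field_simp
          _ ≤ _ := mul_le_mul_of_nonneg_left h5 (by positivity)
      simp_rw [e1, e2] at hcs
      refine hcs.trans ?_
      rw [mul_comm]
      refine mul_le_mul_of_nonneg_right ((Finset.sum_le_sum fun i _ => e3 i).trans ?_)
        (Finset.sum_nonneg fun i _ => mul_nonneg (hpos i).le (sq_nonneg _))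
      rw [← Finset.mul_sum, Finset.sum_coe_sort (Finset.Ico i₀ N) (fun i => ((i : ℝ) ^ 2)⁻¹)]
      have h6 : Finset.Ico i₀ N = Finset.Ioo (i₀ - 1) N := by
        ext i; simp only [Finset.mem_Ico, Finset.mem_Ioo]; omega
      have h7 := sum_Ioo_inv_sq_le (α := ℝ) (i₀ - 1) N
      rw [Nat.cast_sub hi₀] at h7
      rw [h6]
      push_cast at h7
      have h8 : (i₀ : ℝ) - 1 + 1 = i₀ := by ring
      rw [h8] at h7
      calc 2 * ∑ i ∈ Finset.Ioo (i₀ - 1) N, ((i : ℝ) ^ 2)⁻¹ ≤ 2 * (2 / i₀) := by linarith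
        _ = 4 / i₀ := by ring
    · intro m _ m' _ hne
      rw [Finset.sum_mul_sum]
      refine Finset.sum_eq_zero fun i _ => Finset.sum_eq_zero fun i' _ => ?_
      have h1 := phi_mul_phi_of_ne (n := n) (q := q) (fun h => hne (Fin.ext h)) i i' x
      simp only [basisFn]
      rw [bump_eq, bump_eq]
      linear_combination (θ (m, i) * θ (m', i') * χ ((x : ℝ) * n / q - (m : ℕ)) *
        χ ((x : ℝ) * n / q - (m' : ℕ))) * h1
  have h1 : ‖synth (basisFn hχ n q M i₀ N) θ‖ ≤
      Real.sqrt (4 / i₀ * wsq (weight k n q M i₀ N) θ) := by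
    rw [ContinuousMap.norm_le _ (Real.sqrt_nonneg _)]
    intro x
    rw [Real.norm_eq_abs, ← Real.sqrt_sq_eq_abs]
    exact Real.sqrt_le_sqrt (hpt x)
  calc _ ≤ Real.sqrt (4 / i₀ * wsq (weight k n q M i₀ N) θ) ^ 2 :=
        pow_le_pow_left₀ (norm_nonneg _) h1 2
    _ = _ := Real.sq_sqrt (by positivity)

/-! ### The Fisher information -/

lemma l2norm_le_norm (S : C(I, ℝ)) : l2norm S ≤ ‖S‖ := by
  unfold l2norm
  rw [Real.sqrt_le_iff]
  refine ⟨norm_nonneg _, ?_⟩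
  calc ∫ x, S x ^ 2 ≤ ∫ _ : I, ‖S‖ ^ 2 := by
        refine integral_mono_of_nonneg (ae_of_all _ fun _ => sq_nonneg _) (integrable_const _)
          (ae_of_all _ fun x => ?_)
        have := S.norm_coe_le_norm x
        simp only
        rw [← sq_abs]
        exact pow_le_pow_left₀ (abs_nonneg _) this 2
    _ = ‖S‖ ^ 2 := by simp

/-- The Fisher information of the normal model with respect to one coefficient: the contribution
of the variance is negligible for short windows. -/
lemma info_bound {g : I → C(I, ℝ) → ℝ} {C : ℝ} (hC : 0 < C)
    (h3 : ∀ (x : I) (S f : C(I, ℝ)),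
      |fderiv ℝ (fun u : C(I, ℝ) => (g x u) ^ 2) S f| ≤
        C * (|S x * f x| + l1norm f + l2norm S * l2norm f))
    {χ : ℝ → ℝ} {η : ℝ} (hχ : IsCutoff χ η) {n q m i : ℕ}
    (hm : (m + 1) * q ≤ n) (hi : 1 ≤ i) (hiq : i < q) {S : C(I, ℝ)} {δ c₀ sg ε : ℝ} (hε : 0 ≤ ε)
    (hsg : 0 < sg) (hc₀ : 0 < c₀) (hS : ‖S‖ ≤ δ) (hlow : ∀ x, c₀ / 2 ≤ g x S ^ 2)
    (hwin : ∀ x : I, (x : ℝ) * n / q - m ∈ Set.Ioc (0 : ℝ) 1 → sg ≤ (1 + ε) * g x S ^ 2)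
    (hsmall : 12 * C ^ 2 / c₀ ^ 2 * (δ ^ 2 + q / n) ≤ ε / sg) :
    ∑ j : Fin n, ((bump hχ n q m i (design n j)) ^ 2 / (g (design n j) S) ^ 2 +
      (fderiv ℝ (fun u : C(I, ℝ) => (g (design n j) u) ^ 2) S (bump hχ n q m i)) ^ 2 /
        (2 * ((g (design n j) S) ^ 2) ^ 2)) ≤ (1 + 2 * ε) * n / sg := by
  have hq : 0 < q := by omega
  have hn : 0 < n := lt_of_lt_of_le (by positivity) hm
  have hq' : (0 : ℝ) < q := by exact_mod_cast hq
  have hn' : (0 : ℝ) < n := by exact_mod_cast hn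
  have hδ0 : 0 ≤ δ := (norm_nonneg _).trans hS
  set e := bump hχ n q m i with he
  have hsum := sum_bump_sq_le hχ hm hi hiq
  -- The comparison of the variance with `sg` is only available inside the window, and the basis
  -- function vanishes elsewhere.
  have h1 : ∀ j : Fin n, e (design n j) ^ 2 / g (design n j) S ^ 2 ≤
      (1 + ε) / sg * e (design n j) ^ 2 := by
    intro j
    by_cases hx : ((design n j : I) : ℝ) * n / q - m ∈ Set.Ioc (0 : ℝ) 1
    · have hv : 0 < g (design n j) S ^ 2 := lt_of_lt_of_le (by positivity) (hlow _)
      rw [div_le_iff₀ hv, div_mul_eq_mul_div, div_mul_eq_mul_div, le_div_iff₀ hsg]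
      nlinarith [hwin _ hx, sq_nonneg (e (design n j))]
    · have : e (design n j) = 0 := by
        simp only [he, bump, ContinuousMap.coe_mk]
        rw [hχ.eq_zero_of_notMem hx]; ring
      rw [this]; simp
  -- The factor 6 comes from `(x+y+z)² ≤ 3 (x²+y²+z²)` and from the lower bound `c₀²/2` of the
  -- denominator.
  have h2 : ∀ j : Fin n, (fderiv ℝ (fun u : C(I, ℝ) => (g (design n j) u) ^ 2) S e) ^ 2 /
      (2 * ((g (design n j) S) ^ 2) ^ 2) ≤
      6 * C ^ 2 / c₀ ^ 2 * (δ ^ 2 * e (design n j) ^ 2 + 2 * (q / n) + δ ^ 2) := by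
    intro j
    set x := design n j
    have hv := hlow x
    have hL := h3 x S e
    have a1 : |S x * e x| ≤ δ * |e x| := by
      rw [abs_mul]
      exact mul_le_mul_of_nonneg_right ((S.norm_coe_le_norm x).trans hS) (abs_nonneg _)
    have a2 := l1norm_bump_le hχ (i := i) hq hm
    have a3 : l2norm S * l2norm e ≤ δ := by
      have := l2norm_bump_le hχ hm hi hiq
      calc l2norm S * l2norm e ≤ δ * 1 :=
            mul_le_mul ((l2norm_le_norm S).trans hS) this (Real.sqrt_nonneg _) hδ0
        _ = δ := mul_one δ
    set b := Real.sqrt (2 * q / n) with hb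
    have hb2 : b ^ 2 = 2 * (q / n) := by rw [hb, Real.sq_sqrt (by positivity)]; ring
    have hL2 : |fderiv ℝ (fun u : C(I, ℝ) => (g x u) ^ 2) S e| ≤ C * (δ * |e x| + b + δ) :=
      hL.trans (mul_le_mul_of_nonneg_left (by linarith) hC.le)
    have hL3 : (fderiv ℝ (fun u : C(I, ℝ) => (g x u) ^ 2) S e) ^ 2 ≤
        3 * C ^ 2 * (δ ^ 2 * e x ^ 2 + 2 * (q / n) + δ ^ 2) := by
      rw [← sq_abs]
      refine (pow_le_pow_left₀ (abs_nonneg _) hL2 2).trans ?_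
      rw [mul_pow, ← hb2, ← sq_abs (e x)]
      have : (δ * |e x| + b + δ) ^ 2 ≤ 3 * (δ ^ 2 * |e x| ^ 2 + b ^ 2 + δ ^ 2) := by
        nlinarith [sq_nonneg (δ * |e x| - b), sq_nonneg (δ * |e x| - δ), sq_nonneg (b - δ)]
      nlinarith [sq_nonneg C]
    have hden : c₀ ^ 2 / 2 ≤ 2 * ((g x S) ^ 2) ^ 2 := by
      have := pow_le_pow_left₀ (by positivity) hv 2
      nlinarith
    calc _ ≤ (3 * C ^ 2 * (δ ^ 2 * e x ^ 2 + 2 * (q / n) + δ ^ 2)) / (c₀ ^ 2 / 2) :=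
          div_le_div₀ (by positivity) hL3 (by positivity) hden
      _ = _ := by field_simp; ring
  calc _ ≤ ∑ j : Fin n, ((1 + ε) / sg * e (design n j) ^ 2 +
        6 * C ^ 2 / c₀ ^ 2 * (δ ^ 2 * e (design n j) ^ 2 + 2 * (q / n) + δ ^ 2)) :=
        Finset.sum_le_sum fun j _ => add_le_add (h1 j) (h2 j)
    _ = ((1 + ε) / sg + 6 * C ^ 2 / c₀ ^ 2 * δ ^ 2) * ∑ j : Fin n, e (design n j) ^ 2 +
        6 * C ^ 2 / c₀ ^ 2 * (2 * (q / n) + δ ^ 2) * n := by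
        have hsp : ∀ j : Fin n, ((1 + ε) / sg * e (design n j) ^ 2 +
          6 * C ^ 2 / c₀ ^ 2 * (δ ^ 2 * e (design n j) ^ 2 + 2 * (q / n) + δ ^ 2)) =
          ((1 + ε) / sg + 6 * C ^ 2 / c₀ ^ 2 * δ ^ 2) * e (design n j) ^ 2 +
            6 * C ^ 2 / c₀ ^ 2 * (2 * (q / n) + δ ^ 2) := fun j => by ring
        simp_rw [hsp]
        rw [Finset.sum_add_distrib, ← Finset.mul_sum]
        simp [mul_comm]
    _ ≤ ((1 + ε) / sg + 6 * C ^ 2 / c₀ ^ 2 * δ ^ 2) * n +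
        6 * C ^ 2 / c₀ ^ 2 * (2 * (q / n) + δ ^ 2) * n := by
        refine add_le_add (mul_le_mul_of_nonneg_left hsum (by positivity)) le_rfl
    -- The pointwise term and the `L²` term each give `6 δ²`, and the squared `L¹` norm gives `12 q
    -- / n`.
    _ = ((1 + ε) / sg + 12 * C ^ 2 / c₀ ^ 2 * (δ ^ 2 + q / n)) * n := by ring
    _ ≤ ((1 + ε) / sg + ε / sg) * n := by
        refine mul_le_mul_of_nonneg_right (by linarith) hn'.le
    _ = _ := by ring

/-! ### Power sums -/

/-- Bernoulli's inequality gives `(N+1)^{k+1} - N^{k+1} ≥ (k+1) N^k`, which is the induction step;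
the companion lower bound uses the same inequality with a negative increment. -/
lemma sum_pow_le (k N : ℕ) :
    ∑ i ∈ Finset.range N, (i : ℝ) ^ k ≤ (N : ℝ) ^ (k + 1) / (k + 1) := by
  induction N with
  | zero => simp
  | succ N ih =>
    rw [Finset.sum_range_succ]
    have hk : (0 : ℝ) < k + 1 := by positivity
    rcases Nat.eq_zero_or_pos N with rfl | hN
    · rcases Nat.eq_zero_or_pos k with rfl | hk
      · simp
      · simp [hk.ne']; positivity
    have hN' : (0 : ℝ) < N := by exact_mod_cast hN
    have hb := one_add_mul_le_pow (a := 1 / (N : ℝ)) (by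
      have : 0 < 1 / (N : ℝ) := by positivity
      linarith) (k + 1)
    have h2 : ((N : ℝ) + 1) ^ (k + 1) = N ^ (k + 1) * (1 + 1 / N) ^ (k + 1) := by
      rw [← mul_pow]; congr 1; field_simp
    have h3 : (N : ℝ) ^ (k + 1) * (1 + ((k + 1 : ℕ) : ℝ) * (1 / N)) =
        N ^ (k + 1) + (k + 1) * N ^ k := by
      push_cast; field_simp; ring
    have h4 : (N : ℝ) ^ (k + 1) + (k + 1) * N ^ k ≤ ((N : ℝ) + 1) ^ (k + 1) := by
      rw [h2, ← h3]
      exact mul_le_mul_of_nonneg_left hb (by positivity)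
    push_cast
    rw [le_div_iff₀ hk] at ih ⊢
    linarith

lemma le_sum_pow (k N : ℕ) :
    (N : ℝ) ^ (k + 1) / (k + 1) ≤ ∑ i ∈ Finset.range (N + 1), (i : ℝ) ^ k := by
  induction N with
  | zero => simp
  | succ N ih =>
    rw [Finset.sum_range_succ]
    have hk : (0 : ℝ) < k + 1 := by positivity
    have hN' : (0 : ℝ) < (N : ℝ) + 1 := by positivity
    have hb := one_add_mul_le_pow (a := -(1 / ((N : ℝ) + 1))) (by
      have : 1 / ((N : ℝ) + 1) ≤ 1 := by
        rw [div_le_one hN']; linarith [Nat.cast_nonneg (α := ℝ) N]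
      linarith) (k + 1)
    have h2 : (N : ℝ) ^ (k + 1) = ((N : ℝ) + 1) ^ (k + 1) * (1 + -(1 / ((N : ℝ) + 1))) ^ (k + 1)
        := by
      rw [← mul_pow]; congr 1; field_simp; ring
    have h3 : ((N : ℝ) + 1) ^ (k + 1) * (1 + ((k + 1 : ℕ) : ℝ) * -(1 / ((N : ℝ) + 1))) =
        ((N : ℝ) + 1) ^ (k + 1) - (k + 1) * ((N : ℝ) + 1) ^ k := by
      push_cast; field_simp; ring
    have h4 : ((N : ℝ) + 1) ^ (k + 1) - (k + 1) * ((N : ℝ) + 1) ^ k ≤ (N : ℝ) ^ (k + 1) := by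
      rw [h2, ← h3]
      exact mul_le_mul_of_nonneg_left hb (by positivity)
    push_cast
    rw [div_le_iff₀ hk] at ih ⊢
    linarith

/-- The summand is `N^k i^k - i^{2k}`, and `1/(k+1) - 1/(2k+1) = k/((k+1)(2k+1))`. The correction
`1/N` accounts for the last term `i = N` of the lower bound for `∑ i^{2k}`. -/
lemma sum_energy_le (k : ℕ) {i₀ N : ℕ} (hi₀ : 1 ≤ i₀) (hN : 1 ≤ N) :
    ∑ i ∈ Finset.Ico i₀ N, (i : ℝ) ^ (2 * k) * (((N : ℝ) / i) ^ k - 1) ≤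
      (N : ℝ) ^ (2 * k + 1) * (k / ((k + 1) * (2 * k + 1)) + 1 / N) := by
  have hN' : (0 : ℝ) < N := by exact_mod_cast hN
  have h1 : ∀ i ∈ Finset.Ico i₀ N, (i : ℝ) ^ (2 * k) * (((N : ℝ) / i) ^ k - 1) =
      (N : ℝ) ^ k * (i : ℝ) ^ k - (i : ℝ) ^ (2 * k) := by
    intro i hi
    have : (i : ℝ) ≠ 0 := by
      have := (Finset.mem_Ico.1 hi).1
      exact_mod_cast (by omega : i ≠ 0)
    rw [div_pow, two_mul, pow_add]
    field_simp
  rw [Finset.sum_congr rfl h1]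
  have h2 : ∑ i ∈ Finset.Ico i₀ N, ((N : ℝ) ^ k * (i : ℝ) ^ k - (i : ℝ) ^ (2 * k)) ≤
      ∑ i ∈ Finset.range N, ((N : ℝ) ^ k * (i : ℝ) ^ k - (i : ℝ) ^ (2 * k)) := by
    refine Finset.sum_le_sum_of_subset_of_nonneg (fun i hi => ?_) fun i hi _ => ?_
    · simp only [Finset.mem_Ico, Finset.mem_range] at hi ⊢; exact hi.2
    · have : (i : ℝ) ≤ N := by exact_mod_cast (Finset.mem_range.1 hi).le
      have h3 := pow_le_pow_left₀ (Nat.cast_nonneg i) this k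
      rw [two_mul, pow_add]
      have : (0 : ℝ) ≤ (i : ℝ) ^ k := by positivity
      nlinarith
  refine h2.trans ?_
  rw [Finset.sum_sub_distrib, ← Finset.mul_sum]
  have h3 := sum_pow_le k N
  have h4 := le_sum_pow (2 * k) N
  rw [Finset.sum_range_succ] at h4
  push_cast at h4
  have h5 := mul_le_mul_of_nonneg_left h3 (show (0 : ℝ) ≤ (N : ℝ) ^ k by positivity)
  have h6 : (N : ℝ) ^ (2 * k + 1) * (k / ((k + 1) * (2 * k + 1)) + 1 / N) =
      (N : ℝ) ^ k * ((N : ℝ) ^ (k + 1) / (k + 1)) - (N : ℝ) ^ (2 * k + 1) / (2 * k + 1) +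
        (N : ℝ) ^ (2 * k) := by
    have e1 : (N : ℝ) ^ k * (N : ℝ) ^ (k + 1) = (N : ℝ) ^ (2 * k + 1) := by
      rw [← pow_add]; congr 1; ring
    have e2 : (N : ℝ) ^ (2 * k) = (N : ℝ) ^ (2 * k + 1) / N := by
      rw [pow_succ]; field_simp
    rw [← mul_div_assoc, e1, e2]
    field_simp
    ring
  rw [h6]
  linarith

lemma le_sum_risk (k : ℕ) {i₀ N : ℕ} (hN : 1 ≤ N) (hiN : i₀ ≤ N) :
    (N : ℝ) * (k / (k + 1)) - i₀ ≤ ∑ i ∈ Finset.Ico i₀ N, (1 - ((i : ℝ) / N) ^ k) := by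
  have hN' : (0 : ℝ) < N := by exact_mod_cast hN
  have h1 : ∑ i ∈ Finset.Ico i₀ N, ((i : ℝ) / N) ^ k ≤ N / (k + 1) := by
    calc ∑ i ∈ Finset.Ico i₀ N, ((i : ℝ) / N) ^ k ≤ ∑ i ∈ Finset.range N, ((i : ℝ) / N) ^ k := by
          refine Finset.sum_le_sum_of_subset_of_nonneg (fun i hi => ?_) fun i _ _ => by positivity
          simp only [Finset.mem_Ico, Finset.mem_range] at hi ⊢; exact hi.2
      _ = (∑ i ∈ Finset.range N, (i : ℝ) ^ k) / N ^ k := by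
          rw [Finset.sum_div]; exact Finset.sum_congr rfl fun i _ => div_pow _ _ _
      _ ≤ ((N : ℝ) ^ (k + 1) / (k + 1)) / N ^ k :=
          div_le_div_of_nonneg_right (sum_pow_le k N) (by positivity)
      _ = N / (k + 1) := by rw [pow_succ]; field_simp
  rw [Finset.sum_sub_distrib, Finset.sum_const, Nat.card_Ico, nsmul_eq_mul, Nat.cast_sub hiN]
  have h2 : (N : ℝ) * (k / (k + 1)) = N - N / (k + 1) := by field_simp; ring
  rw [h2]
  linarith

/-! ### The Pinsker constant -/

/-- The hypothesis says that the frequency constant `b` exhausts the energy budget `r`; the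
right-hand side is the resulting normalized risk. Raising both sides to the power `2k+1` removes the
real exponents. -/
lemma pinsker_eq {k : ℕ} (hk : 1 ≤ k) {r s b : ℝ} (hr : 0 < r) (hs : 0 < s) (hb : 0 < b)
    (hbk : s * Real.pi ^ (2 * k) * (k / ((k + 1) * (2 * k + 1))) * b ^ (2 * k + 1) = r) :
    gammaStar k * r ^ (1 / (2 * k + 1) : ℝ) * s ^ (2 * k / (2 * k + 1) : ℝ) =
      s * b * (k / (k + 1)) := by
  have hk' : (0 : ℝ) < k := by exact_mod_cast hk
  have hpi := Real.pi_pos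
  have hL : 0 ≤ gammaStar k * r ^ (1 / (2 * k + 1) : ℝ) * s ^ (2 * k / (2 * k + 1) : ℝ) := by
    unfold gammaStar; positivity
  have hR : 0 ≤ s * b * (k / (k + 1)) := by positivity
  have hroot : ∀ {x : ℝ}, 0 ≤ x → (x ^ (1 / (2 * k + 1) : ℝ)) ^ (2 * k + 1) = x := by
    intro x hx
    rw [← Real.rpow_natCast, ← Real.rpow_mul hx]
    have : (1 / (2 * k + 1) : ℝ) * ((2 * k + 1 : ℕ) : ℝ) = 1 := by push_cast; field_simp
    rw [this, Real.rpow_one]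
  have hroot2 : ∀ {x : ℝ}, 0 ≤ x → (x ^ (2 * k / (2 * k + 1) : ℝ)) ^ (2 * k + 1) = x ^ (2 * k) := by
    intro x hx
    rw [← Real.rpow_natCast, ← Real.rpow_mul hx]
    have : (2 * k / (2 * k + 1) : ℝ) * ((2 * k + 1 : ℕ) : ℝ) = ((2 * k : ℕ) : ℝ) := by
      push_cast; field_simp
    rw [this, Real.rpow_natCast]
  refine (pow_left_inj₀ hL hR (by omega : 2 * k + 1 ≠ 0)).1 ?_
  unfold gammaStar
  rw [mul_pow, mul_pow, mul_pow, hroot hr.le, hroot2 hs.le, hroot (by positivity),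
    hroot2 (by positivity), ← hbk, mul_pow, mul_pow, div_pow, mul_pow, div_pow, pow_succ s,
    pow_succ (k : ℝ), pow_succ ((k : ℝ) + 1)]
  field_simp

/-! ### Riemann sums -/

/-- The squared scale at the zero function, extended to the real line. -/
def scaleSq (g : I → C(I, ℝ) → ℝ) (x : ℝ) : ℝ := (g (Set.projIcc 0 1 zero_le_one x) 0) ^ 2

lemma scaleSq_coe (g : I → C(I, ℝ) → ℝ) (x : I) : scaleSq g x = (g x 0) ^ 2 := by
  simp [scaleSq]

lemma varsigma_zero (g : I → C(I, ℝ) → ℝ) : varsigma g 0 = ∫ x in (0 : ℝ)..1, scaleSq g x := by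
  rw [← integral_unitInterval]
  simp [varsigma, scaleSq_coe]

/-- Each of the `M` cells costs at most `ε h`, and the part of `[0,1]` not covered by the windows
costs at most `C₀` times its length. -/
lemma riemann_sum {G : ℝ → ℝ} (hG : Continuous G) {C₀ ε h : ℝ} {M : ℕ} (hh : 0 ≤ h)
    (hMh : M * h ≤ 1) (h0 : ∀ x, 0 ≤ G x) (hC₀ : ∀ x, G x ≤ C₀) (hε : 0 ≤ ε)
    (hunif : ∀ x y : ℝ, |x - y| ≤ h → |G x - G y| ≤ ε) :
    |h * ∑ m ∈ Finset.range M, G (m * h) - ∫ x in (0 : ℝ)..1, G x| ≤ ε + C₀ * (1 - M * h) := by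
  have hI : ∀ a b, IntervalIntegrable G volume a b := fun a b => hG.intervalIntegrable a b
  have h1 : ∑ m ∈ Finset.range M, ∫ x in (m * h : ℝ)..((m + 1 : ℕ) * h : ℝ), G x =
      ∫ x in (0 : ℝ)..(M * h), G x := by
    have := intervalIntegral.sum_integral_adjacent_intervals (f := G) (μ := volume) (n := M)
      (a := fun m : ℕ => (m : ℝ) * h) fun m _ => hI _ _
    simpa using this
  have h2 : ∀ m ∈ Finset.range M,
      |h * G (m * h) - ∫ x in (m * h : ℝ)..((m + 1 : ℕ) * h : ℝ), G x| ≤ ε * h := by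
    intro m _
    have e1 : h * G (m * h) = ∫ x in (m * h : ℝ)..((m + 1 : ℕ) * h : ℝ), G (m * h) := by
      rw [intervalIntegral.integral_const, smul_eq_mul]; push_cast; ring
    rw [e1, ← intervalIntegral.integral_sub (by simp) (hI _ _)]
    have hle : (m * h : ℝ) ≤ (m + 1 : ℕ) * h := by push_cast; nlinarith
    have := intervalIntegral.norm_integral_le_of_norm_le_const (a := (m * h : ℝ))
      (b := ((m + 1 : ℕ) * h : ℝ)) (f := fun x => G (m * h) - G x) (C := ε) (by
        intro x hx
        rw [Set.uIoc_of_le hle] at hx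
        apply hunif
        have := hx.2
        push_cast at this
        rw [abs_le]
        constructor <;> linarith [hx.1])
    rw [Real.norm_eq_abs] at this
    refine this.trans (le_of_eq ?_)
    push_cast
    rw [show ((m : ℝ) + 1) * h - m * h = h by ring, abs_of_nonneg hh]
  have h3 : |h * ∑ m ∈ Finset.range M, G (m * h) - ∫ x in (0 : ℝ)..(M * h), G x| ≤ ε := by
    rw [← h1, Finset.mul_sum, ← Finset.sum_sub_distrib]
    refine (Finset.abs_sum_le_sum_abs _ _).trans ((Finset.sum_le_sum h2).trans ?_)
    rw [Finset.sum_const, Finset.card_range, nsmul_eq_mul]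
    nlinarith
  have h4 : ∫ x in (M * h : ℝ)..1, G x ≤ C₀ * (1 - M * h) := by
    have := intervalIntegral.integral_mono_on hMh (hI _ _) (by simp : IntervalIntegrable
      (fun _ : ℝ => C₀) volume (M * h : ℝ) 1) fun x _ => hC₀ x
    rw [intervalIntegral.integral_const, smul_eq_mul] at this
    linarith
  have h5 : 0 ≤ ∫ x in (M * h : ℝ)..1, G x :=
    intervalIntegral.integral_nonneg hMh fun x _ => h0 x
  have h6 := intervalIntegral.integral_add_adjacent_intervals (hI 0 (M * h)) (hI (M * h) 1)
  rw [← h6]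
  rw [abs_le] at h3 ⊢
  constructor <;> linarith [h3.1, h3.2]

/-! ### The Bayes risk over the localized family -/

/-- With information `1/τ` from the data and `1/w` from the prior, `w = τ (u - 1)` gives `1 / (1/τ +
1/w) = τ (1 - 1/u)`. The remaining factors are the errors from the cutoff, the lost mass and the
truncation. -/
lemma bayes_term_ge {D Z a w L ε τ u : ℝ} (hε : 0 < ε) (hε1 : ε < 1) (hD : 1 - ε ≤ D)
    (hZ : 1 - ε ≤ Z) (hZ1 : Z ≤ 1) (hτ : 0 < τ) (hu : 1 < u) (hw : w = τ * (u - 1))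
    (haw : (4 * L * (a * w) + 1) ^ 2 ≤ 1 + 2 * ε) :
    (1 - ε) ^ 4 / (1 + 2 * ε) * (τ * (1 - u⁻¹)) ≤
      (D * Z) ^ 2 / ((1 + 2 * ε) / τ * Z + w * (4 * L * a + 1 / w) ^ 2) := by
  have hu0 : 0 < u - 1 := by linarith
  have hw0 : 0 < w := by rw [hw]; positivity
  have h1e : 0 < 1 - ε := by linarith
  have hZ0 : 0 < Z := by linarith
  have e1 : w * (4 * L * a + 1 / w) ^ 2 = (4 * L * (a * w) + 1) ^ 2 / w := by
    field_simp
  have h1 : (1 + 2 * ε) / τ * Z + w * (4 * L * a + 1 / w) ^ 2 ≤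
      (1 + 2 * ε) / τ + (1 + 2 * ε) / w := by
    rw [e1]
    exact add_le_add (mul_le_of_le_one_right (by positivity) hZ1)
      (div_le_div_of_nonneg_right haw hw0.le)
  have h2 : 0 < (1 + 2 * ε) / τ * Z + w * (4 * L * a + 1 / w) ^ 2 := by
    have : 0 < (1 + 2 * ε) / τ * Z := by positivity
    have : 0 ≤ w * (4 * L * a + 1 / w) ^ 2 := by positivity
    linarith
  have h3 : (1 - ε) ^ 4 ≤ (D * Z) ^ 2 := by
    calc (1 - ε) ^ 4 = ((1 - ε) * (1 - ε)) ^ 2 := by ring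
      _ ≤ _ := pow_le_pow_left₀ (by positivity)
        (mul_le_mul hD hZ h1e.le (h1e.le.trans hD)) 2
  calc (1 - ε) ^ 4 / (1 + 2 * ε) * (τ * (1 - u⁻¹)) =
        (1 - ε) ^ 4 / ((1 + 2 * ε) / τ + (1 + 2 * ε) / w) := by
        have hu' : (0 : ℝ) < u := by linarith
        have hu'' := hu0.ne'
        rw [hw]
        field_simp
        ring
    _ ≤ _ := div_le_div₀ (sq_nonneg _) h3 h2 h1

/-- The prior variances. -/
def priorVar (k n N : ℕ) {M i₀ : ℕ} (sg : Fin M → ℝ) (α : Idx M i₀ N) : ℝ :=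
  sg α.1 / n * (((N : ℝ) / (α.2 : ℕ)) ^ k - 1)

lemma one_lt_ratio_pow {k i N : ℕ} (hk : 1 ≤ k) (hi : 1 ≤ i) (hiN : i < N) :
    1 < ((N : ℝ) / i) ^ k := by
  have hi' : (0 : ℝ) < i := by exact_mod_cast hi
  refine one_lt_pow₀ ?_ (by omega)
  rw [one_lt_div hi']
  exact_mod_cast hiN

lemma weight_nonneg (k n q M i₀ N : ℕ) (α : Idx M i₀ N) : 0 ≤ weight k n q M i₀ N α := by
  unfold weight; positivity

/-- The Bayes lower bound for the localized family. -/
theorem localized_bayes {g : I → C(I, ℝ) → ℝ} (hg0 : ∀ x S, 0 ≤ g x S) (h2 : CondH2 g)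
    {n : ℕ} {l : ℝ} (hl : 3 ≤ l) {μ : Measure I} [IsFiniteMeasure μ] {k q M N i₀ : ℕ}
    (hk : 1 ≤ k) (hi₀ : 1 ≤ i₀) (hn : 0 < n) (hM : M * q ≤ n) (hN : N ≤ q)
    (hμ : Localizes μ n q) {χ : ℝ → ℝ} {η ε : ℝ} (hχ : IsCutoff χ η) (hη : η < 1 / 2)
    (hε : 0 < ε) (hε1 : ε < 1) (hηε : 4 * η + 2 / q ≤ ε) {R : ℝ} (hR : 0 < R)
    {ρ ρ' : ℝ → ℝ} (hρ : ∀ t, HasDerivAt ρ (ρ' t) t) {L : ℝ}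
    (hρ0 : ∀ t, R * (1 - ε) ≤ t → ρ t = 0) (hρ1 : ∀ t, 0 ≤ t → t ≤ R * (1 - 2 * ε) → ρ t = 1)
    (hρabs : ∀ t, |ρ t| ≤ 1) (hρ' : ∀ t, |ρ' t| ≤ L) (hρm : Measurable ρ')
    {sg : Fin M → ℝ} (hsg : ∀ m, 0 < sg m)
    (hpos : ∀ θ, wsq (weight k n q M i₀ N) θ < R → ∀ x, 0 < g x (synth (basisFn hχ n q M i₀ N) θ))
    (hinfo : ∀ (α : Idx M i₀ N) θ, wsq (weight k n q M i₀ N) θ < R →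
      ∑ j : Fin n, ((basisFn hχ n q M i₀ N α (design n j)) ^ 2 /
          (g (design n j) (synth (basisFn hχ n q M i₀ N) θ)) ^ 2 +
        (fderiv ℝ (fun u : C(I, ℝ) => (g (design n j) u) ^ 2) (synth (basisFn hχ n q M i₀ N) θ)
          (basisFn hχ n q M i₀ N α)) ^ 2 /
        (2 * ((g (design n j) (synth (basisFn hχ n q M i₀ N) θ)) ^ 2) ^ 2)) ≤
      (1 + 2 * ε) * n / sg α.1)
    (hE : ∑ α, weight k n q M i₀ N α * priorVar k n N sg α ≤ R * (1 - 3 * ε))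
    {β : ℝ} (hβ : ∀ α, weight k n q M i₀ N α * priorVar k n N sg α ≤ β)
    (hβ1 : (4 * L * β + 1) ^ 2 ≤ 1 + 2 * ε) (hβ2 : 2 * β ≤ ε ^ 3 * R)
    (T : Estimator n) {X : ℝ≥0∞}
    (hX : ∀ θ, wsq (weight k n q M i₀ N) θ < R →
      riskWith μ g l T (synth (basisFn hχ n q M i₀ N) θ) ≤ X) :
    ENNReal.ofReal ((1 - ε) ^ 4 / (1 + 2 * ε) * ((∑ m, sg m) / n *
      ∑ i ∈ Finset.Ico i₀ N, (1 - ((i : ℝ) / N) ^ k))) ≤ X := by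
  have hn' : (0 : ℝ) < n := by exact_mod_cast hn
  have hL : 0 ≤ L := (abs_nonneg _).trans (hρ' 0)
  set a := weight k n q M i₀ N with ha
  set w := priorVar k n N (i₀ := i₀) sg with hw
  set e := basisFn hχ n q M i₀ N with he
  have hα : ∀ α : Idx M i₀ N, 1 ≤ (α.2 : ℕ) ∧ (α.2 : ℕ) < N := fun α => by
    have := Finset.mem_Ico.1 α.2.2
    omega
  have hαm : ∀ α : Idx M i₀ N, ((α.1 : ℕ) + 1) * q ≤ n := fun α =>
    le_trans (Nat.mul_le_mul_right q α.1.2) hM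
  have ha0 : ∀ α, 0 ≤ a α := weight_nonneg _ _ _ _ _ _
  have hu : ∀ α : Idx M i₀ N, 1 < ((N : ℝ) / (α.2 : ℕ)) ^ k := fun α =>
    one_lt_ratio_pow hk (hα α).1 (hα α).2
  have hw0 : ∀ α, 0 < w α := fun α =>
    mul_pos (div_pos (hsg _) hn') (by linarith [hu α])
  have haw0 : ∀ α, 0 ≤ a α * w α := fun α => mul_nonneg (ha0 α) (hw0 α).le
  set Y := ∫⁻ θ, ENNReal.ofReal (ρ (wsq a θ) ^ 2) ∂(prodGaussian 0 w) with hY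
  have hY1 : Y ≤ 1 := prior_mass_le_one hρabs
  have hYtop : Y ≠ ∞ := ne_top_of_le_ne_top ENNReal.one_ne_top hY1
  have hYlow : ENNReal.ofReal (1 - ε) ≤ Y := by
    -- Nested radii: the mean energy is at most `R (1 - 3ε)`, `ρ` is 1 up to `R (1 - 2ε)` and 0 from
    -- `R (1 - ε)` on. The gap `ε R` is the deviation in Chebyshev's inequality, and `2β ≤ ε³ R`
    -- makes the lost mass at most `ε`.
    have h := prior_mass_ge ha0 (fun α => (hw0 α).le) hρ1 (mul_pos hε hR)
      (by linarith : ∑ α, a α * w α + ε * R ≤ R * (1 - 2 * ε)) hβ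
    refine le_trans (ENNReal.ofReal_le_ofReal ?_) h
    have hE2 : ∑ α, a α * w α ≤ R := hE.trans (by nlinarith)
    have : 2 * β * (∑ α, a α * w α) / (ε * R) ^ 2 ≤ ε := by
      rw [div_le_iff₀ (by positivity)]
      calc 2 * β * (∑ α, a α * w α) ≤ (ε ^ 3 * R) * R :=
            mul_le_mul hβ2 hE2 (Finset.sum_nonneg fun α _ => haw0 α) (by positivity)
        _ = _ := by ring
    linarith
  have hZeq : Y = ENNReal.ofReal Y.toReal := (ENNReal.ofReal_toReal hYtop).symm
  have hZ1 : Y.toReal ≤ 1 := by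
    simpa using ENNReal.toReal_mono ENNReal.one_ne_top hY1
  have hZlow : 1 - ε ≤ Y.toReal := (ENNReal.ofReal_le_iff_le_toReal hYtop).1 hYlow
  have hmain := bayes_family hg0 h2 hl e (φ := fun α : Idx M i₀ N => phi n q α.1 α.2)
    (fun α => measurable_phi _ _ _ _) (fun α x => abs_phi_le _ _ _ _ x)
    (fun α α' => by
      rw [hμ.orth _ _ _ _ (hαm α) (hα α).1 ((hα α).2.trans_le hN) (hα α').1
        ((hα α').2.trans_le hN)]
      refine if_congr ?_ rfl rfl
      rw [Prod.ext_iff, Fin.ext_iff, Subtype.ext_iff])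
    ha0 hw0 hρ (by nlinarith : R * (1 - ε) < R) hρ0 hρabs hρ' hρm
    (fun θ hθ j => hpos θ hθ _) (J := fun α => (1 + 2 * ε) * n / sg α.1)
    (fun α => by have := hsg α.1; positivity) hinfo ENNReal.toReal_nonneg hZeq T hX
  have hlast : X * ENNReal.ofReal Y.toReal ≤ X :=
    mul_le_of_le_one_right' (by rw [← hZeq]; exact hY1)
  refine le_trans ?_ (hmain.trans hlast)
  rw [← ENNReal.ofReal_sum_of_nonneg fun α _ => ?_]
  · refine ENNReal.ofReal_le_ofReal ?_
    have e1 : (1 - ε) ^ 4 / (1 + 2 * ε) * ((∑ m, sg m) / n *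
        ∑ i ∈ Finset.Ico i₀ N, (1 - ((i : ℝ) / N) ^ k)) =
        ∑ α : Idx M i₀ N, (1 - ε) ^ 4 / (1 + 2 * ε) *
          (sg α.1 / n * (1 - (((N : ℝ) / (α.2 : ℕ)) ^ k)⁻¹)) := by
      rw [← Finset.mul_sum, Fintype.sum_prod_type, Finset.sum_div, Finset.sum_mul,
        ← Finset.sum_coe_sort (Finset.Ico i₀ N)]
      congr 1
      refine Finset.sum_congr rfl fun m _ => ?_
      rw [Finset.mul_sum]
      refine Finset.sum_congr rfl fun i _ => ?_
      rw [← inv_pow, inv_div]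
    rw [e1]
    refine Finset.sum_le_sum fun α _ => ?_
    have hD := hμ.diag χ η hχ hη _ _ (hαm α) (hα α).1 ((hα α).2.trans_le hN)
    have := bayes_term_ge (a := a α) (L := L) hε hε1 (D := ∫ x, e α x * phi n q α.1 α.2 x ∂μ)
      (le_trans (by linarith) hD) hZlow hZ1 (div_pos (hsg α.1) hn') (hu α) (w := w α) rfl
      (le_trans (pow_le_pow_left₀ (by have := haw0 α; positivity)
        (by
          have := mul_le_mul_of_nonneg_left (hβ α) (by positivity : 0 ≤ 4 * L)
          linarith) 2) hβ1)
    rwa [div_div_eq_mul_div] at this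
  · have := hsg α.1
    have := (hw0 α).le
    positivity

/-! ### Evaluation of the sums -/

section Sums

variable {k n q M N i₀ : ℕ} {b s : ℝ}

/-- The energy of the prior. -/
lemma prior_energy_le {sg : Fin M → ℝ} (hsg : ∀ m, 0 ≤ sg m) (hi₀ : 1 ≤ i₀) (hN : 1 ≤ N)
    (hq : 0 < q) (hn : 0 < n) (hs : s ^ (2 * k + 1) = n) (hNb : (N : ℝ) ≤ b * (q / n) * s) :
    ∑ α : Idx M i₀ N, weight k n q M i₀ N α * priorVar k n N sg α ≤
      ((q : ℝ) / n * ∑ m, sg m) * Real.pi ^ (2 * k) * b ^ (2 * k + 1) *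
        (k / ((k + 1) * (2 * k + 1)) + 1 / N) := by
  have hn' : (0 : ℝ) < n := by exact_mod_cast hn
  have hq' : (0 : ℝ) < q := by exact_mod_cast hq
  have hN' : (0 : ℝ) < N := by exact_mod_cast hN
  have e1 : ∑ α : Idx M i₀ N, weight k n q M i₀ N α * priorVar k n N sg α =
      ((∑ m, sg m) / n * (Real.pi * (n / q)) ^ (2 * k)) *
        ∑ i ∈ Finset.Ico i₀ N, (i : ℝ) ^ (2 * k) * (((N : ℝ) / i) ^ k - 1) := by
    rw [Fintype.sum_prod_type, Finset.sum_div, Finset.sum_mul, Finset.sum_mul,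
      ← Finset.sum_coe_sort (Finset.Ico i₀ N)]
    refine Finset.sum_congr rfl fun m _ => ?_
    rw [Finset.mul_sum]
    refine Finset.sum_congr rfl fun i _ => ?_
    simp only [weight, priorVar, mul_pow]
    ring
  have hS : 0 ≤ ∑ m, sg m := Finset.sum_nonneg fun m _ => hsg m
  have h1 : (N : ℝ) ^ (2 * k + 1) ≤ (b * (q / n) * s) ^ (2 * k + 1) :=
    pow_le_pow_left₀ hN'.le hNb _
  rw [e1]
  calc _ ≤ ((∑ m, sg m) / n * (Real.pi * (n / q)) ^ (2 * k)) *
        ((b * (q / n) * s) ^ (2 * k + 1) * (k / ((k + 1) * (2 * k + 1)) + 1 / N)) :=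
        mul_le_mul_of_nonneg_left ((sum_energy_le k hi₀ hN).trans
          (mul_le_mul_of_nonneg_right h1 (by positivity))) (by positivity)
    _ = _ := by
        -- All powers of `n` cancel: `s^{2k+1} = n` compensates the noise level `1/n`, and the scale
        -- powers leave one factor `q / n`, which turns `∑ sg` into a Riemann sum.
        rw [mul_pow _ s, hs, mul_pow b, pow_succ ((q : ℝ) / n), mul_pow Real.pi]
        have : ((n : ℝ) / q) ^ (2 * k) * ((q : ℝ) / n) ^ (2 * k) = 1 := by
          rw [← mul_pow, div_mul_div_cancel₀ hq'.ne', div_self hn'.ne', one_pow]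
        rw [pow_succ b]
        linear_combination ((∑ m, sg m) * (q / n) * b ^ (2 * k) * b * Real.pi ^ (2 * k) *
          (k / ((k + 1) * (2 * k + 1)) + 1 / N) * (n / n)) * this +
          ((∑ m, sg m) * (q / n) * b ^ (2 * k) * b * Real.pi ^ (2 * k) *
          (k / ((k + 1) * (2 * k + 1)) + 1 / N)) * (div_self hn'.ne')

/-- Each coordinate of the prior carries a negligible energy. -/
lemma prior_coordinate_le {sg : Fin M → ℝ} (hsg : ∀ m, 0 ≤ sg m) {C₀ : ℝ} (hC₀ : ∀ m, sg m ≤ C₀)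
    (hi₀ : 1 ≤ i₀) (hq : 0 < q) (hn : 0 < n) (hs0 : 0 < s) (hs : s ^ (2 * k + 1) = n)
    (hNb : (N : ℝ) ≤ b * (q / n) * s) (α : Idx M i₀ N) :
    weight k n q M i₀ N α * priorVar k n N sg α ≤ C₀ * Real.pi ^ (2 * k) * b ^ (2 * k) / s := by
  have hn' : (0 : ℝ) < n := by exact_mod_cast hn
  have hq' : (0 : ℝ) < q := by exact_mod_cast hq
  have hα := Finset.mem_Ico.1 α.2.2
  have hi' : (0 : ℝ) < (α.2 : ℕ) := by exact_mod_cast (by omega : 0 < (α.2 : ℕ))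
  have hiN : ((α.2 : ℕ) : ℝ) ≤ N := by exact_mod_cast hα.2.le
  have h1 : ((α.2 : ℕ) : ℝ) ^ (2 * k) * (((N : ℝ) / (α.2 : ℕ)) ^ k - 1) ≤ (N : ℝ) ^ (2 * k) := by
    have e : ((α.2 : ℕ) : ℝ) ^ (2 * k) * ((N : ℝ) / (α.2 : ℕ)) ^ k =
        ((α.2 : ℕ) : ℝ) ^ k * (N : ℝ) ^ k := by
      rw [div_pow, two_mul, pow_add]; field_simp
    have h2 := mul_le_mul_of_nonneg_right (pow_le_pow_left₀ hi'.le hiN k)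
      (by positivity : (0 : ℝ) ≤ (N : ℝ) ^ k)
    have h3 : (0 : ℝ) ≤ ((α.2 : ℕ) : ℝ) ^ (2 * k) := by positivity
    rw [mul_sub, e, two_mul, pow_add, pow_add, mul_one]
    rw [two_mul, pow_add] at h3
    linarith
  have h2 : (N : ℝ) ^ (2 * k) ≤ (b * (q / n) * s) ^ (2 * k) :=
    pow_le_pow_left₀ (Nat.cast_nonneg N) hNb _
  have hC : 0 ≤ C₀ := (hsg α.1).trans (hC₀ α.1)
  calc weight k n q M i₀ N α * priorVar k n N sg α =
        (sg α.1 / n * (Real.pi * (n / q)) ^ (2 * k)) *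
          (((α.2 : ℕ) : ℝ) ^ (2 * k) * (((N : ℝ) / (α.2 : ℕ)) ^ k - 1)) := by
        simp only [weight, priorVar, mul_pow]; ring
    _ ≤ (sg α.1 / n * (Real.pi * (n / q)) ^ (2 * k)) * (b * (q / n) * s) ^ (2 * k) :=
        mul_le_mul_of_nonneg_left (h1.trans h2) (by have := hsg α.1; positivity)
    _ ≤ (C₀ / n * (Real.pi * (n / q)) ^ (2 * k)) * (b * (q / n) * s) ^ (2 * k) := by
        refine mul_le_mul_of_nonneg_right (mul_le_mul_of_nonneg_right
          (div_le_div_of_nonneg_right (hC₀ _) hn'.le) (by positivity)) ?_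
        rw [pow_mul]; positivity
    _ = _ := by
        have e1 : (Real.pi * (n / q)) ^ (2 * k) * (b * (q / n) * s) ^ (2 * k) =
            Real.pi ^ (2 * k) * b ^ (2 * k) * s ^ (2 * k) := by
          rw [← mul_pow, ← mul_pow, ← mul_pow]
          congr 1
          field_simp
        rw [mul_assoc, e1, ← hs, pow_succ]
        field_simp

end Sums

/-! ### The scale near the zero function -/

section Scale

variable {g : I → C(I, ℝ) → ℝ}

lemma continuous_scaleSq (h4 : CondH4 g) : Continuous (scaleSq g) :=
  (h4.1.comp continuous_projIcc).pow 2

lemma exists_scaleSq_bounds (h4 : CondH4 g) (hpos : ∀ x, 0 < g x 0) :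
    ∃ c₀ C₀ : ℝ, 0 < c₀ ∧ ∀ x, c₀ ≤ scaleSq g x ∧ scaleSq g x ≤ C₀ := by
  have hc : Continuous fun x : I => (g x 0) ^ 2 := h4.1.pow 2
  obtain ⟨a, -, ha⟩ := isCompact_univ.exists_isMinOn (Set.univ_nonempty (α := I)) hc.continuousOn
  obtain ⟨b, -, hb⟩ := isCompact_univ.exists_isMaxOn (Set.univ_nonempty (α := I)) hc.continuousOn
  exact ⟨_, _, pow_pos (hpos a) 2, fun x => ⟨ha (Set.mem_univ _), hb (Set.mem_univ _)⟩⟩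

lemma exists_scaleSq_modulus (h4 : CondH4 g) {ε : ℝ} (hε : 0 < ε) :
    ∃ h : ℝ, 0 < h ∧ ∀ x y : ℝ, |x - y| ≤ h → |scaleSq g x - scaleSq g y| ≤ ε := by
  have hc : UniformContinuous fun x : I => (g x 0) ^ 2 :=
    CompactSpace.uniformContinuous_of_continuous (h4.1.pow 2)
  obtain ⟨δ, hδ, h⟩ := Metric.uniformContinuous_iff.1 hc ε hε
  refine ⟨δ / 2, by positivity, fun x y hxy => ?_⟩
  have := @h (Set.projIcc 0 1 zero_le_one x) (Set.projIcc 0 1 zero_le_one y) (by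
    rw [Subtype.dist_eq, Real.dist_eq]
    exact ((Set.abs_projIcc_sub_projIcc zero_le_one).trans hxy).trans_lt (by linarith))
  rw [Real.dist_eq] at this
  exact this.le

lemma exists_sq_close (h4 : CondH4 g) (hg0 : ∀ x S, 0 ≤ g x S) {C₀ ε : ℝ}
    (hC₀ : ∀ x : I, (g x 0) ^ 2 ≤ C₀) (hε : 0 < ε) :
    ∃ δ : ℝ, 0 < δ ∧ ∀ S : C(I, ℝ), ‖S‖ ≤ δ → ∀ x, |(g x S) ^ 2 - (g x 0) ^ 2| ≤ ε := by
  have hC : 0 ≤ C₀ := (sq_nonneg _).trans (hC₀ 0)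
  set B := Real.sqrt C₀ with hB
  have hB0 : 0 ≤ B := Real.sqrt_nonneg _
  obtain ⟨δ, hδ, h⟩ := h4.2 (min 1 (ε / (2 * B + 1))) (by positivity)
  refine ⟨δ, hδ, fun S hS x => ?_⟩
  have h1 := h S hS x
  have hb : g x 0 ≤ B := Real.le_sqrt_of_sq_le (hC₀ x)
  have h2 := h1.trans (min_le_left _ _)
  have h3 := h1.trans (min_le_right _ _)
  have h4 : |g x S + g x 0| ≤ 2 * B + 1 := by
    rw [abs_of_nonneg (add_nonneg (hg0 _ _) (hg0 _ _))]
    linarith [(abs_le.1 h2).2]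
  rw [sq_sub_sq, abs_mul]
  calc |g x S + g x 0| * |g x S - g x 0| ≤ (2 * B + 1) * (ε / (2 * B + 1)) :=
        mul_le_mul h4 h3 (abs_nonneg _) (by positivity)
    _ = ε := by field_simp

lemma abs_varsigma_sub_le (hg : IsScale g) {ε : ℝ} {S : C(I, ℝ)}
    (h : ∀ x, |(g x S) ^ 2 - (g x 0) ^ 2| ≤ ε) : |varsigma g S - varsigma g 0| ≤ ε := by
  unfold varsigma
  rw [← integral_sub (hg.2 S).integrable_sq (hg.2 0).integrable_sq]
  simpa using norm_integral_le_of_norm_le_const (μ := (volume : Measure I))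
    (f := fun x => (g x S) ^ 2 - (g x 0) ^ 2) (ae_of_all _ h)

lemma varsigma_nonneg (g : I → C(I, ℝ) → ℝ) (S : C(I, ℝ)) : 0 ≤ varsigma g S :=
  integral_nonneg fun _ => sq_nonneg _

lemma gammaStar_nonneg (k : ℕ) : 0 ≤ gammaStar k := by
  have := Real.pi_pos
  unfold gammaStar; positivity

/-- The exponent `2k/(2k+1)` is at most 1, so a relative error in `ς` is not amplified. -/
lemma pinsker_le {k : ℕ} {r ε : ℝ} (hr : 0 ≤ r) (hε : 0 ≤ ε) {S : C(I, ℝ)}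
    (h : varsigma g S ≤ (1 + ε) * varsigma g 0) :
    pinsker g k r S ≤ (1 + ε) * pinsker g k r 0 := by
  have h1 : (2 * k / (2 * k + 1) : ℝ) ≤ 1 := by
    rw [div_le_one (by positivity)]; linarith
  have h2 : varsigma g S ^ (2 * k / (2 * k + 1) : ℝ) ≤
      (1 + ε) * varsigma g 0 ^ (2 * k / (2 * k + 1) : ℝ) := by
    refine (Real.rpow_le_rpow (varsigma_nonneg g S) h (by positivity)).trans ?_
    rw [Real.mul_rpow (by positivity) (varsigma_nonneg g 0)]
    refine mul_le_mul_of_nonneg_right ?_ (Real.rpow_nonneg (varsigma_nonneg g 0) _)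
    calc (1 + ε) ^ (2 * k / (2 * k + 1) : ℝ) ≤ (1 + ε) ^ (1 : ℝ) :=
          Real.rpow_le_rpow_of_exponent_le (by linarith) h1
      _ = 1 + ε := Real.rpow_one _
  unfold pinsker
  have h3 : 0 ≤ gammaStar k * r ^ (1 / (2 * k + 1) : ℝ) :=
    mul_nonneg (gammaStar_nonneg k) (Real.rpow_nonneg hr _)
  calc _ ≤ gammaStar k * r ^ (1 / (2 * k + 1) : ℝ) *
        ((1 + ε) * varsigma g 0 ^ (2 * k / (2 * k + 1) : ℝ)) := mul_le_mul_of_nonneg_left h2 h3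
    _ = _ := by ring

end Scale

/-! ### Truncation of the prior and local constants of the scale -/

lemma exists_density_cutoff {a b : ℝ} (ha : 0 < a) (hab : a < b) : ∃ (ρ ρ' : ℝ → ℝ) (L : ℝ),
    (∀ t, HasDerivAt ρ (ρ' t) t) ∧ (∀ t, b ≤ t → ρ t = 0) ∧ (∀ t, 0 ≤ t → t ≤ a → ρ t = 1) ∧
      (∀ t, |ρ t| ≤ 1) ∧ (∀ t, |ρ' t| ≤ L) ∧ Measurable ρ' := by
  let f : ContDiffBump (0 : ℝ) := ⟨a, b, ha, hab⟩
  have hd : Differentiable ℝ f := f.contDiff.differentiable (n := 1) one_ne_zero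
  have hcd : Continuous (deriv f) := (f.contDiff (n := 1)).continuous_deriv le_rfl
  obtain ⟨L, hL⟩ := hcd.bounded_above_of_compact_support f.hasCompactSupport.deriv
  refine ⟨f, deriv f, L, fun t => (hd t).hasDerivAt, fun t ht => ?_, fun t h0 ht => ?_, fun t => ?_,
    hL, hcd.measurable⟩
  · apply f.zero_of_le_dist
    rw [Real.dist_eq, sub_zero]
    exact le_trans ht (le_abs_self t)
  · apply f.one_of_mem_closedBall
    rw [Metric.mem_closedBall, Real.dist_eq, sub_zero, abs_of_nonneg h0]
    exact ht
  · rw [abs_of_nonneg f.nonneg]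
    exact f.le_one

/-- The constants of a neighbourhood of the zero function on which the squared scale is almost
constant on each of the `M` windows. -/
structure LocalScale (g : I → C(I, ℝ) → ℝ) (ε c₀ C₀ C δ : ℝ) (M : ℕ) : Prop where
  low_pos : 0 < c₀
  bounds : ∀ x, c₀ ≤ scaleSq g x ∧ scaleSq g x ≤ C₀
  deriv_pos : 0 < C
  deriv_le : ∀ (x : I) (S f : C(I, ℝ)),
    |fderiv ℝ (fun u : C(I, ℝ) => (g x u) ^ 2) S f| ≤
      C * (|S x * f x| + l1norm f + l2norm S * l2norm f)
  radius_pos : 0 < δ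
  close : ∀ S : C(I, ℝ), ‖S‖ ≤ δ → ∀ x, |(g x S) ^ 2 - (g x 0) ^ 2| ≤ ε * c₀ / 4
  windows_pos : 0 < M
  modulus : ∀ x y : ℝ, |x - y| ≤ 1 / M → |scaleSq g x - scaleSq g y| ≤ ε * c₀ / 4
  small : 12 * C ^ 2 / c₀ ^ 2 * (δ ^ 2 + 1 / M) ≤ ε / C₀

lemma exists_localScale {g : I → C(I, ℝ) → ℝ} (hg0 : ∀ x S, 0 ≤ g x S) (h3 : CondH3 g)
    (h4 : CondH4 g) (hpos : ∀ x, 0 < g x 0) {ε : ℝ} (hε : 0 < ε) :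
    ∃ c₀ C₀ C δ M, LocalScale g ε c₀ C₀ C δ M := by
  obtain ⟨c₀, C₀, hc₀, hcC⟩ := exists_scaleSq_bounds h4 hpos
  have hC₀ : 0 < C₀ := hc₀.trans_le ((hcC 0).1.trans (hcC 0).2)
  obtain ⟨C, hC, h3⟩ := h3
  have hε4 : 0 < ε * c₀ / 4 := by positivity
  obtain ⟨δ₁, hδ₁, hclose⟩ := exists_sq_close h4 hg0
    (fun x : I => by rw [← scaleSq_coe]; exact (hcC x).2) hε4
  obtain ⟨h₀, hh₀, hmod⟩ := exists_scaleSq_modulus h4 hε4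
  -- Solves `12 C² / c₀² · 2t = ε / C₀`: it then suffices that both `δ²` and `1 / M` are at most
  -- `t`.
  obtain ⟨t, ht⟩ : ∃ t, t = ε / (2 * C₀) * (c₀ ^ 2 / (12 * C ^ 2)) := ⟨_, rfl⟩
  have ht0 : 0 < t := by rw [ht]; positivity
  obtain ⟨M, hM⟩ := exists_nat_gt (max (1 / h₀) (1 / t))
  have hM1 : 1 / h₀ < M := (le_max_left _ _).trans_lt hM
  have hM2 : 1 / t < M := (le_max_right _ _).trans_lt hM
  have hM' : (0 : ℝ) < M := lt_trans (by positivity) hM1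
  have hδ : 0 < min δ₁ (Real.sqrt t) := lt_min hδ₁ (Real.sqrt_pos.2 ht0)
  refine ⟨c₀, C₀, C, min δ₁ (Real.sqrt t), M, hc₀, hcC, hC, h3, hδ,
    fun S hS => hclose S (hS.trans (min_le_left _ _)), by exact_mod_cast hM',
    fun x y hxy => hmod x y (hxy.trans ((one_div_le hM' hh₀).2 hM1.le)), ?_⟩
  have h1 : min δ₁ (Real.sqrt t) ^ 2 ≤ t :=
    (pow_le_pow_left₀ hδ.le (min_le_right _ _) 2).trans_eq (Real.sq_sqrt ht0.le)
  calc _ ≤ 12 * C ^ 2 / c₀ ^ 2 * (t + t) :=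
        mul_le_mul_of_nonneg_left (add_le_add h1 ((one_div_le hM' ht0).2 hM2.le)) (by positivity)
    _ = ε / C₀ := by rw [ht]; field_simp; ring

lemma LocalScale.half_le {g : I → C(I, ℝ) → ℝ} {M : ℕ} {ε c₀ C₀ C δ : ℝ}
    (hg : LocalScale g ε c₀ C₀ C δ M) (hε1 : ε < 1) {S : C(I, ℝ)} (hS : ‖S‖ ≤ δ) (x : I) :
    c₀ / 2 ≤ g x S ^ 2 := by
  have h1 := (abs_le.1 (hg.close S hS x)).1
  have h2 := (hg.bounds x).1
  rw [scaleSq_coe] at h2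
  nlinarith [hg.low_pos]

lemma LocalScale.half_le_varsigma {g : I → C(I, ℝ) → ℝ} (hg' : IsScale g) {M : ℕ}
    {ε c₀ C₀ C δ : ℝ} (hg : LocalScale g ε c₀ C₀ C δ M) (hε1 : ε < 1) {S : C(I, ℝ)}
    (hS : ‖S‖ ≤ δ) : c₀ / 2 ≤ varsigma g S := by
  have := integral_mono (μ := (volume : Measure I)) (integrable_const (c₀ / 2))
    (hg'.2 S).integrable_sq (hg.half_le hε1 hS)
  simpa [varsigma] using this

/-- The Fisher information of the localized family. -/
lemma localized_info {g : I → C(I, ℝ) → ℝ} {χ : ℝ → ℝ} {η : ℝ} (hχ : IsCutoff χ η)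
    {n q M m i : ℕ} {ε c₀ C₀ C δ : ℝ} (hg : LocalScale g ε c₀ C₀ C δ M) (hM : M * q ≤ n)
    (hm : m < M) (hi : 1 ≤ i) (hiq : i < q) (hε : 0 < ε) (hε1 : ε < 1) {S : C(I, ℝ)}
    (hS : ‖S‖ ≤ δ) :
    ∑ j : Fin n, ((bump hχ n q m i (design n j)) ^ 2 / (g (design n j) S) ^ 2 +
      (fderiv ℝ (fun u : C(I, ℝ) => (g (design n j) u) ^ 2) S (bump hχ n q m i)) ^ 2 /
        (2 * ((g (design n j) S) ^ 2) ^ 2)) ≤ (1 + 2 * ε) * n / scaleSq g (m * ((q : ℝ) / n)) := by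
  have hc₀ := hg.low_pos
  have hcC := hg.bounds
  have hclose := hg.close S hS
  have hq : 0 < q := by omega
  have hq' : (0 : ℝ) < q := by exact_mod_cast hq
  have hn' : (0 : ℝ) < n := by exact_mod_cast lt_of_lt_of_le (Nat.mul_pos hg.windows_pos hq) hM
  have hM' : (0 : ℝ) < M := by exact_mod_cast hg.windows_pos
  have hMn : (M : ℝ) * q ≤ n := by exact_mod_cast hM
  have hh : (q : ℝ) / n ≤ 1 / M := by
    rw [div_le_div_iff₀ hn' hM']; linarith
  have hsg : 0 < scaleSq g (m * ((q : ℝ) / n)) := hc₀.trans_le (hcC _).1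
  have hlow := hg.half_le hε1 hS
  refine info_bound hg.deriv_pos hg.deriv_le hχ (le_trans (Nat.mul_le_mul_right q hm) hM) hi hiq
      hε.le hsg hc₀ hS hlow
    (fun x hx => ?_) ?_
  -- Moving from the left end of the window to `x`, and from the zero function to `S`, costs `ε c₀ /
  -- 4` each. The total `ε c₀ / 2` is at most `ε g²` since `g² ≥ c₀ / 2`.
  · have e : (x : ℝ) - m * ((q : ℝ) / n) = ((x : ℝ) * n / q - m) * (q / n) := by
      field_simp
    have h1 : |(m * ((q : ℝ) / n)) - (x : ℝ)| ≤ 1 / M := by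
      rw [abs_sub_comm, e, abs_of_nonneg (mul_nonneg hx.1.le (by positivity))]
      exact (mul_le_of_le_one_left (by positivity) hx.2).trans hh
    have h2 := (abs_le.1 (hg.modulus _ _ h1)).2
    have h3 := (abs_le.1 (hclose x)).1
    rw [scaleSq_coe] at h2
    nlinarith [hlow x]
  · calc _ ≤ 12 * C ^ 2 / c₀ ^ 2 * (δ ^ 2 + 1 / M) :=
          mul_le_mul_of_nonneg_left (by linarith) (by positivity)
      _ ≤ ε / C₀ := hg.small
      _ ≤ _ := div_le_div_of_nonneg_left hε.le hsg (hcC _).2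

/-- The average of the squared scale over the windows. -/
lemma window_average {g : I → C(I, ℝ) → ℝ} (hg' : IsScale g) (h4 : CondH4 g) {n q M : ℕ}
    {ε c₀ C₀ C δ : ℝ}
    (hg : LocalScale g ε c₀ C₀ C δ M) (hM : M * q ≤ n) (hn : 0 < n) (hε : 0 < ε)
    (hε1 : ε < 1) (hcov : 1 - M * ((q : ℝ) / n) ≤ ε * c₀ / 4 / C₀) :
    |(q : ℝ) / n * (∑ m : Fin M, scaleSq g ((m : ℕ) * ((q : ℝ) / n))) - varsigma g 0| ≤
      ε * varsigma g 0 := by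
  have hc₀ := hg.low_pos
  have hC₀ : 0 < C₀ := hc₀.trans_le ((hg.bounds 0).1.trans (hg.bounds 0).2)
  have hn' : (0 : ℝ) < n := by exact_mod_cast hn
  have hM' : (0 : ℝ) < M := by exact_mod_cast hg.windows_pos
  have hMn : (M : ℝ) * q ≤ n := by exact_mod_cast hM
  have hh : (q : ℝ) / n ≤ 1 / M := by
    rw [div_le_div_iff₀ hn' hM']; linarith
  have hGc := continuous_scaleSq h4
  have hV := hg.half_le_varsigma hg' hε1 (S := 0) (by simpa using hg.radius_pos.le)
  have h1 := riemann_sum hGc (h := (q : ℝ) / n) (M := M) (by positivity)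
    (by rw [mul_comm, ← le_div_iff₀ hM']; exact hh)
    (fun x => hc₀.le.trans (hg.bounds x).1) (fun x => (hg.bounds x).2)
    (by positivity : 0 ≤ ε * c₀ / 4) fun x y hxy => hg.modulus x y (hxy.trans hh)
  rw [← varsigma_zero] at h1
  rw [Fin.sum_univ_eq_sum_range (fun m => scaleSq g ((m : ℝ) * ((q : ℝ) / n)))]
  refine h1.trans ?_
  -- Oscillation and uncovered remainder contribute `ε c₀ / 4` each, and `c₀ / 2 ≤ ς(0)`.
  have h2 := mul_le_mul_of_nonneg_left hcov hC₀.le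
  rw [mul_div_cancel₀ _ hC₀.ne'] at h2
  nlinarith

/-- The risk of an estimator over the family is controlled by the normalized minimax risk. -/
lemma riskWith_le_iSup {g : I → C(I, ℝ) → ℝ} {k : ℕ} {r ε l : ℝ} {n : ℕ} (μ : Measure I)
    (T : Estimator n) (S : sobolevClass k r) (hpos : 0 < pinsker g k r (restrict S))
    (hle : pinsker g k r (restrict S) ≤ (1 + ε) * pinsker g k r 0) :
    riskWith μ g l T (restrict S) ≤
      (⨆ S : sobolevClass k r, riskWith μ g l T (restrict S) /
        ENNReal.ofReal (pinsker g k r (restrict S))) *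
        ENNReal.ofReal ((1 + ε) * pinsker g k r 0) := by
  have h := le_iSup (fun S : sobolevClass k r => riskWith μ g l T (restrict S) /
    ENNReal.ofReal (pinsker g k r (restrict S))) S
  rw [ENNReal.div_le_iff_le_mul (Or.inl (ENNReal.ofReal_pos.2 hpos).ne')
    (Or.inl ENNReal.ofReal_ne_top)] at h
  exact h.trans (mul_le_mul_right (ENNReal.ofReal_le_ofReal hle) _)

lemma pinsker_pos {g : I → C(I, ℝ) → ℝ} {k : ℕ} (hk : 1 ≤ k) {r : ℝ} (hr : 0 < r) {S : C(I, ℝ)}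
    (hS : 0 < varsigma g S) : 0 < pinsker g k r S := by
  have := Real.pi_pos
  have : (0 : ℝ) < k := by exact_mod_cast hk
  unfold pinsker gammaStar
  positivity

/-! ### The size of the windows and the number of frequencies -/

section Rates

variable {k M : ℕ} {b : ℝ}

/-- The order of the number of frequencies. -/
def rate (k n : ℕ) : ℝ := (n : ℝ) ^ (1 / (2 * k + 1) : ℝ)

lemma rate_pow (k n : ℕ) : rate k n ^ (2 * k + 1) = n := by
  unfold rate
  rw [← Real.rpow_natCast, ← Real.rpow_mul (Nat.cast_nonneg n)]
  have : (1 / (2 * k + 1) : ℝ) * ((2 * k + 1 : ℕ) : ℝ) = 1 := by push_cast; field_simp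
  rw [this, Real.rpow_one]

lemma rpow_eq_div_rate {n : ℕ} (hn : 0 < n) :
    (n : ℝ) ^ (2 * k / (2 * k + 1) : ℝ) = n / rate k n := by
  have hn' : (0 : ℝ) < n := by exact_mod_cast hn
  unfold rate
  rw [eq_div_iff (Real.rpow_pos_of_pos hn' _).ne', ← Real.rpow_add hn']
  have : (2 * k / (2 * k + 1) : ℝ) + 1 / (2 * k + 1) = 1 := by field_simp
  rw [this, Real.rpow_one]

lemma tendsto_rate (k : ℕ) : Tendsto (rate k) atTop atTop :=
  (tendsto_rpow_atTop (by positivity)).comp tendsto_natCast_atTop_atTop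

lemma tendsto_windowSize (hM : 0 < M) :
    Tendsto (fun n : ℕ => ((n / M : ℕ) : ℝ)) atTop atTop :=
  tendsto_natCast_atTop_atTop.comp (Nat.tendsto_div_const_atTop hM.ne')

lemma lt_window_add {n : ℕ} (hM : 0 < M) : (n : ℝ) < M * ((n / M : ℕ) : ℝ) + M := by
  have := Nat.lt_mul_div_succ n hM
  have h : (n : ℝ) < M * ((n / M : ℕ) + 1 : ℕ) := by exact_mod_cast this
  push_cast at h ⊢
  linarith

lemma tendsto_frequencies (hM : 0 < M) (hb : 0 < b) :
    Tendsto (fun n : ℕ => b * (((n / M : ℕ) : ℝ) / n) * rate k n) atTop atTop := by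
  have hM' : (0 : ℝ) < M := by exact_mod_cast hM
  refine tendsto_atTop_mono' _ ?_ ((tendsto_rate k).const_mul_atTop
    (by positivity : 0 < b * (1 / (2 * M))))
  filter_upwards [eventually_ge_atTop (2 * M)] with n hn
  have hn2 : 2 * (M : ℝ) ≤ n := by exact_mod_cast hn
  have hn' : (0 : ℝ) < n := by linarith
  have hr : 0 ≤ rate k n := Real.rpow_nonneg hn'.le _
  refine mul_le_mul_of_nonneg_right (mul_le_mul_of_nonneg_left ?_ hb.le) hr
  rw [div_le_div_iff₀ (by positivity) hn']
  have := lt_window_add (n := n) hM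
  linarith

lemma eventually_window_cover (hM : 0 < M) {ε : ℝ} (hε : 0 < ε) :
    ∀ᶠ n : ℕ in atTop, 1 - M * (((n / M : ℕ) : ℝ) / n) ≤ ε := by
  filter_upwards [eventually_gt_atTop 0,
    tendsto_natCast_atTop_atTop.eventually_ge_atTop (M / ε)] with n hn hnε
  have hn' : (0 : ℝ) < n := by exact_mod_cast hn
  have := lt_window_add (n := n) hM
  rw [div_le_iff₀ hε] at hnε
  rw [sub_le_iff_le_add, ← mul_div_assoc, ← sub_le_iff_le_add', le_div_iff₀ hn']
  nlinarith

/-- Since `k ≥ 1`, the rate is at most of order `√n`. Hence the frequencies used in a window stay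
below the number `q` of its design points, as grid orthogonality requires. -/
lemma eventually_mul_rate_le (hk : 1 ≤ k) (b : ℝ) : ∀ᶠ n : ℕ in atTop, b * rate k n ≤ n := by
  filter_upwards [(tendsto_rate k).eventually_ge_atTop (max b 1)] with n hn
  have h1 : 1 ≤ rate k n := (le_max_right _ _).trans hn
  have h2 : b ≤ rate k n := (le_max_left _ _).trans hn
  calc b * rate k n ≤ rate k n * rate k n := by nlinarith
    _ = rate k n ^ 2 := (sq _).symm
    _ ≤ rate k n ^ (2 * k + 1) := pow_le_pow_right₀ h1 (by omega)
    _ = n := rate_pow k n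

end Rates

/-! ### Assembly of the lower bound -/

/-- The three factors `1 - ε` come from the Riemann sum of the scale, the rounding of `N`, and the
frequencies below `i₀` that are left out. -/
lemma risk_sum_ge {k N i₀ : ℕ} {n s h b V A ε : ℝ} (hn : 0 < n) (hs : 0 < s) (hA : 0 ≤ A)
    (hb : 0 ≤ b) (hε1 : ε < 1) (hV : (1 - ε) * V ≤ h * A) (hN : 1 ≤ N) (hiN : i₀ ≤ N)
    (hNx : (1 - ε) * (b * h * s) ≤ N) (hi : (i₀ : ℝ) ≤ ε * (k / (k + 1) * N)) :
    (1 - ε) ^ 3 * (V * b * (k / (k + 1))) ≤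
      n / s * (A / n * ∑ i ∈ Finset.Ico i₀ N, (1 - ((i : ℝ) / N) ^ k)) := by
  have h1e : 0 < 1 - ε := by linarith
  have hk : (0 : ℝ) ≤ k / (k + 1) := by positivity
  have h1 : (1 - ε) ^ 2 * (k / (k + 1)) * (b * h * s) ≤
      ∑ i ∈ Finset.Ico i₀ N, (1 - ((i : ℝ) / N) ^ k) := by
    have h2 := mul_le_mul_of_nonneg_left hNx (by positivity : 0 ≤ (1 - ε) * ((k : ℝ) / (k + 1)))
    have h3 := le_sum_risk k hN hiN
    linarith
  calc (1 - ε) ^ 3 * (V * b * (k / (k + 1))) =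
        ((1 - ε) * V) * ((1 - ε) ^ 2 * (k / (k + 1)) * b) := by ring
    _ ≤ (h * A) * ((1 - ε) ^ 2 * (k / (k + 1)) * b) :=
        mul_le_mul_of_nonneg_right hV (by positivity)
    _ = n / s * (A / n * ((1 - ε) ^ 2 * (k / (k + 1)) * (b * h * s))) := by field_simp
    _ ≤ _ := mul_le_mul_of_nonneg_left (mul_le_mul_of_nonneg_left h1 (by positivity))
        (by positivity)

/-- The efficiency lost by the localization. -/
def efficiency (ε : ℝ) : ℝ := (1 - ε) ^ 7 * (1 - 3 * ε) / ((1 + 2 * ε) * (1 + ε) ^ 4)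

lemma tendsto_efficiency : Tendsto efficiency (𝓝 0) (𝓝 1) := by
  have h : ContinuousAt efficiency 0 := by
    unfold efficiency
    refine ContinuousAt.div (by fun_prop) (by fun_prop) (by norm_num)
  have h2 := h.tendsto
  simpa [efficiency] using h2

/-- The choice of the number of frequencies for which the prior almost exhausts the energy. -/
lemma exists_frequency_constant {k : ℕ} (hk : 1 ≤ k) {r V ε : ℝ} (hr : 0 < r) (hV : 0 < V)
    (hε : 0 < ε) (hε3 : 3 * ε < 1) : ∃ b : ℝ, 0 < b ∧
    V * (1 + ε) * Real.pi ^ (2 * k) * b ^ (2 * k + 1) *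
        (k / ((k + 1) * (2 * k + 1)) * (1 + ε)) ≤ r / (1 + ε) * (1 - 3 * ε) ∧
      V * b * (k / (k + 1)) = gammaStar k * r ^ (1 / (2 * k + 1) : ℝ) *
        V ^ (2 * k / (2 * k + 1) : ℝ) * ((1 - 3 * ε) / (1 + ε) ^ 3) := by
  have hk' : (0 : ℝ) < k := by exact_mod_cast hk
  have hpi := Real.pi_pos
  obtain ⟨κ, hκ⟩ : ∃ κ : ℝ, κ = k / ((k + 1) * (2 * k + 1)) := ⟨_, rfl⟩
  have hκ0 : 0 < κ := by rw [hκ]; positivity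
  -- `b₀` would use up the energy `r` exactly; the factor `f` below shrinks it to leave room for the
  -- relative errors.
  obtain ⟨b₀, hb₀⟩ : ∃ b₀ : ℝ, b₀ = (r / (V * Real.pi ^ (2 * k) * κ)) ^ (1 / (2 * k + 1) : ℝ) :=
    ⟨_, rfl⟩
  have hb₀0 : 0 < b₀ := by rw [hb₀]; positivity
  have hb₀k : V * Real.pi ^ (2 * k) * κ * b₀ ^ (2 * k + 1) = r := by
    have : b₀ ^ (2 * k + 1) = r / (V * Real.pi ^ (2 * k) * κ) := by
      rw [hb₀, ← Real.rpow_natCast, ← Real.rpow_mul (by positivity)]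
      have : (1 / (2 * k + 1) : ℝ) * ((2 * k + 1 : ℕ) : ℝ) = 1 := by push_cast; field_simp
      rw [this, Real.rpow_one]
    rw [this]
    field_simp
  obtain ⟨f, hf⟩ : ∃ f : ℝ, f = (1 - 3 * ε) / (1 + ε) ^ 3 := ⟨_, rfl⟩
  have hf0 : 0 < f := hf ▸ div_pos (by linarith) (by positivity)
  have hf1 : f ≤ 1 := by
    rw [hf, div_le_one (by positivity)]
    linarith [one_le_pow₀ (by linarith : 1 ≤ 1 + ε) (n := 3)]
  refine ⟨b₀ * f, by positivity, ?_, ?_⟩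
  · rw [← hκ]
    -- Keeping only one of the factors `f ≤ 1` is wasteful but suffices, and `f → 1` as `ε → 0`.
    have h1 : (b₀ * f) ^ (2 * k + 1) ≤ b₀ ^ (2 * k + 1) * f := by
      rw [mul_pow]
      exact mul_le_mul_of_nonneg_left (pow_le_of_le_one hf0.le hf1 (by omega)) (by positivity)
    calc _ = (V * Real.pi ^ (2 * k) * κ * (1 + ε) ^ 2) * (b₀ * f) ^ (2 * k + 1) := by ring
      _ ≤ (V * Real.pi ^ (2 * k) * κ * (1 + ε) ^ 2) * (b₀ ^ (2 * k + 1) * f) :=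
          mul_le_mul_of_nonneg_left h1 (by positivity)
      _ = (V * Real.pi ^ (2 * k) * κ * b₀ ^ (2 * k + 1)) * ((1 + ε) ^ 2 * f) := by ring
      _ = r / (1 + ε) * (1 - 3 * ε) := by rw [hb₀k, hf]; field_simp
  · rw [← hf, pinsker_eq hk hr hV hb₀0 (by rw [← hκ]; exact hb₀k)]
    ring

/-- The lower bound for the risk over the localized family with a given prior. -/
theorem minimax_ge_of_prior {k : ℕ} (hk : 1 ≤ k) {r : ℝ} (hr : 0 < r) {l : ℝ}
    (hl : 3 ≤ l) {g : I → C(I, ℝ) → ℝ} (hg : IsScale g)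
    (hg_pos : ∀ (S : sobolevClass k r) (x : I), 0 < g x (restrict S)) (h2 : CondH2 g)
    {ε c₀ C₀ C δ : ℝ} {n q M N i₀ : ℕ} (hε : 0 < ε) (hε1 : ε < 1)
    (hloc : LocalScale g ε c₀ C₀ C δ M) {μ : Measure I} [IsFiniteMeasure μ] (hμ : Localizes μ n q)
    {χ : ℝ → ℝ} (hχ : IsCutoff χ (ε / 8)) (hi₀ : 1 ≤ i₀) (hq : 0 < q) (hqε : 4 / ε ≤ q)
    (hn : 0 < n) (hMq : M * q ≤ n) (hNq : N ≤ q) {R : ℝ} (hR : 0 < R) (hRr : (1 + ε) * R ≤ r)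
    (hi₀δ : 4 / i₀ * R ≤ δ ^ 2)
    (hsob : ∀ θ : Idx M i₀ N → ℝ, (1 + ε) * wsq (weight k n q M i₀ N) θ ≤ r →
      ∃ S : sobolevClass k r, restrict S = synth (basisFn hχ n q M i₀ N) θ)
    {ρ ρ' : ℝ → ℝ} {L : ℝ} (hρ : ∀ t, HasDerivAt ρ (ρ' t) t)
    (hρ0 : ∀ t, R * (1 - ε) ≤ t → ρ t = 0) (hρ1 : ∀ t, 0 ≤ t → t ≤ R * (1 - 2 * ε) → ρ t = 1)
    (hρabs : ∀ t, |ρ t| ≤ 1) (hρ' : ∀ t, |ρ' t| ≤ L) (hρm : Measurable ρ')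
    {sg : Fin M → ℝ} (hsg : ∀ m : Fin M, sg m = scaleSq g ((m : ℕ) * ((q : ℝ) / n)))
    (hE : ∑ α : Idx M i₀ N, weight k n q M i₀ N α * priorVar k n N sg α ≤ R * (1 - 3 * ε))
    {β : ℝ} (hβ : ∀ α : Idx M i₀ N, weight k n q M i₀ N α * priorVar k n N sg α ≤ β)
    (hβ1 : (4 * L * β + 1) ^ 2 ≤ 1 + 2 * ε) (hβ2 : 2 * β ≤ ε ^ 3 * R) (T : Estimator n) :
    ENNReal.ofReal ((1 - ε) ^ 4 / (1 + 2 * ε) * ((∑ m, sg m) / n *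
        ∑ i ∈ Finset.Ico i₀ N, (1 - ((i : ℝ) / N) ^ k))) ≤
      (⨆ S : sobolevClass k r, riskWith μ g l T (restrict S) /
        ENNReal.ofReal (pinsker g k r (restrict S))) *
        ENNReal.ofReal ((1 + ε) * pinsker g k r 0) := by
  have hc₀ := hloc.low_pos
  have hq' : (0 : ℝ) < q := by exact_mod_cast hq
  have hqn : q ≤ n := le_trans (Nat.le_mul_of_pos_left q hloc.windows_pos) hMq
  have hV := hloc.half_le_varsigma hg hε1 (S := 0) (by simpa using hloc.radius_pos.le)
  have hnorm : ∀ θ, wsq (weight k n q M i₀ N) θ < R →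
      ‖synth (basisFn hχ n q M i₀ N) θ‖ ≤ δ := fun θ hθ =>
    le_of_sq_le_sq ((norm_synth_sq_le hχ hk hi₀ hq hqn θ).trans
      ((mul_le_mul_of_nonneg_left hθ.le (by positivity)).trans hi₀δ)) hloc.radius_pos.le
  have hmem : ∀ θ, wsq (weight k n q M i₀ N) θ < R →
      ∃ S : sobolevClass k r, restrict S = synth (basisFn hχ n q M i₀ N) θ := fun θ hθ =>
    hsob θ ((mul_le_mul_of_nonneg_left hθ.le (by linarith)).trans hRr)
  -- Half of the error is allotted to the cutoff, whose width is `ε / 8`, and half to the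
  -- discretization of the window.
  have hcut : 4 * (ε / 8) + 2 / (q : ℝ) ≤ ε := by
    have : 2 / (q : ℝ) ≤ ε / 2 := by
      rw [div_le_iff₀ hε] at hqε
      rw [div_le_div_iff₀ hq' two_pos]; linarith
    linarith
  refine localized_bayes hg.1 h2 hl hk hi₀ hn hMq hNq hμ hχ (by linarith) hε hε1 hcut hR hρ hρ0
    hρ1 hρabs hρ' hρm (fun m => by rw [hsg]; exact hc₀.trans_le (hloc.bounds _).1)
    (fun θ hθ x => ?_) (fun α θ hθ => ?_) hE hβ hβ1 hβ2 T (fun θ hθ => ?_)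
  · obtain ⟨S, hS⟩ := hmem θ hθ
    rw [← hS]
    exact hg_pos S x
  · have hα := Finset.mem_Ico.1 α.2.2
    rw [hsg]
    exact localized_info hχ hloc hMq α.1.2 (hi₀.trans hα.1) (hα.2.trans_le hNq) hε hε1
      (hnorm θ hθ)
  · obtain ⟨S, hS⟩ := hmem θ hθ
    have hSδ := hnorm θ hθ
    rw [← hS] at hSδ ⊢
    have hς := abs_le.1 (abs_varsigma_sub_le hg (hloc.close _ hSδ))
    have hςS := hloc.half_le_varsigma hg hε1 hSδ
    refine riskWith_le_iSup μ T S (pinsker_pos hk hr (by linarith)) (pinsker_le hr.le hε.le ?_)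
    nlinarith [hς.2]

/-- The lower bound for the normalized minimax risk, up to the factor `efficiency ε`. -/
theorem eventually_minimax_ge {k : ℕ} (hk : 1 ≤ k) {r : ℝ} (hr : 0 < r) {l : ℕ → ℝ}
    (hl : ∀ n, 3 ≤ l n) {g : I → C(I, ℝ) → ℝ} (hg : IsScale g)
    (hg_pos : ∀ (S : sobolevClass k r) (x : I), 0 < g x (restrict S))
    (h2 : CondH2 g) (h3 : CondH3 g) (h4 : CondH4 g) (hg0_pos : ∀ x, 0 < g x 0)
    (μ : ℕ → Measure I) [∀ n, IsFiniteMeasure (μ n)]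
    (hμ : ∀ n q, 0 < q → Localizes (μ n) n q) {ε : ℝ} (hε : 0 < ε) (hε3 : 3 * ε < 1) :
    ∀ᶠ n : ℕ in atTop, ENNReal.ofReal (efficiency ε) ≤
      ENNReal.ofReal ((n : ℝ) ^ (2 * k / (2 * k + 1) : ℝ)) *
        ⨅ T : Estimator n, ⨆ S : sobolevClass k r,
          riskWith (μ n) g (l n) T (restrict S) /
            ENNReal.ofReal (pinsker g k r (restrict S)) := by
  have hε1 : ε < 1 := by linarith
  have hk' : (0 : ℝ) < k := by exact_mod_cast hk
  have hpi := Real.pi_pos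
  obtain ⟨c₀, C₀, C, δ, M, hloc⟩ := exists_localScale hg.1 h3 h4 hg0_pos hε
  have hc₀ := hloc.low_pos
  have hC₀ : 0 < C₀ := hc₀.trans_le ((hloc.bounds 0).1.trans (hloc.bounds 0).2)
  have hM0 := hloc.windows_pos
  have hδ0 := hloc.radius_pos
  have hV0 : 0 < varsigma g 0 := lt_of_lt_of_le (by positivity)
    (hloc.half_le_varsigma hg hε1 (S := 0) (by simpa using hδ0.le))
  obtain ⟨χ, hχ⟩ := exists_isCutoff (η := ε / 8) (by positivity) (by linarith)
  obtain ⟨i₁, hi₁, hsob⟩ := exists_mem_sobolevClass hχ k hε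
  obtain ⟨R, hR⟩ : ∃ R, R = r / (1 + ε) := ⟨_, rfl⟩
  have hR0 : 0 < R := by rw [hR]; positivity
  -- The lowest frequency has two tasks: `i₁` controls the Sobolev norm, and `4R/δ²` keeps the
  -- family in the ball of radius `δ`.
  obtain ⟨i₀, hi₀⟩ := exists_nat_ge (max (i₁ : ℝ) (4 * R / δ ^ 2))
  have hi₁₀ : i₁ ≤ i₀ := by exact_mod_cast (le_max_left _ _).trans hi₀
  have hi₀1 : 1 ≤ i₀ := hi₁.trans hi₁₀
  have hi₀δ : 4 / i₀ * R ≤ δ ^ 2 := by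
    have h0 : (0 : ℝ) < i₀ := by exact_mod_cast hi₀1
    rw [div_mul_eq_mul_div, div_le_comm₀ h0 (by positivity)]
    exact (le_max_right _ _).trans hi₀
  -- The cutoff, and thus `L`, is fixed before `n`, while the energy of a single coordinate tends to
  -- zero; this makes the information due to the truncation negligible.
  obtain ⟨ρ, ρ', L, hρ, hρ0, hρ1, hρabs, hρ', hρm⟩ := exists_density_cutoff
    (a := R * (1 - 2 * ε)) (b := R * (1 - ε)) (mul_pos hR0 (by linarith))
    (mul_lt_mul_of_pos_left (by linarith) hR0)
  have hL : 0 ≤ L := (abs_nonneg _).trans (hρ' 0)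
  obtain ⟨b, hb0, hbk, hγ⟩ := exists_frequency_constant hk hr hV0 hε hε3
  rw [← hR] at hbk
  have hγ0 : 0 < pinsker g k r 0 := pinsker_pos hk hr hV0
  obtain ⟨κ, hκ⟩ : ∃ κ : ℝ, κ = k / ((k + 1) * (2 * k + 1)) := ⟨_, rfl⟩
  have hκ0 : 0 < κ := by rw [hκ]; positivity
  -- The first term keeps the effect of the truncation on the prior information small; the second is
  -- the requirement of Chebyshev's inequality.
  obtain ⟨β, hβdef⟩ : ∃ β, β = min (ε / (8 * (L + 1))) (ε ^ 3 * R / 2) := ⟨_, rfl⟩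
  have hβ0 : 0 < β := by rw [hβdef]; positivity
  have hβ1 : (4 * L * β + 1) ^ 2 ≤ 1 + 2 * ε := by
    have h1 : 4 * L * β ≤ ε / 2 := by
      calc 4 * L * β ≤ 4 * (L + 1) * (ε / (8 * (L + 1))) :=
            mul_le_mul (by linarith) (hβdef ▸ min_le_left _ _) hβ0.le (by positivity)
        _ = ε / 2 := by field_simp; ring
    have h2 : 0 ≤ 4 * L * β := by positivity
    calc (4 * L * β + 1) ^ 2 ≤ (ε / 2 + 1) ^ 2 := pow_le_pow_left₀ (by linarith) (by linarith) 2
      _ ≤ 1 + 2 * ε := by nlinarith only [hε, hε1]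
  have hβ2 : 2 * β ≤ ε ^ 3 * R := by
    have : β ≤ ε ^ 3 * R / 2 := hβdef ▸ min_le_right _ _
    linarith
  have hx := tendsto_frequencies (k := k) hM0 hb0
  filter_upwards [(tendsto_windowSize hM0).eventually_ge_atTop (4 / ε),
    hx.eventually_ge_atTop (1 / ε), hx.eventually_ge_atTop (1 / (ε * κ) + 1),
    hx.eventually_ge_atTop (i₀ / (ε * (k / (k + 1))) + 1),
    (tendsto_rate k).eventually_ge_atTop (C₀ * Real.pi ^ (2 * k) * b ^ (2 * k) / β),
    eventually_window_cover hM0 (by positivity : 0 < ε * c₀ / 4 / C₀), eventually_mul_rate_le hk b,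
    eventually_gt_atTop 0] with n hqε hx1 hx2 hx3 hsβ hcov hbs hn
  have hMq : M * (n / M) ≤ n := Nat.mul_div_le n M
  generalize n / M = q at *
  have hs : rate k n ^ (2 * k + 1) = n := rate_pow k n
  have hn' : (0 : ℝ) < n := by exact_mod_cast hn
  have hs0 : 0 < rate k n := Real.rpow_pos_of_pos hn' _
  rw [rpow_eq_div_rate hn]
  generalize rate k n = s at *
  have hq' : (0 : ℝ) < q := lt_of_lt_of_le (by positivity) hqε
  have hq : 0 < q := by exact_mod_cast hq'
  -- Rounding down keeps the energy within the budget; the eventual lower bounds on the unrounded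
  -- number absorb the loss of at most one frequency.
  obtain ⟨N, hN⟩ : ∃ N, N = ⌊b * ((q : ℝ) / n) * s⌋₊ := ⟨_, rfl⟩
  have hNx : (N : ℝ) ≤ b * ((q : ℝ) / n) * s := hN ▸ Nat.floor_le (by positivity)
  have hxN : b * ((q : ℝ) / n) * s < N + 1 := hN ▸ Nat.lt_floor_add_one _
  have hNκ0 : 1 / (ε * κ) ≤ N := by linarith only [hx2, hxN]
  have hN' : (0 : ℝ) < N := lt_of_lt_of_le (by positivity) hNκ0
  have hN1 : 1 ≤ N := by exact_mod_cast hN'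
  have hNε : (1 - ε) * (b * ((q : ℝ) / n) * s) ≤ N := by
    rw [div_le_iff₀ hε] at hx1
    linarith only [hx1, hxN]
  have hNκ : κ + 1 / (N : ℝ) ≤ κ * (1 + ε) := by
    rw [div_le_iff₀ (by positivity)] at hNκ0
    have : 1 / (N : ℝ) ≤ κ * ε := by rw [div_le_iff₀ hN']; linarith only [hNκ0]
    linarith only [this]
  have hiN : (i₀ : ℝ) ≤ ε * (k / (k + 1) * N) := by
    have : i₀ / (ε * (k / (k + 1))) ≤ (N : ℝ) := by linarith only [hx3, hxN]
    rw [div_le_iff₀ (by positivity)] at this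
    linarith only [this]
  have hi₀N : i₀ ≤ N := by
    have h1 : (k : ℝ) / (k + 1) ≤ 1 := by rw [div_le_one (by positivity)]; linarith
    have : (i₀ : ℝ) ≤ N := by
      calc (i₀ : ℝ) ≤ ε * (k / (k + 1) * N) := hiN
        _ ≤ 1 * (1 * N) := by gcongr
        _ = N := by ring
    exact_mod_cast this
  have hNq : N ≤ q := by
    have : (N : ℝ) ≤ q := by
      calc (N : ℝ) ≤ b * s * (q / n) := hNx.trans_eq (by ring)
        _ ≤ n * (q / n) := mul_le_mul_of_nonneg_right hbs (by positivity)
        _ = q := by field_simp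
    exact_mod_cast this
  obtain ⟨sg, hsg⟩ : ∃ sg : Fin M → ℝ, ∀ m : Fin M,
    sg m = scaleSq g ((m : ℕ) * ((q : ℝ) / n)) := ⟨_, fun _ => rfl⟩
  have hsg0 : ∀ m, 0 ≤ sg m := fun m => hsg m ▸ hc₀.le.trans (hloc.bounds _).1
  have hav := abs_le.1 (window_average hg h4 hloc hMq hn hε hε1 hcov)
  simp_rw [← hsg] at hav
  have hE : ∑ α : Idx M i₀ N, weight k n q M i₀ N α * priorVar k n N sg α ≤ R * (1 - 3 * ε) := by
    refine (prior_energy_le hsg0 hi₀1 hN1 hq hn hs hNx).trans (le_trans ?_ hbk)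
    have h1 : (q : ℝ) / n * ∑ m, sg m ≤ varsigma g 0 * (1 + ε) := by linarith only [hav.2]
    rw [← hκ]
    gcongr
  have hβ : ∀ α : Idx M i₀ N, weight k n q M i₀ N α * priorVar k n N sg α ≤ β := fun α =>
    (prior_coordinate_le hsg0 (fun m => hsg m ▸ (hloc.bounds _).2) hi₀1 hq hn hs0 hs hNx α).trans
      ((div_le_comm₀ hs0 hβ0).2 hsβ)
  rw [ENNReal.mul_iInf_of_ne (ENNReal.ofReal_pos.2 (by positivity)).ne' ENNReal.ofReal_ne_top]
  refine le_iInf fun T => ?_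
  have hbayes := minimax_ge_of_prior hk hr (hl n) hg hg_pos h2 hε hε1 hloc (hμ n q hq) hχ hi₀1 hq
    hqε hn hMq hNq hR0 (by rw [hR, mul_div_cancel₀ _ (by positivity)]) hi₀δ
    (hsob i₀ hi₁₀ n q M N r hq hM0 hMq) hρ hρ0 hρ1 hρabs hρ' hρm hsg hE hβ hβ1 hβ2 T
  -- The factors of `efficiency` are `(1-ε)^4/(1+2ε)` from the van Trees bound, `(1-ε)^3` from the
  -- sums, `(1-3ε)/(1+ε)^3` from the choice of `b`, and `1/(1+ε)` from replacing `γ_k(S)` by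
  -- `γ_k(0)`.
  have hreal : efficiency ε * ((1 + ε) * pinsker g k r 0) ≤
      (n / s) * ((1 - ε) ^ 4 / (1 + 2 * ε) * ((∑ m, sg m) / n *
        ∑ i ∈ Finset.Ico i₀ N, (1 - ((i : ℝ) / N) ^ k))) := by
    have h1 := risk_sum_ge (k := k) (n := n) (V := varsigma g 0) hn' hs0
      (Finset.sum_nonneg fun m _ => hsg0 m) hb0.le hε1 (by linarith only [hav.1]) hN1 hi₀N hNε hiN
    calc efficiency ε * ((1 + ε) * pinsker g k r 0) = (1 - ε) ^ 4 / (1 + 2 * ε) *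
          ((1 - ε) ^ 3 * (varsigma g 0 * b * (k / (k + 1)))) := by
          rw [hγ, efficiency, pinsker]
          field_simp
      _ ≤ (1 - ε) ^ 4 / (1 + 2 * ε) * _ := mul_le_mul_of_nonneg_left h1 (by positivity)
      _ = _ := by ring
  have hγε : ENNReal.ofReal ((1 + ε) * pinsker g k r 0) ≠ 0 :=
    (ENNReal.ofReal_pos.2 (by positivity)).ne'
  refine (ENNReal.mul_le_mul_iff_left hγε ENNReal.ofReal_ne_top).1 ?_
  rw [← ENNReal.ofReal_mul' (by positivity), mul_assoc]
  refine (ENNReal.ofReal_le_ofReal hreal).trans ?_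
  rw [ENNReal.ofReal_mul (by positivity)]
  exact mul_le_mul_right hbayes _

lemma zero_mem_sobolevClass (k : ℕ) {r : ℝ} (hr : 0 ≤ r) : (0 : ℝ → ℝ) ∈ sobolevClass k r := by
  refine ⟨contDiff_const, fun _ => rfl, ?_⟩
  have h : ∀ j, iteratedDeriv j (0 : ℝ → ℝ) = 0 := fun j => by
    ext x
    cases j <;> simp
  simpa [h] using hr

/-- For each small `ε` the liminf is at least `efficiency ε`; then `ε` tends to 0. The scale is
positive at zero because the zero function belongs to the class. -/
lemma one_le_liminf_minimax {k : ℕ} (hk : 1 ≤ k) {r : ℝ} (hr : 0 < r) {l : ℕ → ℝ}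
    (hl : ∀ n, 3 ≤ l n) {g : I → C(I, ℝ) → ℝ} (hg : IsScale g)
    (hg_pos : ∀ (S : sobolevClass k r) (x : I), 0 < g x (restrict S))
    (h2 : CondH2 g) (h3 : CondH3 g) (h4 : CondH4 g)
    (μ : ℕ → Measure I) [∀ n, IsFiniteMeasure (μ n)]
    (hμ : ∀ n q, 0 < q → Localizes (μ n) n q) :
    1 ≤ liminf (fun n : ℕ => ENNReal.ofReal ((n : ℝ) ^ (2 * k / (2 * k + 1) : ℝ)) *
        ⨅ T : Estimator n, ⨆ S : sobolevClass k r,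
          riskWith (μ n) g (l n) T (restrict S) /
            ENNReal.ofReal (pinsker g k r (restrict S))) atTop := by
  have hg0_pos : ∀ x, 0 < g x 0 := fun x => hg_pos ⟨0, zero_mem_sobolevClass k hr.le⟩ x
  have h1 : Tendsto (fun ε => ENNReal.ofReal (efficiency ε)) (𝓝[>] 0) (𝓝 1) := by
    rw [← ENNReal.ofReal_one]
    exact ENNReal.tendsto_ofReal (tendsto_efficiency.mono_left nhdsWithin_le_nhds)
  refine le_of_tendsto h1 ?_
  filter_upwards [Ioo_mem_nhdsGT (by norm_num : (0 : ℝ) < 1 / 3)] with ε hε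
  exact le_liminf_of_le (by isBoundedDefault)
    (eventually_minimax_ge hk hr hl hg hg_pos h2 h3 h4 hg0_pos μ hμ hε.1 (by linarith [hε.2]))

end Pinsker

end

theorem theorem4p3 (k : ℕ) (hk : 1 ≤ k) (r : ℝ) (hr : 0 < r)
    -- the bounds on the fourth moments of the noise: a slowly increasing sequence
    (l : ℕ → ℝ) (hl3 : ∀ n, 3 ≤ l n) (hl_top : Tendsto l atTop atTop)
    (hl_slow : ∀ ν : ℝ, 0 < ν → Tendsto (fun n : ℕ => l n / (n : ℝ) ^ ν) atTop (𝓝 0))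
    -- the scale functional, nondegenerate on the Sobolev class
    (g : I → C(I, ℝ) → ℝ) (hg : Pinsker.IsScale g)
    (hg_pos : ∀ (S : Pinsker.sobolevClass k r) (x : I), 0 < g x (Pinsker.restrict S))
    (h2 : Pinsker.CondH2 g) (h3 : Pinsker.CondH3 g) (h4 : Pinsker.CondH4 g) :
    (1 ≤ liminf (fun n : ℕ =>
        ENNReal.ofReal ((n : ℝ) ^ (2 * k / (2 * k + 1) : ℝ)) *
          ⨅ T : Pinsker.Estimator n, ⨆ S : Pinsker.sobolevClass k r,
            Pinsker.riskEmp g (l n) T (Pinsker.restrict S) /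
              ENNReal.ofReal (Pinsker.pinsker g k r (Pinsker.restrict S))) atTop) ∧
    (1 ≤ liminf (fun n : ℕ =>
        ENNReal.ofReal ((n : ℝ) ^ (2 * k / (2 * k + 1) : ℝ)) *
          ⨅ T : Pinsker.Estimator n, ⨆ S : Pinsker.sobolevClass k r,
            Pinsker.riskL2 g (l n) T (Pinsker.restrict S) /
              ENNReal.ofReal (Pinsker.pinsker g k r (Pinsker.restrict S))) atTop) := by
  constructor
  · simp_rw [Pinsker.riskEmp_eq]
    exact Pinsker.one_le_liminf_minimax hk hr hl3 hg hg_pos h2 h3 h4 Pinsker.designMeasure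
      fun _ _ => Pinsker.localizes_design
  · exact Pinsker.one_le_liminf_minimax hk hr hl3 hg hg_pos h2 h3 h4 (fun _ => volume)
      fun _ _ => Pinsker.localizes_volume
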